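/- Let $\mathbb D=\{|z|<1\}$. Consider the three geometries: $E^2=\mathbb C$ with metric $|dw|^2$; $H^2=\{|w|<1\}$ with metric $4|dw|^2/(1-|w|^2)^2$; and $S^2=\mathbb C\cup\{\infty\}$, the round unit sphere, with metric $4|dw|^2/(1+|w|^2)^2$. Let $X$ be one of them and $\delta$ its metric. A distorted disk in $X$ is a continuous map $F:\overline{\mathbb D}\to X$ whose restriction to $\mathbb D$ is an orientation-preserving $C^1$ immersion and which, if $X=S^2$, is moreover injective near each boundary point (this holds whenever $F$ is a $C^1$ immersion of the closed disk). Let $A[F^*\delta]$ be the area of $\mathbb D$ for the pulled back constant curvature metric $F^*\delta$, and let $A[\Omega]$ be the area of $\Omega\subset X$ for $\delta$. Let $\gamma:\mathbb R/2\pi\mathbb Z\to X$ be a continuous, piecewise $C^1$ closed curve. We say that $F$ is bounded by $\gamma$ if $F|_{\partial\mathbb D}$ is $\gamma$ up to an orientation-preserving reparametrization. (1) Let $X=E^2$ or $H^2$. The winding number $\frac1{2\pi i}\int_0^{2\pi}\frac{\gamma'}{\gamma-w}\,d\theta$ is an integer $\nu(\Omega)$ for all $w$ in a component $\Omega$ of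 $\mathbb C\setminus\operatorname{Im}\gamma$. If a distorted disk $F$ is bounded by $\gamma$, then each $w\in\Omega$ has exactly $\nu(\Omega)$ preimages in $\mathbb D$, the area $A[F^*\delta]$ is finite, and $$A[F^*\delta]=\sum_i\nu(\Omega_i)\,A[\Omega_i],$$ where the sum is over the bounded components $\Omega_i$ of $\mathbb C\setminus\operatorname{Im}\gamma$. (2) Let $X=S^2$. There are integers $\nu(\Omega)$, one for each component $\Omega$ of $S^2\setminus\operatorname{Im}\gamma$ and depending only on $\gamma$, such that for every distorted disk $F$ bounded by $\gamma$ each point of $\Omega$ has exactly $\nu(\Omega)$ preimages in $\mathbb D$, the area $A[F^*\delta]$ is finite, and $A[F^*\delta]=\sum_i\nu(\Omega_i)A[\Omega_i]$, where the sum is over all components $\Omega_i$ of $S^2\setminus\operatorname{Im}\gamma$. If $\infty\notin\operatorname{Im}\gamma$ and $\Omega_\infty$ is the component containing $\infty$, then $\nu(\Omega)-\nu(\Omega_\infty)$ is the winding number of $\gamma$ around any $w\in\Omega\setminus\{\infty\}$; so $\nu(\Omega)$ is the winding number itself when $F$ does not cover $\infty$. In all three cases, any two distorted disks bounded by the same curve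 $\gamma$ have equal area. -/

import Mathlib

open Set Metric MeasureTheory
open scoped Topology Real

noncomputable section

namespace DistortedDisk

/-! ### Closed curves and winding numbers -/

/-- A closed curve: a continuous `2π`-periodic map that is piecewise `C¹`, i.e. `C¹` (up to the
end points) on each of the finitely many closed intervals of a subdivision of `[0, 2π]`. -/
structure IsClosedCurve {E : Type*} [NormedAddCommGroup E] [NormedSpace ℝ E] (γ : ℝ → E) :
    Prop where
  continuous : Continuous γ
  periodic : ∀ θ, γ (θ + 2 * π) = γ θ
  piecewise : ∃ (n : ℕ) (t : ℕ → ℝ), Monotone t ∧ t 0 = 0 ∧ t n = 2 * π ∧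
    ∀ i < n, ContDiffOn ℝ 1 γ (Icc (t i) (t (i + 1)))

/-- The winding number `(2πi)⁻¹ ∫ γ' / (γ - w) dθ` of a closed curve in `ℂ` around `w`. -/
def windingNumber (γ : ℝ → ℂ) (w : ℂ) : ℂ :=
  (2 * π * Complex.I)⁻¹ * ∫ θ in (0 : ℝ)..(2 * π), deriv γ θ / (γ θ - w)

/-- The connected components of `X \ K`. -/
def complementComponents {E : Type*} [TopologicalSpace E] (X K : Set E) : Set (Set E) :=
  {Ω | ∃ P ∈ X \ K, Ω = connectedComponentIn (X \ K) P}

/-- The closed curve `γ` is the boundary of the map `F` of the closed unit disk: up to an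
orientation preserving reparametrization, `F` restricted to the unit circle is `γ`. -/
def Bounds {E : Type*} (γ : ℝ → E) (F : ℂ → E) : Prop :=
  ∃ φ : ℝ → ℝ, Continuous φ ∧ StrictMono φ ∧ (∀ θ, φ (θ + 2 * π) = φ θ + 2 * π) ∧
    ∀ θ : ℝ, F (Complex.exp (θ * Complex.I)) = γ (φ θ)

/-- The points of the open unit disk above `P`; their number is the number of layers at `P`. -/
def layers {E : Type*} (F : ℂ → E) (P : E) : Set ℂ :=
  {z | z ∈ ball (0 : ℂ) 1 ∧ F z = P}

/-! ### Pulled back metrics and areas -/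

/-- The pull-back by `F` of the metric `ρ(p) ⟨·, ·⟩`, as a field of bilinear forms on the disk. -/
def pullbackMetric {E : Type*} [NormedAddCommGroup E] [InnerProductSpace ℝ E]
    (ρ : E → ℝ) (F : ℂ → E) (z u v : ℂ) : ℝ :=
  ρ (F z) * inner ℝ (fderiv ℝ F z u) (fderiv ℝ F z v)

/-- The area `∫ √(det g) dx dy` of the open unit disk for the metric `g`. -/
def diskArea (g : ℂ → ℂ → ℂ → ℝ) : ENNReal :=
  ∫⁻ z in ball (0 : ℂ) 1,
    ENNReal.ofReal (√(g z 1 1 * g z Complex.I Complex.I - g z 1 Complex.I * g z Complex.I 1))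

/-! ### The Euclidean and the hyperbolic plane -/

inductive PlaneGeometry
  | euclidean
  | hyperbolic

namespace PlaneGeometry

/-- `E²` is `ℂ`, and `H²` is the open unit disk (Poincaré model). -/
def domain : PlaneGeometry → Set ℂ
  | euclidean => univ
  | hyperbolic => ball 0 1

/-- The metric is `factor w * |dw|²`: `|dw|²` on `E²` and `4 |dw|² / (1 - |w|²)²` on `H²`. -/
def factor : PlaneGeometry → ℂ → ℝ
  | euclidean => fun _ => 1
  | hyperbolic => fun w => 4 / (1 - ‖w‖ ^ 2) ^ 2

/-- The area of a set for the metric `factor w * |dw|²`. -/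
def setArea (G : PlaneGeometry) (Ω : Set ℂ) : ENNReal :=
  ∫⁻ w in Ω, ENNReal.ofReal (G.factor w)

/-- A distorted disk in `E²` or `H²`: a map of the closed unit disk, continuous up to the
boundary, which is an orientation preserving `C¹` immersion of the open disk. -/
structure IsDistortedDisk (G : PlaneGeometry) (F : ℂ → ℂ) : Prop where
  continuousOn : ContinuousOn F (closedBall 0 1)
  mapsTo : MapsTo F (closedBall 0 1) G.domain
  contDiffOn : ContDiffOn ℝ 1 F (ball 0 1)
  det_pos : ∀ z ∈ ball (0 : ℂ) 1, 0 < (fderiv ℝ F z).det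

/-- The area of the disk for the metric pulled back by `F`. -/
def area (G : PlaneGeometry) (F : ℂ → ℂ) : ENNReal :=
  diskArea (pullbackMetric G.factor F)

end PlaneGeometry

/-! ### The round sphere -/

/-- Euclidean three-space; `S²` is its unit sphere with the induced metric. -/
abbrev Space := EuclideanSpace ℝ (Fin 3)

namespace Sphere

/-- The round unit two-sphere. -/
def domain : Set Space := sphere 0 1

/-- The point at infinity of the projective coordinate. -/
def infinity : Space := !₂[0, 0, -1]

/-- The projective coordinate `w = (x₀ + i x₁) / (1 + x₂)` on `S² \ {infinity}`, in which the
metric of the sphere is `4 |dw|² / (1 + |w|²)²`. -/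
def coord (p : Space) : ℂ := (p 0 + p 1 * Complex.I) / (1 + p 2)

/-- The area of a subset of the sphere (total area `4π`). -/
def setArea (Ω : Set Space) : ENNReal :=
  (volume : Measure Space).toSphere (Subtype.val ⁻¹' Ω)

/-- A distorted disk in `S²`: a map of the closed unit disk, continuous up to the boundary, which
is a `C¹` immersion of the open disk, orientation preserving for the outward orientation of the
sphere, and which is injective near each boundary point. -/
structure IsDistortedDisk (F : ℂ → Space) : Prop where
  continuousOn : ContinuousOn F (closedBall 0 1)
  mapsTo : MapsTo F (closedBall 0 1) domain
  contDiffOn : ContDiffOn ℝ 1 F (ball 0 1)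
  det_pos : ∀ z ∈ ball (0 : ℂ) 1, 0 < (Matrix.of fun i j : Fin 3 =>
    (![F z, fderiv ℝ F z 1, fderiv ℝ F z Complex.I] i) j).det
  locally_injective : ∀ z ∈ sphere (0 : ℂ) 1, ∃ U ∈ 𝓝 z, InjOn F (U ∩ closedBall 0 1)

/-- The area of the disk for the metric pulled back by `F`. -/
def area (F : ℂ → Space) : ENNReal :=
  diskArea (pullbackMetric (fun _ => 1) F)

end Sphere

end DistortedDisk

end

noncomputable section

namespace DistortedDisk

/-! ### The degree of a periodic map to the punctured plane -/

/-! Plane case. For `P` off the curve, `F - P` is continuous on the closed disk, has no zero on the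
circle, and near each zero it behaves like an orientation preserving linear map. By the argument
principle (`hasDegree_ncard_zeros`) the number of zeros is the degree of `γ - P`, which is the
winding number (`IsClosedCurve.windingNumber_eq`). The area formula (`lintegral_eq_lintegral_count`)
makes the area of the disk the integral of the number of layers. The curve is a null set, so this
integral splits into a sum over the components of its complement. Finiteness needs an argument,
since `F` is differentiable only inside the disk and the winding number may be unbounded: it is
dominated by a multiple of the integral of `1 / |γ - w|` over the curve, and `1 / |w|` is locally
integrable in the plane (`IsClosedCurve.lintegral_windingNumber_ne_top`).

Sphere. Points of the sphere are complex lines in `ℂ²`. A map of the disk lifts to a continuous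
nowhere zero map `Φ` (`Sphere.exists_lift`), and `F z = P` exactly when `wedge p (Φ z) = 0` for a
vector `p` on the line of `P`. The argument principle then counts the layers at `P` as the degree of
`wedge p Γ`, where `Γ` is the closed lift of `γ` given by the boundary values of `Φ`. This lift is
not determined by `γ`: multiplying it by a loop `k` of degree `d` in the punctured plane shifts
every count by `d`.

The ambiguity is removed by a second degree. For small `ε > 0` the loop `wedge (Γ θ) (Γ (θ + ε))`
has degree one (`Sphere.hasDegree_wedge_rotate`): pull the two boundary points radially towards the
centre, where they visibly turn once around each other. On the way `F` never identifies them,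
because `F` is injective at a uniform small scale; injectivity near the boundary is what makes this
scale uniform. Multiplication by `k` changes the second degree by `2d`, so `d = 0` for the lifts of
two disks with the same boundary (`Sphere.IsCurveLift.hasDegree_eq`). For the finiteness of the
area, a point off the curve is rotated to infinity; the number of layers is then a constant plus a
planar winding number. -/

/-- The `2π`-periodic map `f : ℝ → ℂ \ {0}` is continuous and has degree `n`. -/
def HasDegree (f : ℝ → ℂ) (n : ℤ) : Prop :=
  ∃ g : ℝ → ℂ, Continuous g ∧ (∀ θ, f θ = Complex.exp (g θ)) ∧
    ∀ θ, g (θ + 2 * π) = g θ + n * (2 * π * Complex.I)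

/-- The values lie in the discrete set `2πi ℤ`. This is the only rigidity that the theory of the
degree needs. -/
lemma eq_of_continuous_exp_eq_one {X : Type*} [TopologicalSpace X] [PreconnectedSpace X]
    {g : X → ℂ} (hg : Continuous g) (h : ∀ x, Complex.exp (g x) = 1) (x y : X) : g x = g y := by
  choose k hk using fun x => Complex.exp_eq_one_iff.1 (h x)
  have hc : Continuous k := by
    rw [Int.isClosedEmbedding_coe_real.isInducing.continuous_iff]
    have : (Int.cast : ℤ → ℝ) ∘ k = fun x => (g x / (2 * π * Complex.I)).re := by
      funext x
      rw [hk x, mul_div_cancel_right₀ _ Complex.two_pi_I_ne_zero]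
      simp
    rw [this]
    fun_prop
  rw [hk x, hk y, PreconnectedSpace.constant inferInstance hc]

namespace HasDegree

variable {f g : ℝ → ℂ} {m n : ℤ}

lemma continuous (hf : HasDegree f n) : Continuous f := by
  obtain ⟨g, hg, h, -⟩ := hf
  rw [funext h]
  fun_prop

lemma ne_zero (hf : HasDegree f n) (θ : ℝ) : f θ ≠ 0 := by
  obtain ⟨g, -, h, -⟩ := hf
  rw [h]
  exact Complex.exp_ne_zero _

lemma periodic (hf : HasDegree f n) (θ : ℝ) : f (θ + 2 * π) = f θ := by
  obtain ⟨g, -, h, h'⟩ := hf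
  rw [h, h, h', Complex.exp_add, Complex.exp_int_mul_two_pi_mul_I, mul_one]

lemma mul (hf : HasDegree f m) (hg : HasDegree g n) :
    HasDegree (fun θ => f θ * g θ) (m + n) := by
  obtain ⟨a, ha, h1, h2⟩ := hf
  obtain ⟨b, hb, h3, h4⟩ := hg
  refine ⟨fun θ => a θ + b θ, ha.add hb, fun θ => ?_, fun θ => ?_⟩
  · simp only [h1, h3, Complex.exp_add]
  · simp only [h2, h4]
    push_cast
    ring

lemma inv (hf : HasDegree f m) : HasDegree (fun θ => (f θ)⁻¹) (-m) := by
  obtain ⟨a, ha, h1, h2⟩ := hf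
  refine ⟨fun θ => -a θ, ha.neg, fun θ => ?_, fun θ => ?_⟩
  · simp only [h1, Complex.exp_neg]
  · simp only [h2]
    push_cast
    ring

lemma div (hf : HasDegree f m) (hg : HasDegree g n) :
    HasDegree (fun θ => f θ / g θ) (m - n) := by
  simpa only [div_eq_mul_inv, sub_eq_add_neg] using hf.mul hg.inv

lemma unique (hf : HasDegree f m) (hg : HasDegree f n) : m = n := by
  obtain ⟨g, hg, h1, h2⟩ := hf.div hg
  have h3 : ∀ θ, Complex.exp (g θ) = 1 := fun θ => by
    rw [← h1]
    exact div_self (hf.ne_zero θ)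
  have h4 := h2 0
  rw [eq_of_continuous_exp_eq_one hg h3 (0 + 2 * π) 0, left_eq_add, mul_eq_zero,
    or_iff_left Complex.two_pi_I_ne_zero] at h4
  exact sub_eq_zero.1 (by exact_mod_cast h4)

lemma comp (hf : HasDegree f n) {φ : ℝ → ℝ} (hφ : Continuous φ)
    (hφ' : ∀ θ, φ (θ + 2 * π) = φ θ + 2 * π) : HasDegree (fun θ => f (φ θ)) n := by
  obtain ⟨g, hg, h1, h2⟩ := hf
  exact ⟨fun θ => g (φ θ), hg.comp hφ, fun θ => h1 _, fun θ => by simp only [hφ', h2]⟩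

lemma of_slitPlane (hf : Continuous f) (hp : ∀ θ, f (θ + 2 * π) = f θ)
    (h : ∀ θ, f θ ∈ Complex.slitPlane) : HasDegree f 0 := by
  refine ⟨fun θ => Complex.log (f θ), hf.clog h, fun θ => ?_, fun θ => ?_⟩
  · rw [Complex.exp_log (Complex.slitPlane_ne_zero (h θ))]
  · simp [hp]

lemma const {c : ℂ} (hc : c ≠ 0) : HasDegree (fun _ => c) 0 :=
  ⟨fun _ => Complex.log c, continuous_const, fun _ => (Complex.exp_log hc).symm, by simp⟩

lemma exp_mul_I : HasDegree (fun θ => Complex.exp (θ * Complex.I)) 1 :=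
  ⟨fun θ => θ * Complex.I, by fun_prop, fun _ => rfl, fun θ => by push_cast; ring⟩

/-- Rouché's theorem. -/
lemma of_norm_sub_lt (hg : HasDegree g n) (hf : Continuous f) (hp : ∀ θ, f (θ + 2 * π) = f θ)
    (h : ∀ θ, ‖f θ - g θ‖ < ‖g θ‖) : HasDegree f n := by
  have h1 : HasDegree (fun θ => f θ / g θ) 0 := by
    refine of_slitPlane (hf.div hg.continuous hg.ne_zero) (fun θ => by rw [hp, hg.periodic])
      fun θ => ?_
    have h0 := norm_pos_iff.2 (hg.ne_zero θ)
    have h2 : ‖f θ / g θ - 1‖ < 1 := by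
      rw [div_sub_one (hg.ne_zero θ), norm_div, div_lt_one h0]
      exact h θ
    have := Complex.mem_slitPlane_of_norm_lt_one h2
    simpa using this
  have h2 := h1.mul hg
  simpa [div_mul_cancel₀ _ (hg.ne_zero _)] using h2

lemma exists_of_continuous (hf : Continuous f) (hp : ∀ θ, f (θ + 2 * π) = f θ)
    (h0 : ∀ θ, f θ ≠ 0) : ∃ n, HasDegree f n := by
  have : ContractibleSpace (univ : Set ℝ) := convex_univ.contractibleSpace univ_nonempty
  have hsc : IsSimplyConnected (univ : Set ℝ) :=
    inferInstanceAs (SimplyConnectedSpace (univ : Set ℝ))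
  obtain ⟨g, hg, hgf⟩ := Complex.exists_continuousOn_eqOn_exp_comp hsc isOpen_univ hf.continuousOn
    (by simpa using h0)
  rw [continuousOn_univ] at hg
  have hgf : ∀ θ, Complex.exp (g θ) = f θ := fun θ => hgf (mem_univ θ)
  have h1 : ∀ θ, Complex.exp (g (θ + 2 * π) - g θ) = 1 := fun θ => by
    rw [Complex.exp_sub, hgf, hgf, hp, div_self (h0 θ)]
  obtain ⟨n, hn⟩ := Complex.exp_eq_one_iff.1 (h1 0)
  refine ⟨n, g, hg, fun θ => (hgf θ).symm, fun θ => ?_⟩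
  have h2 := eq_of_continuous_exp_eq_one (by fun_prop) h1 θ 0
  rw [← hn, ← h2]
  ring

end HasDegree

lemma forall_of_forall_mem_Icc {p : ℝ → Prop} (hp : ∀ θ, p (θ + 2 * π) ↔ p θ)
    (h : ∀ θ ∈ Icc 0 (2 * π), p θ) (θ : ℝ) : p θ := by
  have hq : Function.Periodic p (2 * π) := fun θ => propext (hp θ)
  obtain ⟨y, hy, h2⟩ := hq.exists_mem_Ico₀ Real.two_pi_pos θ
  rw [h2]
  exact h y (Ico_subset_Icc_self hy)

/-- Loops uniformly close to a given one have the same degree. -/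
lemma HasDegree.eventually {X : Type*} {l : Filter X} {H : X → ℝ → ℂ} {f : ℝ → ℂ} {n : ℤ}
    (hf : HasDegree f n) (hc : ∀ᶠ x in l, Continuous (H x))
    (hp : ∀ᶠ x in l, ∀ θ, H x (θ + 2 * π) = H x θ)
    (ht : ∀ θ, Filter.Tendsto (Function.uncurry H) (l ×ˢ 𝓝 θ) (𝓝 (f θ))) :
    ∀ᶠ x in l, HasDegree (H x) n := by
  have h1 : ∀ᶠ x in l, ∀ θ ∈ Icc 0 (2 * π), ‖H x θ - f θ‖ < ‖f θ‖ := by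
    -- Tube lemma over one compact period: the pointwise limits in `l ×ˢ 𝓝 θ` give Rouché's
    -- inequality for all `θ` at once.
    have h2 : {q : X × ℝ | ‖H q.1 q.2 - f q.2‖ < ‖f q.2‖} ∈ l ×ˢ 𝓝ˢ (Icc 0 (2 * π)) := by
      refine isCompact_Icc.mem_prod_nhdsSet_of_forall fun θ _ => ?_
      have h4 : Filter.Tendsto (fun q : X × ℝ => f q.2) (l ×ˢ 𝓝 θ) (𝓝 (f θ)) :=
        (hf.continuous.tendsto θ).comp Filter.tendsto_snd
      have h5 : ‖f θ - f θ‖ - ‖f θ‖ < 0 := by simpa using hf.ne_zero θ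
      filter_upwards [(((ht θ).sub h4).norm.sub h4.norm).eventually (gt_mem_nhds h5)] with q hq
      exact sub_neg.1 hq
    exact (Filter.Eventually.curry h2).mono fun _ h => h.self_of_nhdsSet
  filter_upwards [h1, hc, hp] with x hx hx1 hx2
  exact hf.of_norm_sub_lt hx1 hx2
    (forall_of_forall_mem_Icc (fun θ => by rw [hx2, hf.periodic]) hx)

/-- Homotopic loops have the same degree. -/
lemma HasDegree.of_homotopy {H : ℝ → ℝ → ℂ} {r s : ℝ} (hrs : r ≤ s)
    (hH : ContinuousOn (Function.uncurry H) (Icc r s ×ˢ univ))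
    (hp : ∀ t ∈ Icc r s, ∀ θ, H t (θ + 2 * π) = H t θ)
    (h0 : ∀ t ∈ Icc r s, ∀ θ, H t θ ≠ 0) {n : ℤ} (hn : HasDegree (H r) n) :
    HasDegree (H s) n := by
  have hc : ∀ t ∈ Icc r s, Continuous (H t) := fun t ht => by
    have h1 : ContinuousOn (Function.uncurry H ∘ fun θ : ℝ => (t, θ)) univ :=
      hH.comp (by fun_prop) (fun θ _ => ⟨ht, mem_univ θ⟩)
    exact continuousOn_univ.1 h1
  choose! d hd using fun t (ht : t ∈ Icc r s) =>
    HasDegree.exists_of_continuous (hc t ht) (hp t ht) (h0 t ht)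
  -- The degree is locally constant in the parameter of the homotopy, hence constant on the
  -- connected interval.
  have hdc : ContinuousOn d (Icc r s) := by
    intro t ht
    refine (continuousWithinAt_const (b := d t)).congr_of_eventuallyEq ?_ rfl
    have h1 : ∀ᶠ u in 𝓝[Icc r s] t, HasDegree (H u) (d t) := by
      refine (hd t ht).eventually ?_ ?_ fun θ => ?_
      · filter_upwards [self_mem_nhdsWithin] using hc
      · filter_upwards [self_mem_nhdsWithin] using hp
      · have h2 : ContinuousWithinAt (Function.uncurry H) (Icc r s ×ˢ univ) (t, θ) :=
          hH _ ⟨ht, mem_univ _⟩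
        rwa [ContinuousWithinAt, nhdsWithin_prod_eq, nhdsWithin_univ] at h2
    filter_upwards [h1, self_mem_nhdsWithin] with u hu hu'
    exact (hd u hu').unique hu
  have h1 := isPreconnected_Icc.constant hdc (left_mem_Icc.2 hrs) (right_mem_Icc.2 hrs)
  have h2 := hd s (right_mem_Icc.2 hrs)
  rwa [← h1, (hd r (left_mem_Icc.2 hrs)).unique hn] at h2

/-! ### Simple zeros -/

/-- `f` behaves near its zero `z₀` like an orientation preserving real linear isomorphism. -/
def IsSimpleZero (f : ℂ → ℂ) (z₀ : ℂ) : Prop :=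
  ∃ a : ℂ, a ≠ 0 ∧ ∃ c < (1 : ℝ), ∀ᶠ z in 𝓝 z₀, ‖f z - a * (z - z₀)‖ ≤ c * ‖a‖ * ‖z - z₀‖

lemma det_eq (L : ℂ →L[ℝ] ℂ) :
    L.det = (L 1).re * (L Complex.I).im - (L Complex.I).re * (L 1).im := by
  rw [ContinuousLinearMap.det, ← LinearMap.det_toMatrix Complex.basisOneI, Matrix.det_fin_two]
  simp [LinearMap.toMatrix_apply]

/-- Write `L u = a * u + b * conj u`. Then `det L = ‖a‖² - ‖b‖²`, so a positive determinant means
`‖b‖ < ‖a‖`, and `c = ‖b‖ / ‖a‖`. -/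
lemma exists_norm_sub_mul_le {L : ℂ →L[ℝ] ℂ} (hL : 0 < L.det) :
    ∃ a : ℂ, a ≠ 0 ∧ ∃ c < (1 : ℝ), ∀ u, ‖L u - a * u‖ ≤ c * ‖a‖ * ‖u‖ := by
  set p := L 1
  set q := L Complex.I
  have hdet : L.det = p.re * q.im - q.re * p.im := det_eq L
  have hLu : ∀ u : ℂ, L u = u.re * p + u.im * q := fun u => by
    conv_lhs => rw [show u = u.re • (1 : ℂ) + u.im • Complex.I by simp [Complex.re_add_im]]
    rw [map_add, map_smul, map_smul]
    simp [p, q]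
  set a := (p - Complex.I * q) / 2 with ha
  set b := (p + Complex.I * q) / 2 with hb
  have hab : ‖a‖ ^ 2 = ‖b‖ ^ 2 + L.det := by
    rw [← Complex.normSq_eq_norm_sq, ← Complex.normSq_eq_norm_sq, hdet, ha, hb,
      Complex.normSq_div, Complex.normSq_div, Complex.normSq_apply (p - _),
      Complex.normSq_apply (p + _)]
    simp
    ring
  have hlt : ‖b‖ < ‖a‖ := by
    refine lt_of_pow_lt_pow_left₀ 2 (norm_nonneg a) (by linarith)
  have ha0 : 0 < ‖a‖ := (norm_nonneg b).trans_lt hlt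
  refine ⟨a, norm_pos_iff.1 ha0, ‖b‖ / ‖a‖, (div_lt_one ha0).2 hlt, fun u => ?_⟩
  have h1 : L u - a * u = b * (starRingEnd ℂ) u := by
    rw [hLu, ha, hb]
    apply Complex.ext <;> simp <;> ring
  rw [h1, div_mul_cancel₀ _ ha0.ne', norm_mul, RCLike.norm_conj]

lemma IsSimpleZero.of_hasFDerivAt {f : ℂ → ℂ} {L : ℂ →L[ℝ] ℂ} {z₀ : ℂ}
    (hf : HasFDerivAt f L z₀) (h0 : f z₀ = 0) (hL : 0 < L.det) : IsSimpleZero f z₀ := by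
  obtain ⟨a, ha, c, hc, h⟩ := exists_norm_sub_mul_le hL
  -- Half of the gap `1 - c` is spent on the error term of the derivative.
  refine ⟨a, ha, (c + 1) / 2, by linarith, ?_⟩
  have hε : 0 < (1 - c) / 2 * ‖a‖ := mul_pos (by linarith) (norm_pos_iff.2 ha)
  filter_upwards [hf.isLittleO.def hε] with z hz
  have h1 : f z - a * (z - z₀) = (f z - f z₀ - L (z - z₀)) + (L (z - z₀) - a * (z - z₀)) := by
    rw [h0]
    ring
  rw [h1]
  refine (norm_add_le _ _).trans ((add_le_add hz (h _)).trans (le_of_eq ?_))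
  ring

lemma eventually_mul_norm_add_lt {X : Type*} {l : Filter X} {k : X → ℂ} {k₀ : ℂ}
    (hk : Filter.Tendsto k l (𝓝 k₀)) (hk₀ : k₀ ≠ 0) {c : ℝ} (hc : c < 1) :
    ∀ᶠ x in l, ‖k x‖ * c + ‖k x - k₀‖ < (c + 1) / 2 * ‖k₀‖ := by
  have h1 : Filter.Tendsto (fun x => ‖k x‖ * c + ‖k x - k₀‖) l (𝓝 (‖k₀‖ * c + ‖k₀ - k₀‖)) :=
    (hk.norm.mul_const c).add (hk.sub_const k₀).norm
  refine h1.eventually (gt_mem_nhds ?_)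
  have h2 : 0 < ‖k₀‖ := norm_pos_iff.2 hk₀
  rw [sub_self, norm_zero]
  nlinarith

lemma norm_mul_sub_le {k k₀ w a u : ℂ} {c : ℝ} (h : ‖w - a * u‖ ≤ c * ‖a‖ * ‖u‖)
    (hk : ‖k‖ * c + ‖k - k₀‖ < (c + 1) / 2 * ‖k₀‖) :
    ‖k * w - k₀ * a * u‖ ≤ (c + 1) / 2 * ‖k₀ * a‖ * ‖u‖ := by
  have h2 : k * w - k₀ * a * u = k * (w - a * u) + (k - k₀) * (a * u) := by ring
  rw [h2]
  calc _ ≤ ‖k‖ * ‖w - a * u‖ + ‖k - k₀‖ * (‖a‖ * ‖u‖) := by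
        refine (norm_add_le _ _).trans (le_of_eq ?_)
        rw [norm_mul, norm_mul, norm_mul]
    _ ≤ ‖k‖ * (c * ‖a‖ * ‖u‖) + ‖k - k₀‖ * (‖a‖ * ‖u‖) := by gcongr
    _ = (‖k‖ * c + ‖k - k₀‖) * (‖a‖ * ‖u‖) := by ring
    _ ≤ ((c + 1) / 2 * ‖k₀‖) * (‖a‖ * ‖u‖) := by gcongr
    _ = _ := by rw [norm_mul]; ring

/-- Lifts of the disk to `ℂ²` are only continuous, so a notion of simple zero stable under
continuous nonvanishing factors is required. Differentiability would not survive such factors, while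
the estimate does, with a slightly larger `c < 1`. -/
lemma IsSimpleZero.mul {f g k : ℂ → ℂ} {z₀ : ℂ} (hf : IsSimpleZero f z₀)
    (hk : ContinuousAt k z₀) (hk₀ : k z₀ ≠ 0) (hg : ∀ᶠ z in 𝓝 z₀, g z = k z * f z) :
    IsSimpleZero g z₀ := by
  obtain ⟨a, ha, c, hc, h⟩ := hf
  refine ⟨k z₀ * a, mul_ne_zero hk₀ ha, (c + 1) / 2, by linarith, ?_⟩
  filter_upwards [h, hg, eventually_mul_norm_add_lt hk hk₀ hc] with z h1 h2 h3
  rw [h2]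
  exact norm_mul_sub_le h1 h3

lemma HasDegree.exp_mul_I_sub {z₀ : ℂ} (hz : z₀ ∈ ball (0 : ℂ) 1) :
    HasDegree (fun θ => Complex.exp (θ * Complex.I) - z₀) 1 := by
  refine HasDegree.exp_mul_I.of_norm_sub_lt (by fun_prop) (fun θ => ?_) fun θ => ?_
  · rw [HasDegree.exp_mul_I.periodic]
  · simpa [Complex.norm_exp_ofReal_mul_I] using hz

lemma exp_mul_I_mem_sphere (θ : ℝ) : Complex.exp (θ * Complex.I) ∈ sphere (0 : ℂ) 1 := by
  simp [Complex.norm_exp_ofReal_mul_I]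

/-- Shrinking the circle to its centre is a homotopy to a nonzero constant. -/
lemma HasDegree.of_forall_ne_zero {f : ℂ → ℂ} (hf : ContinuousOn f (closedBall 0 1))
    (h0 : ∀ z ∈ closedBall (0 : ℂ) 1, f z ≠ 0) :
    HasDegree (fun θ => f (Complex.exp (θ * Complex.I))) 0 := by
  have hmem : ∀ t ∈ Icc (0 : ℝ) 1, ∀ θ : ℝ,
      (t : ℂ) * Complex.exp (θ * Complex.I) ∈ closedBall (0 : ℂ) 1 := fun t ht θ => by
    simpa [Complex.norm_exp_ofReal_mul_I, abs_of_nonneg ht.1] using ht.2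
  have h1 := HasDegree.of_homotopy (r := 0) (s := 1) (n := 0) zero_le_one
    (H := fun t θ => f (t * Complex.exp (θ * Complex.I))) ?_ (fun t _ θ => ?_)
    (fun t ht θ => h0 _ (hmem t ht θ)) ?_
  · simpa using h1
  · exact hf.comp (by fun_prop) fun q hq => hmem _ hq.1 _
  · simp only [HasDegree.exp_mul_I.periodic]
  · simpa using HasDegree.const (h0 0 (by simp))

/-- The part of the argument principle which divides out one zero. -/
lemma IsSimpleZero.exists_div {f : ℂ → ℂ} {z₀ : ℂ} (hz₀ : z₀ ∈ ball (0 : ℂ) 1)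
    (hf : ContinuousOn f (closedBall 0 1)) (h : IsSimpleZero f z₀) :
    ∃ g : ℂ → ℂ, ContinuousOn g (closedBall 0 1) ∧
      (∀ z ∈ sphere (0 : ℂ) 1, f z = g z * (z - z₀)) ∧
      (∀ z ∈ closedBall (0 : ℂ) 1, g z = 0 ↔ f z = 0 ∧ z ≠ z₀) ∧
      ∀ z, f z = 0 → z ∈ ball (0 : ℂ) 1 → z ≠ z₀ → IsSimpleZero f z → IsSimpleZero g z := by
  obtain ⟨a, ha, c, hc, h⟩ := h
  have ha' := norm_pos_iff.2 ha
  obtain ⟨ε, hε, hball⟩ : ∃ ε > 0, closedBall z₀ ε ⊆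
      {z | ‖f z - a * (z - z₀)‖ ≤ c * ‖a‖ * ‖z - z₀‖} ∩ ball 0 1 :=
    Metric.nhds_basis_closedBall.mem_iff.1 (Filter.inter_mem h (isOpen_ball.mem_nhds hz₀))
  have hclose : ∀ z ∈ closedBall z₀ ε, z ≠ z₀ → ‖f z / (z - z₀) - a‖ ≤ c * ‖a‖ := by
    intro z hz hne
    have h1 : 0 < ‖z - z₀‖ := norm_pos_iff.2 (sub_ne_zero.2 hne)
    rw [div_sub' (sub_ne_zero.2 hne), norm_div, div_le_iff₀ h1, mul_comm (z - z₀) a]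
    exact (hball hz).1
  have hz₀f : f z₀ = 0 := by simpa using (hball (mem_closedBall_self hε.le)).1
  -- The quotient `f z / (z - z₀)` need not have a limit at `z₀`, but near `z₀` it stays within `c *
  -- ‖a‖ < ‖a‖` of `a`. Interpolating between it and the constant `a` therefore gives a function
  -- that is continuous at `z₀`, has no zero near `z₀`, and agrees with the quotient at distance at
  -- least `ε`.
  set t : ℂ → ℝ := fun z => min 1 (‖z - z₀‖ / ε) with ht
  have htc : Continuous t := by fun_prop
  have ht0 : ∀ z, 0 ≤ t z := fun z => le_min zero_le_one (by positivity)
  have ht1 : ∀ z, t z ≤ 1 := fun z => min_le_left _ _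
  set g : ℂ → ℂ := fun z => t z * (f z / (z - z₀)) + (1 - t z) * a with hg
  have hg1 : ∀ z, ε ≤ ‖z - z₀‖ → g z = f z / (z - z₀) := fun z hz => by
    have : t z = 1 := min_eq_left ((one_le_div hε).2 hz)
    simp [hg, this]
  have hg2 : ∀ z ∈ closedBall z₀ ε, ‖g z - a‖ ≤ t z * (|c| * ‖a‖) := by
    intro z hz
    rcases eq_or_ne z z₀ with rfl | hne
    · simp [hg, ht]
    · have h1 : g z - a = t z * (f z / (z - z₀) - a) := by simp only [hg]; ring
      rw [h1, norm_mul, Complex.norm_real, Real.norm_of_nonneg (ht0 z)]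
      have := (hclose z hz hne).trans (mul_le_mul_of_nonneg_right (le_abs_self c) ha'.le)
      exact mul_le_mul_of_nonneg_left this (ht0 z)
  have hg3 : ∀ z ∈ closedBall z₀ ε, g z ≠ 0 := by
    intro z hz h0
    rcases eq_or_ne z z₀ with rfl | hne
    · simp [hg, ht, ha] at h0
    · have h1 : g z - a = t z * (f z / (z - z₀) - a) := by simp only [hg]; ring
      have h2 : ‖a‖ ≤ c * ‖a‖ := by
        calc ‖a‖ = ‖g z - a‖ := by simp [h0]
          _ = t z * ‖f z / (z - z₀) - a‖ := by
            rw [h1, norm_mul, Complex.norm_real, Real.norm_of_nonneg (ht0 z)]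
          _ ≤ 1 * ‖f z / (z - z₀) - a‖ := by gcongr; exact ht1 z
          _ ≤ c * ‖a‖ := by rw [one_mul]; exact hclose z hz hne
      nlinarith
  have hsph : ∀ z ∈ sphere (0 : ℂ) 1, ε < ‖z - z₀‖ := by
    intro z hz
    by_contra hcon
    have := (hball (mem_closedBall_iff_norm.2 (not_lt.1 hcon))).2
    rw [mem_ball_zero_iff] at this
    rw [mem_sphere_zero_iff_norm] at hz
    linarith
  have hne : ∀ z, ε < ‖z - z₀‖ → z - z₀ ≠ 0 := fun z hz => norm_pos_iff.1 (hε.trans hz)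
  have hg4 : ∀ z, g z = 0 ↔ f z = 0 ∧ z ≠ z₀ := by
    intro z
    rcases le_or_gt ‖z - z₀‖ ε with hz | hz
    · have hz' := mem_closedBall_iff_norm.2 hz
      refine ⟨fun h0 => (hg3 z hz' h0).elim, fun h0 => ?_⟩
      have h1 := hclose z hz' h0.2
      rw [h0.1, zero_div, zero_sub, norm_neg] at h1
      nlinarith
    · rw [hg1 z hz.le, div_eq_zero_iff, or_iff_left (hne z hz), iff_self_and]
      exact fun _ => sub_ne_zero.1 (hne z hz)
  refine ⟨g, fun z hz => ?_, fun z hz => ?_, fun z _ => hg4 z, fun z hz hzb hzne hs => ?_⟩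
  · rcases eq_or_ne z z₀ with rfl | hzne
    · have h1 : Filter.Tendsto (fun u => t u * (|c| * ‖a‖)) (𝓝 z) (𝓝 0) := by
        have := (htc.tendsto z).mul_const (|c| * ‖a‖)
        simpa [ht] using this
      have h2 : Filter.Tendsto g (𝓝 z) (𝓝 a) := by
        rw [tendsto_iff_norm_sub_tendsto_zero]
        refine squeeze_zero' (Filter.Eventually.of_forall fun _ => norm_nonneg _) ?_ h1
        filter_upwards [closedBall_mem_nhds z hε] with u hu using hg2 u hu
      have h3 : g z = a := by simp [hg, ht]
      rw [ContinuousWithinAt, h3]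
      exact h2.mono_left nhdsWithin_le_nhds
    · have h1 := hf z hz
      have h2 : ContinuousWithinAt (fun z => z - z₀) (closedBall 0 1) z := by fun_prop
      have h3 : ContinuousWithinAt (fun z => (t z : ℂ)) (closedBall 0 1) z :=
        (Complex.continuous_ofReal.comp htc).continuousWithinAt
      exact (h3.mul (h1.div h2 (sub_ne_zero.2 hzne))).add
        ((continuousWithinAt_const.sub h3).mul continuousWithinAt_const)
  · rw [hg1 z (hsph z hz).le, div_mul_cancel₀ _ (hne z (hsph z hz))]
  · have h1 : ε < ‖z - z₀‖ := by
      by_contra hcon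
      have := hclose z (mem_closedBall_iff_norm.2 (not_lt.1 hcon)) hzne
      rw [hz, zero_div, zero_sub, norm_neg] at this
      nlinarith
    refine hs.mul (k := fun z => (z - z₀)⁻¹) ?_ (inv_ne_zero (hne z h1)) ?_
    · exact ContinuousAt.inv₀ (by fun_prop) (hne z h1)
    · have h2 : ContinuousAt (fun z => ‖z - z₀‖) z := by fun_prop
      filter_upwards [h2.eventually (lt_mem_nhds h1)] with u hu
      rw [hg1 u hu.le, div_eq_inv_mul]

lemma IsSimpleZero.eventually_ne {f : ℂ → ℂ} {z₀ : ℂ} (h : IsSimpleZero f z₀) :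
    ∀ᶠ z in 𝓝[≠] z₀, f z ≠ 0 := by
  obtain ⟨a, ha, c, hc, h⟩ := h
  filter_upwards [h.filter_mono nhdsWithin_le_nhds, self_mem_nhdsWithin] with z hz hne h0
  rw [h0, zero_sub, norm_neg, norm_mul] at hz
  have := mul_pos (norm_pos_iff.2 ha) (norm_pos_iff.2 (sub_ne_zero.2 hne))
  nlinarith

/-- The zeros form a compact set, as there are none on the circle, and simple zeros are isolated. -/
lemma finite_zeros {f : ℂ → ℂ} (hf : ContinuousOn f (closedBall 0 1))
    (hs : ∀ z ∈ sphere (0 : ℂ) 1, f z ≠ 0)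
    (h : ∀ z ∈ ball (0 : ℂ) 1, f z = 0 → IsSimpleZero f z) :
    {z | z ∈ ball (0 : ℂ) 1 ∧ f z = 0}.Finite := by
  have heq : {z | z ∈ ball (0 : ℂ) 1 ∧ f z = 0} = closedBall 0 1 ∩ f ⁻¹' {0} := by
    ext z
    refine ⟨fun hz => ⟨ball_subset_closedBall hz.1, hz.2⟩, fun hz => ⟨?_, hz.2⟩⟩
    rw [← ball_union_sphere] at hz
    exact hz.1.resolve_right fun h1 => hs z h1 hz.2
  have hc : IsCompact {z | z ∈ ball (0 : ℂ) 1 ∧ f z = 0} := by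
    rw [heq]
    exact (isCompact_closedBall 0 1).of_isClosed_subset
      (hf.preimage_isClosed_of_isClosed isClosed_closedBall isClosed_singleton) inter_subset_left
  by_contra hinf
  obtain ⟨z, hz, hacc⟩ := Set.Infinite.exists_accPt_of_subset_isCompact hinf hc subset_rfl
  rw [accPt_iff_frequently_nhdsNE] at hacc
  exact hacc ((h z hz.1 hz.2).eventually_ne.mono fun _ h1 h2 => h1 h2.2)

/-- The argument principle: the degree on the unit circle is the number of zeros. -/
theorem hasDegree_ncard_zeros {f : ℂ → ℂ} (hf : ContinuousOn f (closedBall 0 1))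
    (hs : ∀ z ∈ sphere (0 : ℂ) 1, f z ≠ 0)
    (h : ∀ z ∈ ball (0 : ℂ) 1, f z = 0 → IsSimpleZero f z) :
    HasDegree (fun θ => f (Complex.exp (θ * Complex.I)))
      {z | z ∈ ball (0 : ℂ) 1 ∧ f z = 0}.ncard := by
  induction hn : {z | z ∈ ball (0 : ℂ) 1 ∧ f z = 0}.ncard generalizing f with
  | zero =>
    rw [Set.ncard_eq_zero (finite_zeros hf hs h)] at hn
    refine HasDegree.of_forall_ne_zero hf fun z hz h0 => ?_
    rw [← ball_union_sphere] at hz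
    refine hz.elim (fun hz => ?_) fun hz => hs z hz h0
    exact (hn ▸ (⟨hz, h0⟩ : z ∈ {z | z ∈ ball (0 : ℂ) 1 ∧ f z = 0}) : z ∈ (∅ : Set ℂ))
  | succ n ih =>
    obtain ⟨z₀, hz₀, hz₀'⟩ : {z | z ∈ ball (0 : ℂ) 1 ∧ f z = 0}.Nonempty := by
      rw [← Set.ncard_pos (finite_zeros hf hs h), hn]
      omega
    obtain ⟨g, hg, hg1, hg2, hg3⟩ := (h z₀ hz₀ hz₀').exists_div hz₀ hf
    have hset : {z | z ∈ ball (0 : ℂ) 1 ∧ g z = 0} =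
        {z | z ∈ ball (0 : ℂ) 1 ∧ f z = 0} \ {z₀} := by
      ext z
      simp only [mem_ofPred_eq, mem_sdiff, mem_singleton_iff, and_assoc]
      exact and_congr_right fun hz => hg2 z (ball_subset_closedBall hz)
    have hd := ih hg (fun z hz h0 => hs z hz ((hg2 z (sphere_subset_closedBall hz)).1 h0).1)
      (fun z hz h0 => ?_) ?_
    -- On the circle `f` is `g` times `z - z₀`, and the second factor has degree one.
    · have h1 := hd.mul (HasDegree.exp_mul_I_sub hz₀)
      simp only [← hg1 _ (exp_mul_I_mem_sphere _)] at h1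
      exact_mod_cast h1
    · have h1 := (hg2 z (ball_subset_closedBall hz)).1 h0
      exact hg3 z h1.1 hz h1.2 (h z hz h1.1)
    · rw [hset, Set.ncard_sdiff_singleton_of_mem (by exact ⟨hz₀, hz₀'⟩), hn]
      rfl

/-! ### Closed curves -/

/-- A `C¹` map does not raise Hausdorff dimension, and sets of dimension below that of `F` are null.
It is applied to arcs in the plane and to cones over arcs in space. -/
lemma addHaar_image_eq_zero_of_finrank_lt {E F : Type*} [NormedAddCommGroup E] [NormedSpace ℝ E]
    [FiniteDimensional ℝ E] [NormedAddCommGroup F] [NormedSpace ℝ F] [FiniteDimensional ℝ F]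
    [MeasurableSpace F] [BorelSpace F] (μ : Measure F) [μ.IsAddHaarMeasure] {f : E → F} {s : Set E}
    (hf : ContDiffOn ℝ 1 f s) (hs : Convex ℝ s) (h : Module.finrank ℝ E < Module.finrank ℝ F) :
    μ (f '' s) = 0 := by
  refine measure_zero_of_dimH_lt (d := Module.finrank ℝ F) ?_ ?_
  · rw [NNReal.coe_natCast]
    exact Measure.absolutelyContinuous_isAddHaarMeasure _ _
  · refine (hf.dimH_image_le hs subset_rfl).trans_lt
      ((dimH_mono (subset_univ s)).trans_lt ?_)
    rw [Real.dimH_univ_eq_finrank]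
    exact_mod_cast h

namespace IsClosedCurve

section

variable {E : Type*} [NormedAddCommGroup E] [NormedSpace ℝ E] {γ : ℝ → E}

lemma range_eq (hγ : IsClosedCurve γ) : range γ = γ '' Icc 0 (2 * π) := by
  refine Subset.antisymm ?_ (image_subset_range _ _)
  rintro _ ⟨θ, rfl⟩
  obtain ⟨y, hy, h⟩ :=
    Function.Periodic.exists_mem_Ico₀ (f := γ) hγ.periodic Real.two_pi_pos θ
  exact ⟨y, Ico_subset_Icc_self hy, h.symm⟩

lemma isCompact_range (hγ : IsClosedCurve γ) : IsCompact (range γ) := by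
  rw [hγ.range_eq]
  exact isCompact_Icc.image hγ.continuous

lemma exists_range_eq_iUnion (hγ : IsClosedCurve γ) : ∃ (n : ℕ) (a b : ℕ → ℝ),
    range γ ⊆ ⋃ i ∈ Finset.range n, γ '' Icc (a i) (b i) ∧
      ∀ i ∈ Finset.range n, ContDiffOn ℝ 1 γ (Icc (a i) (b i)) := by
  obtain ⟨n, t, ht, h0, hn, h⟩ := hγ.piecewise
  -- The search below finds the first `t k > θ`, which fails at `θ = 2π`; the extra degenerate
  -- interval at index `n` covers this point.
  refine ⟨n + 1, fun i => if i < n then t i else 2 * π, fun i => if i < n then t (i + 1) else 2 * π,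
    ?_, fun i _ => ?_⟩
  · rw [hγ.range_eq]
    rintro _ ⟨θ, hθ, rfl⟩
    rcases hθ.2.eq_or_lt with rfl | hlt
    · exact mem_biUnion (Finset.mem_coe.2 (Finset.self_mem_range_succ n))
        ⟨2 * π, by simp, rfl⟩
    · have hex : ∃ k, θ < t k := ⟨n, hn ▸ hlt⟩
      classical
      obtain ⟨i, hi⟩ : ∃ i, Nat.find hex = i + 1 := Nat.exists_eq_succ_of_ne_zero fun hz => by
        have := Nat.find_spec hex
        rw [hz, h0] at this
        exact absurd hθ.1 (not_le.2 this)
      have h1 : t i ≤ θ := not_lt.1 (Nat.find_min hex (by omega))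
      have h2 : θ < t (i + 1) := hi ▸ Nat.find_spec hex
      have h3 : i < n := by
        have : Nat.find hex ≤ n := Nat.find_min' hex (hn ▸ hlt)
        omega
      refine mem_biUnion (Finset.mem_coe.2 (Finset.mem_range.2 (by omega : i < n + 1))) ⟨θ, ?_, rfl⟩
      simp only [h3, if_true]
      exact ⟨h1, h2.le⟩
  · dsimp only
    split_ifs with hi
    · exact h i hi
    · rw [Icc_self]
      exact (contDiffOn_const (c := γ (2 * π))).congr fun x hx => by rw [hx]

lemma exists_norm_deriv_le (hγ : IsClosedCurve γ) : ∃ (s : Set ℝ) (C : ℝ), s.Countable ∧ 0 ≤ C ∧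
    ∀ θ ∈ Icc 0 (2 * π) \ s, DifferentiableAt ℝ γ θ ∧ ‖deriv γ θ‖ ≤ C := by
  obtain ⟨n, t, ht, h0, hn, h⟩ := hγ.piecewise
  have hb : ∀ i, ∃ C, 0 ≤ C ∧ (i < n → ∀ θ ∈ Ioo (t i) (t (i + 1)),
      DifferentiableAt ℝ γ θ ∧ ‖deriv γ θ‖ ≤ C) := by
    intro i
    by_cases hi : i < n ∧ t i < t (i + 1)
    · have h1 := (h i hi.1).continuousOn_derivWithin (uniqueDiffOn_Icc hi.2) le_rfl
      obtain ⟨C, hC⟩ := isCompact_Icc.exists_bound_of_continuousOn h1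
      refine ⟨|C|, abs_nonneg C, fun _ θ hθ => ?_⟩
      have h2 : Icc (t i) (t (i + 1)) ∈ 𝓝 θ := Icc_mem_nhds hθ.1 hθ.2
      refine ⟨((h i hi.1).differentiableOn one_ne_zero).differentiableAt h2, ?_⟩
      rw [← derivWithin_of_mem_nhds h2]
      exact (hC θ (Ioo_subset_Icc_self hθ)).trans (le_abs_self C)
    · refine ⟨0, le_rfl, fun h1 θ hθ => (hi ⟨h1, hθ.1.trans hθ.2⟩).elim⟩
  choose C hC hC' using hb
  refine ⟨range t, ∑ i ∈ Finset.range n, C i, countable_range t,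
    Finset.sum_nonneg fun i _ => hC i, fun θ hθ => ?_⟩
  have hlt : θ < t n := by
    rw [hn]
    exact hθ.1.2.lt_of_ne fun h1 => hθ.2 ⟨n, by rw [hn, h1]⟩
  have hex : ∃ k, θ < t k := ⟨n, hlt⟩
  classical
  obtain ⟨i, hi⟩ : ∃ i, Nat.find hex = i + 1 := Nat.exists_eq_succ_of_ne_zero fun hz => by
    have := Nat.find_spec hex
    rw [hz, h0] at this
    exact absurd hθ.1.1 (not_le.2 this)
  have h1 : t i ≤ θ := not_lt.1 (Nat.find_min hex (by omega))
  have h2 : θ < t (i + 1) := hi ▸ Nat.find_spec hex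
  have h3 : i < n := by
    have : Nat.find hex ≤ n := Nat.find_min' hex hlt
    omega
  have h4 := hC' i h3 θ ⟨h1.lt_of_ne fun h4 => hθ.2 ⟨i, h4⟩, h2⟩
  exact ⟨h4.1, h4.2.trans
    (Finset.single_le_sum (f := C) (fun j _ => hC j) (Finset.mem_range.2 h3))⟩

end

/-! ### Plane curves: the winding number as a degree, and its integrability -/

section

variable {γ : ℝ → ℂ}

lemma volume_range (hγ : IsClosedCurve γ) : volume (range γ) = 0 := by
  obtain ⟨n, a, b, h1, h2⟩ := hγ.exists_range_eq_iUnion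
  refine measure_mono_null h1 ((measure_biUnion_null_iff (Finset.countable_toSet _)).2 fun i hi => ?_)
  exact addHaar_image_eq_zero_of_finrank_lt volume (h2 i hi) (convex_Icc _ _) (by simp)

lemma exists_hasDegree_sub (hγ : IsClosedCurve γ) {w : ℂ} (hw : w ∉ range γ) :
    ∃ n : ℤ, HasDegree (fun θ => γ θ - w) n :=
  HasDegree.exists_of_continuous (hγ.continuous.sub continuous_const)
    (fun θ => by rw [hγ.periodic]) fun θ h => hw ⟨θ, sub_eq_zero.1 h⟩

/-- The continuous logarithm of `γ - w` is a primitive of the integrand off the finitely many break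
points, and its increment over a period is `2πi n`. -/
lemma windingNumber_eq (hγ : IsClosedCurve γ) {w : ℂ} (hw : w ∉ range γ) {n : ℤ}
    (hn : HasDegree (fun θ => γ θ - w) n) : windingNumber γ w = n := by
  obtain ⟨g, hg, h1, h2⟩ := hn
  obtain ⟨s, C, hs, hC, h3⟩ := hγ.exists_norm_deriv_le
  replace h1 : ∀ θ, γ θ - w = Complex.exp (g θ) := h1
  have hd : ∀ θ ∈ Icc 0 (2 * π) \ s, HasDerivAt g (deriv γ θ / (γ θ - w)) θ := by
    intro θ hθ
    -- The logarithm `g` is only known to be continuous. Near `θ` it is a local inverse of `exp`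
    -- composed with `γ - w`, hence differentiable wherever `γ` is.
    have h4 := Complex.hasStrictDerivAt_exp (g θ)
    have h5 := h4.to_localInverse (Complex.exp_ne_zero _)
    have h6 : HasDerivAt (fun u => γ u - w) (deriv γ θ) θ := (h3 θ hθ).1.hasDerivAt.sub_const w
    have h7 := h5.hasDerivAt
    have h8 := HasDerivAt.scomp_of_eq θ h7 h6 (h1 θ).symm
    have h9 : (Complex.exp (g θ))⁻¹ = (γ θ - w)⁻¹ := by rw [← h1]
    rw [h9, smul_eq_mul, ← div_eq_mul_inv] at h8
    refine h8.congr_of_eventuallyEq ?_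
    filter_upwards [(hg.tendsto θ).eventually
      (h4.eventually_left_inverse (Complex.exp_ne_zero _))] with u hu
    rw [Function.comp_apply, h1, hu]
  obtain ⟨δ, hδ, h4⟩ : ∃ δ > 0, ∀ θ, δ ≤ ‖γ θ - w‖ := by
    obtain ⟨δ, hδ, h4⟩ := Metric.isOpen_iff.1 hγ.isCompact_range.isClosed.isOpen_compl w hw
    refine ⟨δ, hδ, fun θ => ?_⟩
    by_contra h5
    exact h4 (mem_ball_iff_norm.2 (not_le.1 h5)) ⟨θ, rfl⟩
  have hi : IntervalIntegrable (fun θ => deriv γ θ / (γ θ - w)) volume 0 (2 * π) := by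
    rw [intervalIntegrable_iff_integrableOn_Icc_of_le Real.two_pi_pos.le]
    refine Measure.integrableOn_of_bounded (M := C / δ) measure_Icc_lt_top.ne ?_ ?_
    · exact ((measurable_deriv γ).div
        (hγ.continuous.measurable.sub_const w)).aestronglyMeasurable
    · filter_upwards [ae_restrict_mem measurableSet_Icc,
        ae_restrict_of_ae (hs.ae_notMem volume)] with θ h5 h6
      rw [norm_div]
      exact div_le_div₀ hC (h3 θ ⟨h5, h6⟩).2 hδ (h4 θ)
  have h5 := integral_eq_of_hasDerivAt_off_countable g _ hs hg.continuousOn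
    (fun θ hθ => hd θ ⟨?_, hθ.2⟩) hi
  · have h6 := h2 0
    rw [zero_add] at h6
    rw [windingNumber, h5, h6]
    have := Complex.two_pi_I_ne_zero
    field_simp
    ring
  · rw [min_eq_left Real.two_pi_pos.le, max_eq_right Real.two_pi_pos.le] at hθ
    exact Ioo_subset_Icc_self hθ.1

lemma eventually_hasDegree_sub (hγ : IsClosedCurve γ) {w : ℂ} {n : ℤ}
    (hn : HasDegree (fun θ => γ θ - w) n) : ∀ᶠ v in 𝓝 w, HasDegree (fun θ => γ θ - v) n := by
  refine hn.eventually (.of_forall fun v => hγ.continuous.sub continuous_const)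
    (.of_forall fun v θ => by rw [hγ.periodic]) fun θ => ?_
  have : Continuous (Function.uncurry fun (v : ℂ) (θ : ℝ) => γ θ - v) :=
    (hγ.continuous.comp continuous_snd).sub continuous_fst
  simpa [nhds_prod_eq] using this.tendsto (w, θ)

lemma enorm_windingNumber_le (hγ : IsClosedCurve γ) : ∃ C : NNReal, ∀ w,
    ‖windingNumber γ w‖ₑ ≤ ∫⁻ θ in Icc 0 (2 * π), C * ‖γ θ - w‖ₑ⁻¹ := by
  obtain ⟨s, C, hs, hC, h3⟩ := hγ.exists_norm_deriv_le
  lift C to NNReal using hC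
  refine ⟨C, fun w => ?_⟩
  rw [windingNumber, intervalIntegral.integral_of_le Real.two_pi_pos.le, enorm_mul,
    ← integral_Icc_eq_integral_Ioc]
  have h4 : ‖(2 * π * Complex.I : ℂ)⁻¹‖ₑ ≤ 1 := by
    rw [← ofReal_norm, ENNReal.ofReal_le_one, norm_inv]
    refine inv_le_one_of_one_le₀ ?_
    have : ‖(2 * π * Complex.I : ℂ)‖ = 2 * π := by simp [Real.pi_pos.le]
    linarith [Real.pi_gt_three]
  refine (mul_le_of_le_one_left' h4).trans ((enorm_integral_le_lintegral_enorm _).trans ?_)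
  refine lintegral_mono_ae ?_
  filter_upwards [ae_restrict_mem measurableSet_Icc,
    ae_restrict_of_ae (hs.ae_notMem volume)] with θ h5 h6
  rw [div_eq_mul_inv, enorm_mul]
  refine mul_le_mul' ?_ ?_
  · have := (h3 θ ⟨h5, h6⟩).2
    exact enorm_le_coe.2 this
  -- Where the curve meets `w`, the complex inverse is `0` and the extended one is `⊤`, so the
  -- inequality persists.
  · rcases eq_or_ne (γ θ - w) 0 with h7 | h7
    · simp [h7]
    · rw [enorm_inv h7]

lemma lintegral_enorm_inv_ball (R : ℝ) : ∫⁻ w in ball (0 : ℂ) R, ‖w‖ₑ⁻¹ ≠ ⊤ := by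
  have h : IntegrableOn (fun w : ℂ => ‖w‖⁻¹) (ball 0 R) := by
    refine integrableOn_ball_of_norm_le_rpow (C := 1) (α := 1) (by simp) (by simp) ?_
      (by fun_prop)
    refine .of_forall fun w => ?_
    simp [Real.rpow_neg_one]
  refine ne_of_eq_of_ne (setLIntegral_congr_fun_ae measurableSet_ball ?_) h.hasFiniteIntegral.ne
  filter_upwards [(countable_singleton (0 : ℂ)).ae_notMem volume] with w hw _
  rw [← enorm_norm w, enorm_inv (norm_ne_zero_iff.2 hw)]

/-- The winding number is locally integrable. -/
lemma lintegral_windingNumber_ne_top (hγ : IsClosedCurve γ) (R : ℝ) :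
    ∫⁻ w in ball 0 R, ‖windingNumber γ w‖ₑ ≠ ⊤ := by
  obtain ⟨C, hC⟩ := hγ.enorm_windingNumber_le
  obtain ⟨M, hM⟩ := hγ.isCompact_range.isBounded.exists_norm_le
  have hmeas : Measurable (Function.uncurry fun (w : ℂ) (θ : ℝ) => (C : ENNReal) * ‖γ θ - w‖ₑ⁻¹) := by
    have := hγ.continuous.measurable
    fun_prop
  have h1 : ∀ θ, ∫⁻ w in ball 0 R, (C : ENNReal) * ‖γ θ - w‖ₑ⁻¹ ≤
      C * ∫⁻ w in ball (0 : ℂ) (R + M), ‖w‖ₑ⁻¹ := by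
    intro θ
    rw [lintegral_const_mul' _ _ ENNReal.coe_ne_top]
    refine mul_le_mul_right ?_ _
    have h2 : MeasurePreserving (fun w : ℂ => γ θ - w) := Measure.measurePreserving_sub_left volume (γ θ)
    have h3 : MeasurableEmbedding (fun w : ℂ => γ θ - w) :=
      (MeasurableEquiv.subLeft (γ θ)).measurableEmbedding
    calc _ ≤ ∫⁻ w in (fun w : ℂ => γ θ - w) ⁻¹' (ball 0 (R + M)), ‖γ θ - w‖ₑ⁻¹ := by
          refine lintegral_mono_set fun w hw => ?_
          rw [mem_preimage, mem_ball_zero_iff]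
          rw [mem_ball_zero_iff] at hw
          have := norm_sub_le (γ θ) w
          have := hM (γ θ) ⟨θ, rfl⟩
          linarith
      _ = _ := h2.setLIntegral_comp_preimage_emb h3 (fun w => ‖w‖ₑ⁻¹) _
  have h2 : ∫⁻ w in ball 0 R, ‖windingNumber γ w‖ₑ ≤
      ∫⁻ θ in Icc 0 (2 * π), C * ∫⁻ w in ball (0 : ℂ) (R + M), ‖w‖ₑ⁻¹ := by
    refine (lintegral_mono hC).trans ?_
    -- After Tonelli, the inner integral is that of `1 / |w|` over a translate of the ball, bounded
    -- uniformly in `θ`.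
    rw [lintegral_lintegral_swap hmeas.aemeasurable]
    exact lintegral_mono h1
  refine ne_top_of_le_ne_top ?_ h2
  rw [setLIntegral_const]
  exact ENNReal.mul_ne_top (ENNReal.mul_ne_top ENNReal.coe_ne_top (lintegral_enorm_inv_ball _))
    measure_Icc_lt_top.ne

end

end IsClosedCurve

lemma exists_eq_of_locally_const {E : Type*} [TopologicalSpace E] {X K : Set E} (d : E → ℤ)
    (hd : ∀ P ∈ X \ K, ∀ᶠ Q in 𝓝[X \ K] P, d Q = d P) :
    ∃ ν : Set E → ℤ, ∀ Ω ∈ complementComponents X K, ∀ P ∈ Ω, d P = ν Ω := by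
  classical
  refine ⟨fun Ω => if h : Ω.Nonempty then d h.some else 0, fun Ω hΩ P hP => ?_⟩
  have hne : Ω.Nonempty := ⟨P, hP⟩
  simp only [hne, dif_pos]
  obtain ⟨Q, -, rfl⟩ := hΩ
  have hc : ContinuousOn d (X \ K) := fun R hR =>
    (continuousWithinAt_const (b := d R)).congr_of_eventuallyEq (hd R hR) rfl
  exact isPreconnected_connectedComponentIn.constant
    (hc.mono (connectedComponentIn_subset _ _)) hP hne.some_mem

/-! ### Areas and numbers of layers -/

/-- Countably many of the neighbourhoods on which `F` is injective suffice (Lindelöf), and they can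
be made disjoint. On each piece the number of preimages is the indicator of the image. -/
lemma exists_disjoint_injOn_cover {E : Type*} {U : Set ℂ} (hU : IsOpen U) {F : ℂ → E}
    (hinj : ∀ z ∈ U, ∃ V ∈ 𝓝 z, InjOn F V) :
    ∃ A : ℕ → Set ℂ, (∀ n, MeasurableSet (A n)) ∧ Pairwise (Function.onFun Disjoint A) ∧
      ⋃ n, A n = U ∧ ∀ n, InjOn F (A n) := by
  rcases U.eq_empty_or_nonempty with rfl | ⟨z₀, hz₀⟩
  · exact ⟨fun _ => ∅, fun _ => .empty, fun _ _ _ => disjoint_bot_left, by simp, by simp⟩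
  choose! V hV hVF using hinj
  obtain ⟨S, hSU, hSc, hS⟩ := TopologicalSpace.countable_cover_nhdsWithin
    (f := fun z => interior (V z) ∩ U) (s := U) fun z hz => mem_nhdsWithin_of_mem_nhds
      (Filter.inter_mem (interior_mem_nhds.2 (hV z hz)) (hU.mem_nhds hz))
  have hne : S.Nonempty := by
    obtain ⟨x, hx, -⟩ := mem_iUnion₂.1 (hS hz₀)
    exact ⟨x, hx⟩
  obtain ⟨x, rfl⟩ := hSc.exists_eq_range hne
  set B : ℕ → Set ℂ := fun n => interior (V (x n)) ∩ U
  refine ⟨disjointed B, fun n => ?_, disjoint_disjointed B, ?_, fun n => ?_⟩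
  · exact MeasurableSet.disjointed (fun n => (isOpen_interior.inter hU).measurableSet) n
  · rw [iUnion_disjointed]
    refine Subset.antisymm (iUnion_subset fun n => inter_subset_right) ?_
    simpa [B] using hS
  · exact (hVF (x n) (hSU ⟨n, rfl⟩)).mono
      ((disjointed_subset B n).trans (inter_subset_left.trans interior_subset))

/-- The area formula: the integral of the Jacobian is the integral of the number of preimages. -/
theorem lintegral_eq_lintegral_count {E : Type*} [TopologicalSpace E] [T2Space E]
    [MeasurableSpace E] [BorelSpace E] {U : Set ℂ} (hU : IsOpen U) {F : ℂ → E}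
    (hF : ContinuousOn F U) (hinj : ∀ z ∈ U, ∃ V ∈ 𝓝 z, InjOn F V) {μ : Measure E}
    {J : ℂ → ENNReal}
    (hμ : ∀ A ⊆ U, MeasurableSet A → InjOn F A → μ (F '' A) = ∫⁻ z in A, J z) :
    ∫⁻ z in U, J z = ∫⁻ P, Measure.count (U ∩ F ⁻¹' {P}) ∂μ := by
  obtain ⟨A, hAm, hAd, hAU, hAF⟩ := exists_disjoint_injOn_cover hU hinj
  have hsub : ∀ n, A n ⊆ U := fun n => hAU ▸ subset_iUnion A n
  have hmeas : ∀ n, MeasurableSet (F '' A n) := fun n =>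
    (hAm n).image_of_continuousOn_injOn (hF.mono (hsub n)) (hAF n)
  have hss : ∀ n P, (A n ∩ F ⁻¹' {P}).Subsingleton := fun n P x hx y hy =>
    hAF n hx.1 hy.1 (hx.2.trans hy.2.symm)
  have h1 : ∀ n P, (F '' A n).indicator (fun _ => (1 : ENNReal)) P =
      Measure.count (A n ∩ F ⁻¹' {P}) := by
    intro n P
    by_cases hP : P ∈ F '' A n
    · obtain ⟨z, hz, rfl⟩ := hP
      have h2 : A n ∩ F ⁻¹' {F z} = {z} := (hss n (F z)).eq_singleton_of_mem ⟨hz, rfl⟩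
      rw [indicator_of_mem (mem_image_of_mem F hz), h2, Measure.count_singleton]
    · have h2 : A n ∩ F ⁻¹' {P} = ∅ :=
        eq_empty_of_forall_notMem fun z hz => hP ⟨z, hz.1, hz.2⟩
      rw [indicator_of_notMem hP, h2, measure_empty]
  calc ∫⁻ z in U, J z = ∑' n, ∫⁻ z in A n, J z := by rw [← hAU, lintegral_iUnion hAm hAd]
    _ = ∑' n, ∫⁻ P, (F '' A n).indicator (fun _ => (1 : ENNReal)) P ∂μ := by
      refine tsum_congr fun n => ?_
      rw [← hμ _ (hsub n) (hAm n) (hAF n), lintegral_indicator_const (hmeas n), one_mul]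
    _ = ∫⁻ P, ∑' n, (F '' A n).indicator (fun _ => (1 : ENNReal)) P ∂μ :=
      (lintegral_tsum fun n => (measurable_const.indicator (hmeas n)).aemeasurable).symm
    _ = _ := by
      refine lintegral_congr fun P => ?_
      simp only [h1]
      rw [← hAU, iUnion_inter, measure_iUnion
        (hAd.mono fun i j h => h.mono inter_subset_left inter_subset_left)
        fun n => (hss n P).measurableSet]

lemma hasSum_of_lintegral_ne_top {E ι : Type*} [MeasurableSpace E] [Countable ι] {μ : Measure E}
    {c : E → ENNReal} {Ω : ι → Set E} {n : ι → ℕ} (hm : ∀ i, MeasurableSet (Ω i))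
    (hd : Pairwise (Function.onFun Disjoint Ω)) (hc : ∀ i, ∀ P ∈ Ω i, c P = n i)
    (h0 : ∀ᵐ P ∂μ, P ∉ ⋃ i, Ω i → c P = 0) (hfin : ∫⁻ P, c P ∂μ ≠ ⊤) :
    HasSum (fun i => (n i : ℝ) * (μ (Ω i)).toReal) (∫⁻ P, c P ∂μ).toReal := by
  have h1 : ∫⁻ P, c P ∂μ = ∑' i, n i * μ (Ω i) := by
    calc ∫⁻ P, c P ∂μ = ∫⁻ P in ⋃ i, Ω i, c P ∂μ := by
          rw [← lintegral_indicator (MeasurableSet.iUnion hm)]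
          refine lintegral_congr_ae ?_
          filter_upwards [h0] with P hP
          by_cases h : P ∈ ⋃ i, Ω i
          · rw [indicator_of_mem h]
          · rw [indicator_of_notMem h, hP h]
      _ = ∑' i, ∫⁻ P in Ω i, c P ∂μ := lintegral_iUnion hm hd _
      _ = _ := tsum_congr fun i => by
          rw [setLIntegral_congr_fun (hm i) (hc i), setLIntegral_const]
  rw [h1] at hfin ⊢
  rw [ENNReal.tsum_toReal_eq fun i => ENNReal.ne_top_of_tsum_ne_top hfin i]
  simpa using ENNReal.hasSum_toReal hfin

lemma count_layers {E : Type*} {F : ℂ → E} {P : E} (h : (layers F P).Finite) :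
    Measure.count (ball (0 : ℂ) 1 ∩ F ⁻¹' {P}) = ((layers F P).ncard : ENNReal) := by
  rw [show ball (0 : ℂ) 1 ∩ F ⁻¹' {P} = layers F P from rfl, Measure.count_apply h.measurableSet,
    ← h.cast_ncard_eq]
  rfl

lemma pairwise_disjoint_components {E : Type*} [TopologicalSpace E] {X K : Set E}
    {p : Set E → Prop} (hp : ∀ Ω, p Ω → Ω ∈ complementComponents X K) :
    Pairwise (Function.onFun Disjoint (fun Ω : {Ω : Set E // p Ω} => Ω.1)) := by
  rintro ⟨Ω₁, h1⟩ ⟨Ω₂, h2⟩ hne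
  obtain ⟨P, -, rfl⟩ := hp Ω₁ h1
  obtain ⟨Q, -, rfl⟩ := hp Ω₂ h2
  refine Set.disjoint_left.2 fun R hR hR' => hne (Subtype.ext ?_)
  exact (connectedComponentIn_eq hR).trans (connectedComponentIn_eq hR').symm

lemma subset_of_mem_complementComponents {E : Type*} [TopologicalSpace E] {X K Ω : Set E}
    (h : Ω ∈ complementComponents X K) : Ω ⊆ X \ K := by
  obtain ⟨P, -, rfl⟩ := h
  exact connectedComponentIn_subset _ _

lemma exists_exp_mul_I_eq {z : ℂ} (hz : z ∈ sphere (0 : ℂ) 1) :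
    ∃ θ : ℝ, Complex.exp (θ * Complex.I) = z := by
  refine ⟨z.arg, ?_⟩
  have := Complex.norm_mul_exp_arg_mul_I z
  rwa [mem_sphere_zero_iff_norm.1 hz, Complex.ofReal_one, one_mul] at this

lemma Bounds.notMem_image_sphere {E : Type*} {γ : ℝ → E} {F : ℂ → E} (h : Bounds γ F) {P : E}
    (hP : P ∉ range γ) {z : ℂ} (hz : z ∈ sphere (0 : ℂ) 1) : F z ≠ P := by
  obtain ⟨φ, -, -, -, h⟩ := h
  obtain ⟨θ, rfl⟩ := exists_exp_mul_I_eq hz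
  rw [h]
  exact fun h1 => hP ⟨_, h1⟩

lemma exists_injOn_of_det_ne_zero {F : ℂ → ℂ} {z : ℂ} (hF : ContDiffAt ℝ 1 F z)
    (h : (fderiv ℝ F z).det ≠ 0) : ∃ V ∈ 𝓝 z, InjOn F V := by
  have h1 := hF.hasStrictFDerivAt one_ne_zero
  rw [← ContinuousLinearMap.coe_toContinuousLinearEquivOfDetNeZero _ h] at h1
  exact ⟨(h1.toOpenPartialHomeomorph F).source, (h1.toOpenPartialHomeomorph F).open_source.mem_nhds
    h1.mem_toOpenPartialHomeomorph_source, (h1.toOpenPartialHomeomorph F).injOn⟩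

/-! ### Distorted disks in the Euclidean and the hyperbolic plane -/

namespace PlaneGeometry

variable {G : PlaneGeometry} {γ : ℝ → ℂ} {F : ℂ → ℂ}

lemma measurable_factor (G : PlaneGeometry) : Measurable G.factor := by
  cases G
  · exact measurable_const
  · show Measurable fun w : ℂ => 4 / (1 - ‖w‖ ^ 2) ^ 2
    fun_prop

lemma factor_nonneg (G : PlaneGeometry) (w : ℂ) : 0 ≤ G.factor w := by
  cases G
  · exact zero_le_one
  · show 0 ≤ 4 / (1 - ‖w‖ ^ 2) ^ 2
    positivity

lemma continuousOn_factor (G : PlaneGeometry) : ContinuousOn G.factor G.domain := by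
  cases G
  · exact continuousOn_const
  · show ContinuousOn (fun w : ℂ => 4 / (1 - ‖w‖ ^ 2) ^ 2) (ball 0 1)
    refine ContinuousOn.div (by fun_prop) (by fun_prop) fun w hw => ?_
    rw [mem_ball_zero_iff] at hw
    have := norm_nonneg w
    refine pow_ne_zero 2 (ne_of_gt ?_)
    nlinarith

/-- The area measure of the geometry. -/
def areaMeasure (G : PlaneGeometry) : Measure ℂ :=
  volume.withDensity fun w => ENNReal.ofReal (G.factor w)

lemma areaMeasure_apply (G : PlaneGeometry) {Ω : Set ℂ} (h : MeasurableSet Ω) :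
    G.areaMeasure Ω = G.setArea Ω := withDensity_apply _ h

namespace IsDistortedDisk

lemma contDiffAt (hF : G.IsDistortedDisk F) {z : ℂ} (hz : z ∈ ball (0 : ℂ) 1) :
    ContDiffAt ℝ 1 F z := hF.contDiffOn.contDiffAt (isOpen_ball.mem_nhds hz)

lemma layers_ncard (hF : G.IsDistortedDisk F) (hγF : Bounds γ F) {P : ℂ} (hP : P ∉ range γ)
    {n : ℤ} (hn : HasDegree (fun θ => γ θ - P) n) :
    (layers F P).Finite ∧ ((layers F P).ncard : ℤ) = n := by
  have h1 : ContinuousOn (fun z => F z - P) (closedBall 0 1) := hF.continuousOn.sub continuousOn_const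
  have h2 : ∀ z ∈ sphere (0 : ℂ) 1, F z - P ≠ 0 := fun z hz =>
    sub_ne_zero.2 (hγF.notMem_image_sphere hP hz)
  have h3 : ∀ z ∈ ball (0 : ℂ) 1, F z - P = 0 → IsSimpleZero (fun z => F z - P) z :=
    fun z hz h0 => .of_hasFDerivAt
      (((hF.contDiffAt hz).differentiableAt one_ne_zero).hasFDerivAt.sub_const P) h0
      (hF.det_pos z hz)
  have h4 : {z | z ∈ ball (0 : ℂ) 1 ∧ F z - P = 0} = layers F P := by
    ext z
    simp [layers, sub_eq_zero]
  have h5 := hasDegree_ncard_zeros h1 h2 h3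
  rw [h4] at h5
  refine ⟨h4 ▸ finite_zeros h1 h2 h3, h5.unique ?_⟩
  obtain ⟨φ, hφ, -, hφ', h⟩ := hγF
  simpa only [h] using hn.comp hφ hφ'

lemma area_eq (hF : G.IsDistortedDisk F) :
    G.area F = ∫⁻ P, Measure.count (ball (0 : ℂ) 1 ∩ F ⁻¹' {P}) ∂G.areaMeasure := by
  refine lintegral_eq_lintegral_count isOpen_ball (hF.continuousOn.mono ball_subset_closedBall)
    (fun z hz => exists_injOn_of_det_ne_zero (hF.contDiffAt hz) (hF.det_pos z hz).ne')
    fun A hA hAm hAF => ?_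
  have h1 : ∀ z ∈ A, HasFDerivWithinAt F (fderiv ℝ F z) A z := fun z hz =>
    ((hF.contDiffAt (hA hz)).differentiableAt one_ne_zero).hasFDerivAt.hasFDerivWithinAt
  rw [areaMeasure_apply G (hAm.image_of_continuousOn_injOn
      (hF.continuousOn.mono (hA.trans ball_subset_closedBall)) hAF), setArea,
    lintegral_image_eq_lintegral_abs_det_fderiv_mul volume hAm h1 hAF]
  refine setLIntegral_congr_fun hAm fun z _ => ?_
  have h2 := G.factor_nonneg (F z)
  -- The determinant of the pulled back metric is the square of `factor (F z)` times the Jacobian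
  -- determinant.
  rw [← ENNReal.ofReal_mul (abs_nonneg _), mul_comm, ← abs_of_nonneg h2, ← abs_mul,
    ← Real.sqrt_sq_eq_abs, det_eq]
  congr 2
  simp only [pullbackMetric, Complex.inner]
  simp
  ring

/-- The image of the closed disk is a compact subset of the domain, so the area density is bounded
on it, even in the hyperbolic case. The number of layers is the winding number almost everywhere,
and this is locally integrable. -/
lemma area_ne_top (hγ : IsClosedCurve γ) (hF : G.IsDistortedDisk F) (hγF : Bounds γ F) :
    G.area F ≠ ⊤ := by
  have hK := (isCompact_closedBall (0 : ℂ) 1).image_of_continuousOn hF.continuousOn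
  obtain ⟨R, hR⟩ := hK.isBounded.subset_ball (0 : ℂ)
  obtain ⟨C, hC⟩ := hK.exists_bound_of_continuousOn
    (G.continuousOn_factor.mono hF.mapsTo.image_subset)
  have h1 : ∀ᵐ P ∂volume, ENNReal.ofReal (G.factor P) *
      Measure.count (ball (0 : ℂ) 1 ∩ F ⁻¹' {P}) ≤
      (ball 0 R).indicator (fun P => ENNReal.ofReal C * ‖windingNumber γ P‖ₑ) P := by
    filter_upwards [measure_eq_zero_iff_ae_notMem.1 hγ.volume_range] with P hP
    obtain ⟨n, hn⟩ := hγ.exists_hasDegree_sub hP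
    obtain ⟨h2, h3⟩ := hF.layers_ncard hγF hP hn
    rw [count_layers h2]
    rcases (layers F P).eq_empty_or_nonempty with h4 | ⟨z, hz⟩
    · simp [h4]
    · have h4 : P ∈ F '' closedBall 0 1 := ⟨z, ball_subset_closedBall hz.1, hz.2⟩
      rw [indicator_of_mem (hR h4), hγ.windingNumber_eq hP hn, ← h3]
      refine mul_le_mul' (ENNReal.ofReal_le_ofReal ((le_abs_self _).trans (hC P h4))) ?_
      rw [← ofReal_norm]
      simp
  rw [hF.area_eq, areaMeasure]
  refine ne_top_of_le_ne_top ?_ ((lintegral_withDensity_le_lintegral_mul _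
    G.measurable_factor.ennreal_ofReal _).trans (lintegral_mono_ae h1))
  rw [lintegral_indicator measurableSet_ball, lintegral_const_mul' _ _ ENNReal.ofReal_ne_top]
  exact ENNReal.mul_ne_top ENNReal.ofReal_ne_top (hγ.lintegral_windingNumber_ne_top R)

lemma hasSum_area (hγ : IsClosedCurve γ) (hF : G.IsDistortedDisk F) (hγF : Bounds γ F)
    {ν : Set ℂ → ℤ} (hν : ∀ Ω ∈ complementComponents univ (range γ), ∀ P ∈ Ω,
      (layers F P).Finite ∧ ((layers F P).ncard : ℤ) = ν Ω) :
    HasSum (fun Ω : {Ω : Set ℂ //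
        Ω ∈ complementComponents univ (range γ) ∧ Bornology.IsBounded Ω} =>
      (ν Ω.1 : ℝ) * (G.setArea Ω.1).toReal) (G.area F).toReal := by
  have hopen : ∀ Ω ∈ complementComponents univ (range γ), IsOpen Ω := by
    rintro _ ⟨P, -, rfl⟩
    exact (isOpen_univ.sdiff hγ.isCompact_range.isClosed).connectedComponentIn
  have hne : ∀ Ω ∈ complementComponents univ (range γ), Ω.Nonempty := by
    rintro _ ⟨P, hP, rfl⟩
    exact ⟨P, mem_connectedComponentIn hP⟩
  have hcount : Countable {Ω : Set ℂ //
      Ω ∈ complementComponents univ (range γ) ∧ Bornology.IsBounded Ω} :=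
    (pairwise_disjoint_components fun _ h => h.1).countable_of_isOpen_disjoint (fun Ω => hopen Ω.1 Ω.2.1)
      fun Ω => hne Ω.1 Ω.2.1
  have hfin := hF.area_ne_top hγ hγF
  rw [hF.area_eq] at hfin ⊢
  have hpos : ∀ Ω ∈ complementComponents univ (range γ), 0 ≤ ν Ω := fun Ω hΩ => by
    obtain ⟨P, hP⟩ := hne Ω hΩ
    rw [← (hν Ω hΩ P hP).2]
    exact Int.natCast_nonneg _
  have key := hasSum_of_lintegral_ne_top (n := fun Ω : {Ω : Set ℂ //
      Ω ∈ complementComponents univ (range γ) ∧ Bornology.IsBounded Ω} => (ν Ω.1).toNat)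
    (fun Ω => (hopen Ω.1 Ω.2.1).measurableSet) (pairwise_disjoint_components fun _ h => h.1)
    (fun Ω P hP => ?_) ?_ hfin
  · convert key using 3 with Ω
    · exact_mod_cast (Int.toNat_of_nonneg (hpos Ω.1 Ω.2.1)).symm
    · rw [areaMeasure_apply G (hopen Ω.1 Ω.2.1).measurableSet]
  · rw [count_layers (hν Ω.1 Ω.2.1 P hP).1, ← (hν Ω.1 Ω.2.1 P hP).2]
    simp
  · have h0 : ∀ᵐ P ∂volume, P ∉ range γ := measure_eq_zero_iff_ae_notMem.1 hγ.volume_range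
    filter_upwards [(withDensity_absolutelyContinuous _ _ : G.areaMeasure ≪ _).ae_le h0] with P hP hP'
    set Ω := connectedComponentIn (univ \ range γ) P
    have hPm : P ∈ univ \ range γ := ⟨mem_univ P, hP⟩
    have hΩ : Ω ∈ complementComponents univ (range γ) := ⟨P, hPm, rfl⟩
    have hPΩ : P ∈ Ω := mem_connectedComponentIn hPm
    -- A point off the curve and in no bounded component lies in an unbounded one. That component
    -- leaves the compact image of the disk, so its number of layers is zero.
    have hunb : ¬ Bornology.IsBounded Ω := fun hb =>
      hP' (mem_iUnion.2 ⟨⟨Ω, hΩ, hb⟩, hPΩ⟩)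
    have hK := (isCompact_closedBall (0 : ℂ) 1).image_of_continuousOn hF.continuousOn
    obtain ⟨Q, hQ, hQ'⟩ := not_subset.1 fun h => hunb (hK.isBounded.subset h)
    have h1 : layers F Q = ∅ := eq_empty_of_forall_notMem fun z hz =>
      hQ' ⟨z, ball_subset_closedBall hz.1, hz.2⟩
    have h2 := (hν Ω hΩ P hPΩ).2
    rw [← (hν Ω hΩ Q hQ).2, h1, ncard_empty] at h2
    rw [count_layers (hν Ω hΩ P hPΩ).1]
    exact_mod_cast h2

end IsDistortedDisk

/-- The theorem for the Euclidean and the hyperbolic plane. -/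
theorem area_eq_sum (G : PlaneGeometry) (hγ : IsClosedCurve γ) :
    (∃ ν : Set ℂ → ℤ,
      (∀ Ω ∈ complementComponents univ (range γ), ∀ P ∈ Ω, windingNumber γ P = ν Ω) ∧
      ∀ F : ℂ → ℂ, G.IsDistortedDisk F → Bounds γ F →
        (∀ Ω ∈ complementComponents univ (range γ), ∀ P ∈ Ω,
          (layers F P).Finite ∧ ((layers F P).ncard : ℤ) = ν Ω) ∧
        G.area F ≠ ⊤ ∧
        HasSum (fun Ω : {Ω : Set ℂ //
            Ω ∈ complementComponents univ (range γ) ∧ Bornology.IsBounded Ω} =>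
          (ν Ω.1 : ℝ) * (G.setArea Ω.1).toReal) (G.area F).toReal) ∧
    ∀ F₁ F₂ : ℂ → ℂ, G.IsDistortedDisk F₁ → G.IsDistortedDisk F₂ →
      Bounds γ F₁ → Bounds γ F₂ → G.area F₁ = G.area F₂ := by
  choose! d hd using fun w (hw : w ∈ univ \ range γ) => hγ.exists_hasDegree_sub hw.2
  have hopen : IsOpen (univ \ range γ) := isOpen_univ.sdiff hγ.isCompact_range.isClosed
  obtain ⟨ν, hν⟩ := exists_eq_of_locally_const (X := univ) (K := range γ) d fun P hP => by
    rw [hopen.nhdsWithin_eq hP]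
    filter_upwards [hγ.eventually_hasDegree_sub (hd P hP), hopen.mem_nhds hP] with Q hQ hQ'
    exact (hd Q hQ').unique hQ
  have hmem : ∀ Ω ∈ complementComponents univ (range γ), ∀ P ∈ Ω, P ∈ univ \ range γ :=
    fun Ω hΩ P hP => subset_of_mem_complementComponents hΩ hP
  have main : ∀ F : ℂ → ℂ, G.IsDistortedDisk F → Bounds γ F → _ := fun F hF hγF =>
    have h1 : ∀ Ω ∈ complementComponents univ (range γ), ∀ P ∈ Ω,
        (layers F P).Finite ∧ ((layers F P).ncard : ℤ) = ν Ω := fun Ω hΩ P hP =>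
      hν Ω hΩ P hP ▸ hF.layers_ncard hγF (hmem Ω hΩ P hP).2 (hd P (hmem Ω hΩ P hP))
    And.intro h1 (And.intro (hF.area_ne_top hγ hγF) (hF.hasSum_area hγ hγF h1))
  refine ⟨⟨ν, fun Ω hΩ P hP => ?_, main⟩, fun F₁ F₂ h₁ h₂ hb₁ hb₂ => ?_⟩
  · rw [← hν Ω hΩ P hP]
    exact hγ.windingNumber_eq (hmem Ω hΩ P hP).2 (hd P (hmem Ω hΩ P hP))
  · rw [← ENNReal.toReal_eq_toReal_iff' (main F₁ h₁ hb₁).2.1 (main F₂ h₂ hb₂).2.1]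
    exact (main F₁ h₁ hb₁).2.2.unique (main F₂ h₂ hb₂).2.2

end PlaneGeometry

/-! ### Spinors: lifts of points of the sphere to `ℂ²` -/

namespace Sphere

lemma sum_sq_eq_one {v : Space} (hv : v ∈ domain) : v 0 ^ 2 + v 1 ^ 2 + v 2 ^ 2 = 1 := by
  have h := EuclideanSpace.real_norm_sq_eq v
  rw [mem_sphere_zero_iff_norm.1 hv, Fin.sum_univ_three] at h
  linarith

lemma sum_sq_eq_one' {v : Space} (hv : v ∈ domain) :
    (v 0 : ℂ) ^ 2 + (v 1 : ℂ) ^ 2 + (v 2 : ℂ) ^ 2 = 1 := by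
  simpa using congrArg Complex.ofReal (sum_sq_eq_one hv)

lemma mem_domain_iff {v : Space} : v ∈ domain ↔ v 0 ^ 2 + v 1 ^ 2 + v 2 ^ 2 = 1 := by
  refine ⟨sum_sq_eq_one, fun h => mem_sphere_zero_iff_norm.2 ?_⟩
  have h1 := EuclideanSpace.real_norm_sq_eq v
  rw [Fin.sum_univ_three, h] at h1
  nlinarith [norm_nonneg v]

/-- The area form of `ℂ²`. -/
def wedge (p q : ℂ × ℂ) : ℂ := p.1 * q.2 - p.2 * q.1

/-- The standard Hermitian form of `ℂ²`. -/
def herm (p q : ℂ × ℂ) : ℂ := starRingEnd ℂ p.1 * q.1 + starRingEnd ℂ p.2 * q.2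

/-- Twice the orthogonal projection of `ℂ²` to the complex line which represents `v`. -/
def proj (v : Space) (p : ℂ × ℂ) : ℂ × ℂ :=
  ((1 + v 2) * p.1 + (v 0 - v 1 * Complex.I) * p.2,
    (v 0 + v 1 * Complex.I) * p.1 + (1 - v 2) * p.2)

/-- `p` is a nonzero vector on the complex line in `ℂ²` which represents the point `v` of the
sphere. -/
structure IsLift (v : Space) (p : ℂ × ℂ) : Prop where
  ne_zero : p ≠ 0
  eq₁ : (v 0 + v 1 * Complex.I) * p.1 = (1 + v 2) * p.2
  eq₂ : (v 0 - v 1 * Complex.I) * p.2 = (1 - v 2) * p.1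

lemma herm_self_ne_zero {p : ℂ × ℂ} (hp : p ≠ 0) : herm p p ≠ 0 := by
  intro h
  have h1 : Complex.normSq p.1 + Complex.normSq p.2 = 0 := by
    have h2 : herm p p = ((Complex.normSq p.1 + Complex.normSq p.2 : ℝ) : ℂ) := by
      rw [herm, Complex.ofReal_add, Complex.normSq_eq_conj_mul_self,
        Complex.normSq_eq_conj_mul_self]
    rw [h2] at h
    exact_mod_cast h
  have h2 := Complex.normSq_nonneg p.1
  have h3 := Complex.normSq_nonneg p.2
  exact hp (Prod.ext (Complex.normSq_eq_zero.1 (by linarith)) (Complex.normSq_eq_zero.1 (by linarith)))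

/-- The coefficient is that of the Hermitian projection to the line of `p`; this formula makes it
continuous in `p` and `q`. -/
lemma eq_smul_of_wedge_eq_zero {p q : ℂ × ℂ} (hp : p ≠ 0) (h : wedge p q = 0) :
    q = (herm p q / herm p p) • p := by
  have h0 := herm_self_ne_zero hp
  rw [wedge] at h
  apply Prod.ext
  · rw [Prod.smul_fst, smul_eq_mul, div_mul_eq_mul_div, eq_div_iff h0, herm, herm]
    linear_combination (-starRingEnd ℂ p.2) * h
  · rw [Prod.smul_snd, smul_eq_mul, div_mul_eq_mul_div, eq_div_iff h0, herm, herm]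
    linear_combination (starRingEnd ℂ p.1) * h

lemma wedge_smul_smul (a b : ℂ) (p q : ℂ × ℂ) : wedge (a • p) (b • q) = a * b * wedge p q := by
  simp only [wedge, Prod.smul_fst, Prod.smul_snd, smul_eq_mul]
  ring

lemma continuous_wedge : Continuous fun q : (ℂ × ℂ) × (ℂ × ℂ) => wedge q.1 q.2 := by
  unfold wedge
  fun_prop

lemma continuous_herm : Continuous fun q : (ℂ × ℂ) × (ℂ × ℂ) => herm q.1 q.2 := by
  have := Complex.continuous_conj
  unfold herm
  fun_prop

lemma _root_.ContinuousOn.sphereProj {X : Type*} [TopologicalSpace X] {F : X → Space}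
    {Φ : X → ℂ × ℂ} {s : Set X} (hF : ContinuousOn F s) (hΦ : ContinuousOn Φ s) :
    ContinuousOn (fun x => proj (F x) (Φ x)) s := by
  unfold proj
  fun_prop

namespace IsLift

variable {u v : Space} {p q : ℂ × ℂ}

lemma wedge_eq_zero (hp : IsLift v p) (hq : IsLift v q) : wedge p q = 0 := by
  have h1 := hp.eq₁
  have h2 := hp.eq₂
  have h3 := hq.eq₁
  have h4 := hq.eq₂
  have h5 : (2 : ℂ) * wedge p q = 0 := by
    rw [wedge]
    linear_combination q.1 * h1 - p.1 * h3 - q.2 * h2 + p.2 * h4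
  simpa using h5

/-- The Hopf map: `v` is recovered from any nonzero vector on its line. -/
lemma ratio (hp : IsLift v p) :
    v 0 * herm p p = (starRingEnd ℂ p.1 * p.2 + starRingEnd ℂ p.2 * p.1) ∧
      v 1 * herm p p = Complex.I * (starRingEnd ℂ p.2 * p.1 - starRingEnd ℂ p.1 * p.2) ∧
      v 2 * herm p p = starRingEnd ℂ p.1 * p.1 - starRingEnd ℂ p.2 * p.2 := by
  have h1 := hp.eq₁
  have h2 := hp.eq₂
  have h3 := congrArg (starRingEnd ℂ) h1
  have h4 := congrArg (starRingEnd ℂ) h2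
  simp only [map_mul, map_add, map_sub, map_one, Complex.conj_ofReal, Complex.conj_I] at h3 h4
  have hI := Complex.I_mul_I
  simp only [herm]
  refine ⟨?_, ?_, ?_⟩
  · linear_combination (1 / 2) * starRingEnd ℂ p.1 * h1 + (1 / 2) * starRingEnd ℂ p.2 * h2 +
      (1 / 2) * p.1 * h3 + (1 / 2) * p.2 * h4
  · linear_combination (-Complex.I / 2) * starRingEnd ℂ p.1 * h1 +
      (Complex.I / 2) * starRingEnd ℂ p.2 * h2 +
      (Complex.I / 2) * p.1 * h3 - (Complex.I / 2) * p.2 * h4 +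
      (v 1 * (starRingEnd ℂ p.1 * p.1 + starRingEnd ℂ p.2 * p.2)) * hI
  · linear_combination starRingEnd ℂ p.1 * h2 - p.2 * h3

lemma eq_of_wedge_eq_zero (hp : IsLift u p) (hq : IsLift v q) (h : wedge p q = 0) : u = v := by
  set k := herm p q / herm p p
  have hk : q = k • p := eq_smul_of_wedge_eq_zero hp.ne_zero h
  have hk0 : k ≠ 0 := fun h0 => hq.ne_zero (by rw [hk, h0, zero_smul])
  have hp' : IsLift v p := by
    have h1 := hq.eq₁
    have h2 := hq.eq₂
    rw [hk, Prod.smul_fst, Prod.smul_snd, smul_eq_mul, smul_eq_mul] at h1 h2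
    refine ⟨hp.ne_zero, mul_left_cancel₀ hk0 ?_, mul_left_cancel₀ hk0 ?_⟩
    · linear_combination h1
    · linear_combination h2
  have h0 := herm_self_ne_zero hp.ne_zero
  ext i
  fin_cases i
  · exact_mod_cast mul_right_cancel₀ h0 (hp.ratio.1.trans hp'.ratio.1.symm)
  · exact_mod_cast mul_right_cancel₀ h0 (hp.ratio.2.1.trans hp'.ratio.2.1.symm)
  · exact_mod_cast mul_right_cancel₀ h0 (hp.ratio.2.2.trans hp'.ratio.2.2.symm)

lemma wedge_eq_zero_iff (hp : IsLift u p) (hq : IsLift v q) : wedge p q = 0 ↔ u = v :=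
  ⟨hp.eq_of_wedge_eq_zero hq, fun h => hp.wedge_eq_zero (h ▸ hq)⟩

lemma proj_self (hp : IsLift v p) : proj v p = (2 : ℂ) • p := by
  have h1 := hp.eq₁
  have h2 := hp.eq₂
  apply Prod.ext
  · rw [proj, Prod.smul_fst, smul_eq_mul]
    linear_combination h2
  · rw [proj, Prod.smul_snd, smul_eq_mul]
    linear_combination h1

/-- With Pauli matrices `σ`, `proj v` is `1 + v·σ` and the equations of a lift say that `1 - v·σ`
kills it. Since `(v·σ)² = 1` on the unit sphere, the product of the two vanishes. -/
lemma of_proj_ne_zero (hv : v ∈ domain) (h : proj v p ≠ 0) : IsLift v (proj v p) := by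
  have h1 := sum_sq_eq_one' hv
  have hI := Complex.I_mul_I
  refine ⟨h, ?_, ?_⟩
  · simp only [proj]
    linear_combination p.2 * h1 - p.2 * v 1 ^ 2 * hI
  · simp only [proj]
    linear_combination p.1 * h1 - p.1 * v 1 ^ 2 * hI

/-- The projection of a lift of `u` is a lift of `v`, unless `v` is antipodal to `u`. -/
lemma proj (hp : IsLift u p) (hv : v ∈ domain) (huv : u ≠ -v) : IsLift v (proj v p) := by
  refine of_proj_ne_zero hv fun h => huv ?_
  have h1 := congrArg Prod.fst h
  have h2 := congrArg Prod.snd h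
  simp only [Sphere.proj, Prod.fst_zero, Prod.snd_zero] at h1 h2
  -- The kernel of `proj v` is the line of `-v`, so a vanishing projection makes `p` a lift of `-v`
  -- too.
  refine hp.eq_of_wedge_eq_zero (q := p) ⟨hp.ne_zero, ?_, ?_⟩ (by rw [wedge]; ring)
  · simp only [PiLp.neg_apply, Complex.ofReal_neg]
    linear_combination -h2
  · simp only [PiLp.neg_apply, Complex.ofReal_neg]
    linear_combination -h1

end IsLift

lemma dist_neg_self {v : Space} (hv : v ∈ domain) : dist (-v) v = 2 := by
  rw [dist_eq_norm, ← neg_add', norm_neg, ← two_smul ℝ, norm_smul, mem_sphere_zero_iff_norm.1 hv]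
  norm_num

lemma ne_neg_self {v : Space} (hv : v ∈ domain) : v ≠ -v := fun h => by
  have h1 := dist_neg_self hv
  rw [← h, dist_self] at h1
  norm_num at h1

lemma infinity_mem : infinity ∈ domain := by
  simp [mem_domain_iff, infinity]

lemma isLift_infinity : IsLift infinity (0, 1) := by
  refine ⟨by simp, ?_, ?_⟩ <;> simp [infinity]

lemma one_add_ne_zero {v : Space} (hv : v ∈ domain) (h : v ≠ infinity) : 1 + v 2 ≠ 0 := by
  intro h0
  have h1 := sum_sq_eq_one hv
  have h2 : v 2 = -1 := by linarith
  rw [h2] at h1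
  have h3 : v 0 = 0 := by nlinarith [sq_nonneg (v 0), sq_nonneg (v 1)]
  have h4 : v 1 = 0 := by nlinarith [sq_nonneg (v 0), sq_nonneg (v 1)]
  refine h ?_
  ext i
  fin_cases i <;> simp [infinity, h2, h3, h4]

lemma isLift_coord {v : Space} (hv : v ∈ domain) (h : v ≠ infinity) : IsLift v (1, coord v) := by
  have h0 : (1 + v 2 : ℂ) ≠ 0 := by
    have h1 := Complex.ofReal_ne_zero.2 (one_add_ne_zero hv h)
    simpa using h1
  have h1 := sum_sq_eq_one' hv
  refine ⟨by simp, ?_, ?_⟩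
  · simp only [coord]
    field_simp
  · simp only [coord]
    field_simp
    linear_combination h1 - v 1 ^ 2 * Complex.I_sq

lemma exists_isLift {v : Space} (hv : v ∈ domain) : ∃ p, IsLift v p := by
  by_cases h : v = infinity
  · exact ⟨_, h ▸ isLift_infinity⟩
  · exact ⟨_, isLift_coord hv h⟩

/-- A map of the disk to the sphere lifts to `ℂ²`. -/
theorem exists_lift {F : ℂ → Space} (hF : ContinuousOn F (closedBall 0 1))
    (hF' : MapsTo F (closedBall 0 1) domain) :
    ∃ Φ : ℂ → ℂ × ℂ, ContinuousOn Φ (closedBall 0 1) ∧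
      ∀ z ∈ closedBall (0 : ℂ) 1, IsLift (F z) (Φ z) := by
  -- The tolerance `2` is the distance of antipodal points. From `F (k z / (n + 1))` to the next
  -- radius the value never jumps to its antipode, so projecting one lift gives the next; the
  -- induction starts from the constant map at the centre.
  obtain ⟨δ, hδ, hδF⟩ := Metric.uniformContinuousOn_iff.1
    ((isCompact_closedBall (0 : ℂ) 1).uniformContinuousOn_of_continuous hF) 2 two_pos
  obtain ⟨n, hn⟩ := exists_nat_one_div_lt hδ
  have hn0 : (0 : ℝ) < n + 1 := by positivity
  have hmem : ∀ k ≤ n + 1, ∀ z ∈ closedBall (0 : ℂ) 1,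
      (((k : ℝ) / (n + 1) : ℝ) : ℂ) * z ∈ closedBall (0 : ℂ) 1 := by
    intro k hk z hz
    rw [mem_closedBall_zero_iff] at hz ⊢
    rw [norm_mul, Complex.norm_real, Real.norm_of_nonneg (by positivity)]
    have : (k : ℝ) / (n + 1) ≤ 1 := (div_le_one hn0).2 (by exact_mod_cast hk)
    exact mul_le_one₀ this (norm_nonneg z) hz
  suffices h : ∀ k ≤ n + 1, ∃ Φ : ℂ → ℂ × ℂ, ContinuousOn Φ (closedBall 0 1) ∧
      ∀ z ∈ closedBall (0 : ℂ) 1, IsLift (F ((((k : ℝ) / (n + 1) : ℝ) : ℂ) * z)) (Φ z) by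
    obtain ⟨Φ, h1, h2⟩ := h (n + 1) le_rfl
    refine ⟨Φ, h1, fun z hz => ?_⟩
    have h3 : (((n + 1 : ℕ) : ℝ) / (n + 1) : ℝ) = 1 := by
      push_cast
      exact div_self hn0.ne'
    have h4 := h2 z hz
    rwa [h3, Complex.ofReal_one, one_mul] at h4
  intro k
  induction k with
  | zero =>
    intro _
    obtain ⟨p, hp⟩ := exists_isLift (hF' (mem_closedBall_self zero_le_one))
    exact ⟨fun _ => p, continuousOn_const, fun z _ => by simpa using hp⟩
  | succ k ih =>
    intro hk
    obtain ⟨Φ, h1, h2⟩ := ih (by omega)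
    refine ⟨fun z => proj (F (((((k + 1 : ℕ) : ℝ) / (n + 1) : ℝ) : ℂ) * z)) (Φ z), ?_,
      fun z hz => (h2 z hz).proj (hF' (hmem _ hk z hz)) fun h => ?_⟩
    · have h3 : ContinuousOn (fun z : ℂ => (((((k + 1 : ℕ) : ℝ) / (n + 1) : ℝ) : ℂ) * z))
          (closedBall 0 1) := by fun_prop
      exact ContinuousOn.sphereProj (hF.comp h3 (hmem _ hk)) h1
    · have h3 := hδF _ (hmem k (by omega) z hz) _ (hmem _ hk z hz) ?_
      · rw [h, dist_neg_self (hF' (hmem _ hk z hz))] at h3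
        exact lt_irrefl _ h3
      · rw [dist_eq_norm, ← sub_mul, norm_mul, ← Complex.ofReal_sub, Complex.norm_real,
          ← sub_div, norm_div]
        have h5 : ‖((k : ℝ) - ((k + 1 : ℕ) : ℝ))‖ = 1 := by
          push_cast
          simp
        rw [h5, Real.norm_of_nonneg hn0.le]
        refine lt_of_le_of_lt ?_ hn
        have := mem_closedBall_zero_iff.1 hz
        exact mul_le_of_le_one_right (by positivity) this

/-- The linear form `v ↦ wedge p (proj v p)`. -/
def spinForm (p : ℂ × ℂ) : Space →L[ℝ] ℂ :=
  LinearMap.toContinuousLinearMap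
    { toFun := fun v => (v 0 + v 1 * Complex.I) * p.1 ^ 2 - 2 * v 2 * p.1 * p.2
        - (v 0 - v 1 * Complex.I) * p.2 ^ 2
      map_add' := fun u v => by simp; ring
      map_smul' := fun c v => by simp; ring }

lemma spinForm_apply (p : ℂ × ℂ) (v : Space) :
    spinForm p v = (v 0 + v 1 * Complex.I) * p.1 ^ 2 - 2 * v 2 * p.1 * p.2
        - (v 0 - v 1 * Complex.I) * p.2 ^ 2 := rfl

lemma wedge_proj (p : ℂ × ℂ) (v : Space) : wedge p (proj v p) = spinForm p v := by
  rw [spinForm_apply, wedge, proj]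
  ring

/-- `spinForm p` carries the outward orientation of the sphere at `v` to that of `ℂ`, the
determinants differing by the factor `‖p‖⁴` for the Hermitian norm. -/
lemma spinForm_det {v : Space} {p : ℂ × ℂ} (hp : IsLift v p) (a b : Space) :
    ∃ s > 0, (spinForm p a).re * (spinForm p b).im - (spinForm p b).re * (spinForm p a).im =
      s * (Matrix.of fun i j : Fin 3 => (![v, a, b] i) j).det := by
  have h0 := herm_self_ne_zero hp.ne_zero
  have hr : herm p p = ((Complex.normSq p.1 + Complex.normSq p.2 : ℝ) : ℂ) := by
    rw [herm, Complex.ofReal_add, Complex.normSq_eq_conj_mul_self,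
      Complex.normSq_eq_conj_mul_self]
  set s := Complex.normSq p.1 + Complex.normSq p.2 with hs
  have hs0 : s ≠ 0 := fun h => h0 (by rw [hr, h, Complex.ofReal_zero])
  obtain ⟨h1, h2, h3⟩ := hp.ratio
  rw [hr, ← Complex.ofReal_mul] at h1 h2 h3
  have k1 := congrArg Complex.re h1
  have k2 := congrArg Complex.re h2
  have k3 := congrArg Complex.re h3
  simp at k1 k2 k3
  refine ⟨s ^ 2, by positivity, ?_⟩
  rw [Matrix.det_fin_three]
  simp only [Matrix.of_apply, Matrix.cons_val_zero, Matrix.cons_val_one, Matrix.cons_val]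
  -- One factor `s` is moved onto each coordinate of `v`, where the Hopf formulas `k1`, `k2`, `k3`
  -- apply.
  have e : ∀ x y z t u w : ℝ, s ^ 2 * (v 0 * x * y - v 0 * z * t - v 1 * u * y + v 1 * z * w
    + v 2 * u * t - v 2 * x * w) = s * ((v 0 * s) * x * y - (v 0 * s) * z * t - (v 1 * s) * u * y
      + (v 1 * s) * z * w + (v 2 * s) * u * t - (v 2 * s) * x * w) := by intros; ring
  rw [e, k1, k2, k3, hs, Complex.normSq_apply, Complex.normSq_apply]
  simp [spinForm_apply, pow_two]
  ring

end Sphere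

namespace Sphere

/-! ### Lifts of distorted disks -/

lemma contDiffAt_proj {F : ℂ → Space} {z₀ : ℂ} (hF : ContDiffAt ℝ 1 F z₀) (p : ℂ × ℂ) :
    ContDiffAt ℝ 1 (fun z => (proj (F z) p).1) z₀ ∧ ContDiffAt ℝ 1 (fun z => (proj (F z) p).2) z₀ := by
  have h : ∀ i, ContDiffAt ℝ 1 (fun z => (F z i : ℂ)) z₀ := fun i =>
    (Complex.ofRealCLM.comp (EuclideanSpace.proj i : Space →L[ℝ] ℝ)).contDiff.contDiffAt.comp z₀ hF
  have h0 := h 0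
  have h1 := h 1
  have h2 := h 2
  simp only [proj]
  constructor <;> fun_prop

/-- The function of two points is `C¹` and vanishes on the diagonal. At `(z₀, z₀)` its derivative in
the second point is `2 * spinForm p` after the derivative of `F`, of positive determinant. -/
lemma exists_wedge_proj_sub_le {F : ℂ → Space} {z₀ : ℂ} (hF : ContDiffAt ℝ 1 F z₀)
    (hdet : 0 < (Matrix.of fun i j : Fin 3 =>
      (![F z₀, fderiv ℝ F z₀ 1, fderiv ℝ F z₀ Complex.I] i) j).det)
    {p : ℂ × ℂ} (hp : IsLift (F z₀) p) :
    ∃ a : ℂ, a ≠ 0 ∧ ∃ c < (1 : ℝ), ∀ᶠ q : ℂ × ℂ in 𝓝 (z₀, z₀),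
      ‖wedge (proj (F q.1) p) (proj (F q.2) p) - a * (q.2 - q.1)‖ ≤ c * ‖a‖ * ‖q.2 - q.1‖ := by
  obtain ⟨hS1, hS2⟩ := contDiffAt_proj hF p
  set D : ℂ × ℂ → ℂ := fun q => wedge (proj (F q.1) p) (proj (F q.2) p) with hD
  have hDc : ContDiffAt ℝ 1 D (z₀, z₀) := by
    have a1 := hS1.comp (z₀, z₀) (f := Prod.fst) contDiffAt_fst
    have a2 := hS2.comp (z₀, z₀) (f := Prod.fst) contDiffAt_fst
    have b1 := hS1.comp (z₀, z₀) (f := Prod.snd) contDiffAt_snd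
    have b2 := hS2.comp (z₀, z₀) (f := Prod.snd) contDiffAt_snd
    exact (a1.mul b2).sub (a2.mul b1)
  have hDs := hDc.hasStrictFDerivAt one_ne_zero
  set D' := fderiv ℝ D (z₀, z₀)
  set L : ℂ →L[ℝ] ℂ := D'.comp (ContinuousLinearMap.inr ℝ ℂ ℂ) with hL
  have hL2 : ∀ u, L u = 2 * spinForm p (fderiv ℝ F z₀ u) := by
    have h1 : HasFDerivAt (fun u => D (z₀, u)) L z₀ :=
      hDs.hasFDerivAt.comp z₀ (hasFDerivAt_prodMk_right z₀ z₀)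
    have h2 : (fun u => D (z₀, u)) = fun u => (2 : ℂ) * spinForm p (F u) := by
      funext u
      rw [hD, ← wedge_proj]
      dsimp only
      rw [hp.proj_self, ← one_smul ℂ (proj (F u) p), wedge_smul_smul, mul_one, one_smul]
    have h3 : HasFDerivAt (fun u => (2 : ℂ) * spinForm p (F u))
        ((2 : ℂ) • (spinForm p).comp (fderiv ℝ F z₀)) z₀ :=
      ((spinForm p).hasFDerivAt.comp z₀
        (hF.differentiableAt one_ne_zero).hasFDerivAt).const_mul 2
    rw [h2] at h1
    intro u
    rw [h1.unique h3]
    simp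
  have hdetL : 0 < L.det := by
    obtain ⟨s, hs, h⟩ := spinForm_det hp (fderiv ℝ F z₀ 1) (fderiv ℝ F z₀ Complex.I)
    have h4 : L.det = 4 * (s * (Matrix.of fun i j : Fin 3 =>
      (![F z₀, fderiv ℝ F z₀ 1, fderiv ℝ F z₀ Complex.I] i) j).det) := by
      rw [← h, det_eq, hL2, hL2]
      simp
      ring
    rw [h4]
    positivity
  obtain ⟨a, ha, c, hc, hac⟩ := exists_norm_sub_mul_le hdetL
  refine ⟨a, ha, (c + 1) / 2, by linarith, ?_⟩
  have hε : 0 < (1 - c) / 2 * ‖a‖ := mul_pos (by linarith) (norm_pos_iff.2 ha)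
  -- Strict differentiability is used between a pair and its diagonal partner, so that the estimate
  -- is uniform in both points.
  have ht : Filter.Tendsto (fun q : ℂ × ℂ => ((q.1, q.2), (q.1, q.1))) (𝓝 (z₀, z₀))
      (𝓝 ((z₀, z₀), (z₀, z₀))) :=
    (show Continuous fun q : ℂ × ℂ => ((q.1, q.2), (q.1, q.1)) by fun_prop).tendsto (z₀, z₀)
  filter_upwards [ht.eventually (hDs.isLittleO.def hε)] with q hq
  have h0 : D (q.1, q.1) = 0 := by
    simp only [hD, wedge]
    ring
  have h1 : D' ((q.1, q.2) - (q.1, q.1)) = L (q.2 - q.1) := by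
    rw [Prod.mk_sub_mk, sub_self]
    rfl
  have h2 : ‖(q.1, q.2) - (q.1, q.1)‖ = ‖q.2 - q.1‖ := by simp [Prod.norm_def]
  rw [h0, h1, h2, sub_zero] at hq
  have h3 : D q - a * (q.2 - q.1) = (D q - L (q.2 - q.1)) + (L (q.2 - q.1) - a * (q.2 - q.1)) := by
    ring
  change ‖D q - _‖ ≤ _
  rw [h3]
  refine (norm_add_le _ _).trans ((add_le_add hq (hac _)).trans (le_of_eq ?_))
  ring

lemma continuousAt_herm_div {X : Type*} [TopologicalSpace X] {Γ₁ Γ₂ : X → ℂ × ℂ} {x : X}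
    (h₁ : ContinuousAt Γ₁ x) (h₂ : ContinuousAt Γ₂ x) (h : Γ₁ x ≠ 0) :
    ContinuousAt (fun x => herm (Γ₁ x) (Γ₂ x) / herm (Γ₁ x) (Γ₁ x)) x := by
  have a1 := continuous_herm.continuousAt.comp (h₁.prodMk h₂)
  have a2 := continuous_herm.continuousAt.comp (h₁.prodMk h₁)
  exact a1.div a2 (herm_self_ne_zero h)

namespace IsDistortedDisk

variable {F : ℂ → Space} {Φ : ℂ → ℂ × ℂ}

lemma contDiffAt (hF : IsDistortedDisk F) {z : ℂ} (hz : z ∈ ball (0 : ℂ) 1) :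
    ContDiffAt ℝ 1 F z := hF.contDiffOn.contDiffAt (isOpen_ball.mem_nhds hz)

/-- Near `z₀` the lift `Φ` is a continuous nonvanishing multiple `k` of `proj (F z) (Φ z₀)`, so
`wedge` only gains the factor `k q.1 * k q.2`. The two-point form serves both for counting zeros and
for injectivity. -/
lemma exists_wedge_sub_le (hF : IsDistortedDisk F) (hΦ : ContinuousOn Φ (closedBall 0 1))
    (hFΦ : ∀ z ∈ closedBall (0 : ℂ) 1, IsLift (F z) (Φ z)) {z₀ : ℂ} (hz₀ : z₀ ∈ ball (0 : ℂ) 1) :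
    ∃ a : ℂ, a ≠ 0 ∧ ∃ c < (1 : ℝ), ∀ᶠ q : ℂ × ℂ in 𝓝 (z₀, z₀),
      ‖wedge (Φ q.1) (Φ q.2) - a * (q.2 - q.1)‖ ≤ c * ‖a‖ * ‖q.2 - q.1‖ := by
  have hz₀' := ball_subset_closedBall hz₀
  have hnhds : closedBall (0 : ℂ) 1 ∈ 𝓝 z₀ :=
    Filter.mem_of_superset (isOpen_ball.mem_nhds hz₀) ball_subset_closedBall
  obtain ⟨a, ha, c, hc, hac⟩ := exists_wedge_proj_sub_le (hF.contDiffAt hz₀) (hF.det_pos z₀ hz₀)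
    (hFΦ z₀ hz₀')
  set p := Φ z₀
  have hFc : ContinuousAt F z₀ := (hF.contDiffAt hz₀).continuousAt
  have hSc : ContinuousAt (fun z => proj (F z) p) z₀ := by
    have h1 := contDiffAt_proj (hF.contDiffAt hz₀) p
    exact h1.1.continuousAt.prodMk h1.2.continuousAt
  have hdom := hF.mapsTo hz₀'
  have hS0 : proj (F z₀) p ≠ 0 := ((hFΦ z₀ hz₀').proj hdom (ne_neg_self hdom)).ne_zero
  set k : ℂ → ℂ := fun z =>
    herm (proj (F z) p) (Φ z) / herm (proj (F z) p) (proj (F z) p) with hk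
  have hkc : ContinuousAt k z₀ := continuousAt_herm_div hSc (hΦ.continuousAt hnhds) hS0
  have hkS : ∀ᶠ z in 𝓝 z₀, Φ z = k z • proj (F z) p := by
    have h1 : ∀ᶠ z in 𝓝 z₀, F z₀ ≠ -F z := by
      have : ContinuousAt (fun z => F z₀ - -F z) z₀ := continuousAt_const.sub hFc.neg
      filter_upwards [this.eventually_ne (sub_ne_zero.2 (ne_neg_self hdom))] with z hz
      exact sub_ne_zero.1 hz
    filter_upwards [h1, hnhds] with z h2 h3
    have h4 := (hFΦ z₀ hz₀').proj (hF.mapsTo h3) h2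
    exact eq_smul_of_wedge_eq_zero h4.ne_zero (h4.wedge_eq_zero (hFΦ z h3))
  have hk0 : k z₀ ≠ 0 := fun h0 => by
    have h1 := hkS.self_of_nhds
    rw [h0, zero_smul] at h1
    exact (hFΦ z₀ hz₀').ne_zero h1
  have hkk : Filter.Tendsto (fun q : ℂ × ℂ => k q.1 * k q.2) (𝓝 (z₀, z₀)) (𝓝 (k z₀ * k z₀)) := by
    rw [nhds_prod_eq]
    exact (hkc.tendsto.comp Filter.tendsto_fst).mul (hkc.tendsto.comp Filter.tendsto_snd)
  have hkk0 := mul_ne_zero hk0 hk0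
  refine ⟨k z₀ * k z₀ * a, mul_ne_zero hkk0 ha, (c + 1) / 2, by linarith, ?_⟩
  have e : ∀ᶠ q : ℂ × ℂ in 𝓝 (z₀, z₀),
      Φ q.1 = k q.1 • proj (F q.1) p ∧ Φ q.2 = k q.2 • proj (F q.2) p := by
    rw [nhds_prod_eq]
    exact (Filter.tendsto_fst.eventually hkS).and (Filter.tendsto_snd.eventually hkS)
  filter_upwards [hac, eventually_mul_norm_add_lt hkk hkk0 hc, e] with q h1 h2 h3
  rw [h3.1, h3.2, wedge_smul_smul]
  exact norm_mul_sub_le h1 h2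

lemma exists_injOn (hF : IsDistortedDisk F) {z₀ : ℂ} (hz₀ : z₀ ∈ ball (0 : ℂ) 1) :
    ∃ V ∈ 𝓝 z₀, InjOn F V := by
  obtain ⟨Φ, hΦ, hFΦ⟩ := exists_lift hF.continuousOn hF.mapsTo
  obtain ⟨a, ha, c, hc, h⟩ := hF.exists_wedge_sub_le hΦ hFΦ hz₀
  rw [nhds_prod_eq] at h
  obtain ⟨V, hV, h⟩ := Filter.mem_prod_self_iff.1 h
  have hnhds : closedBall (0 : ℂ) 1 ∈ 𝓝 z₀ :=
    Filter.mem_of_superset (isOpen_ball.mem_nhds hz₀) ball_subset_closedBall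
  refine ⟨V ∩ closedBall 0 1, Filter.inter_mem hV hnhds, fun x hx y hy hxy => ?_⟩
  have h1 : ‖wedge (Φ x) (Φ y) - a * (y - x)‖ ≤ c * ‖a‖ * ‖y - x‖ := h (mk_mem_prod hx.1 hy.1)
  rw [((hFΦ x hx.2).wedge_eq_zero_iff (hFΦ y hy.2)).2 hxy, zero_sub, norm_neg, norm_mul] at h1
  by_contra hne
  have := mul_pos (norm_pos_iff.2 ha) (norm_pos_iff.2 (sub_ne_zero.2 (Ne.symm hne)))
  nlinarith

/-- Lebesgue number of a cover of the closed disk by sets of injectivity, which exist at boundary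
points by hypothesis. -/
lemma exists_uniform_injOn (hF : IsDistortedDisk F) :
    ∃ δ > 0, ∀ x ∈ closedBall (0 : ℂ) 1, ∀ y ∈ closedBall (0 : ℂ) 1, dist x y < δ →
      F x = F y → x = y := by
  have h : ∀ z ∈ closedBall (0 : ℂ) 1, ∃ U ∈ 𝓝 z, InjOn F (U ∩ closedBall 0 1) := by
    intro z hz
    rw [← ball_union_sphere] at hz
    refine hz.elim (fun hz => ?_) (hF.locally_injective z)
    obtain ⟨V, hV, h⟩ := hF.exists_injOn hz
    exact ⟨V, hV, h.mono inter_subset_left⟩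
  choose! U hU hUF using h
  obtain ⟨δ, hδ, h⟩ := lebesgue_number_lemma_of_metric (isCompact_closedBall (0 : ℂ) 1)
    (c := fun z : closedBall (0 : ℂ) 1 => interior (U z)) (fun _ => isOpen_interior)
    fun z hz => mem_iUnion.2 ⟨⟨z, hz⟩, mem_interior_iff_mem_nhds.2 (hU z hz)⟩
  refine ⟨δ, hδ, fun x hx y hy hxy he => ?_⟩
  obtain ⟨z, hz⟩ := h x hx
  exact hUF z z.2 ⟨interior_subset (hz (mem_ball_self hδ)), hx⟩
    ⟨interior_subset (hz (mem_ball'.2 hxy)), hy⟩ he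

lemma layers_hasDegree (hF : IsDistortedDisk F) (hΦ : ContinuousOn Φ (closedBall 0 1))
    (hFΦ : ∀ z ∈ closedBall (0 : ℂ) 1, IsLift (F z) (Φ z)) {P : Space} {p : ℂ × ℂ}
    (hp : IsLift P p) (hs : ∀ z ∈ sphere (0 : ℂ) 1, F z ≠ P) :
    (layers F P).Finite ∧ HasDegree (fun θ => wedge p (Φ (Complex.exp (θ * Complex.I))))
      (layers F P).ncard := by
  have h1 : ContinuousOn (fun z => wedge p (Φ z)) (closedBall 0 1) :=
    continuous_wedge.comp_continuousOn (continuousOn_const.prodMk hΦ)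
  have h0 : ∀ z ∈ closedBall (0 : ℂ) 1, wedge p (Φ z) = 0 ↔ F z = P := fun z hz => by
    rw [hp.wedge_eq_zero_iff (hFΦ z hz), eq_comm]
  have h2 : ∀ z ∈ sphere (0 : ℂ) 1, wedge p (Φ z) ≠ 0 := fun z hz h =>
    hs z hz ((h0 z (sphere_subset_closedBall hz)).1 h)
  have h3 : ∀ z ∈ ball (0 : ℂ) 1, wedge p (Φ z) = 0 → IsSimpleZero (fun z => wedge p (Φ z)) z := by
    intro z hz hz0
    obtain ⟨a, ha, c, hc, h⟩ := hF.exists_wedge_sub_le hΦ hFΦ hz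
    have hs : IsSimpleZero (fun u => wedge (Φ z) (Φ u)) z := by
      refine ⟨a, ha, c, hc, ?_⟩
      have ht : Filter.Tendsto (fun u : ℂ => (z, u)) (𝓝 z) (𝓝 (z, z)) :=
        (show Continuous fun u : ℂ => (z, u) by fun_prop).tendsto z
      exact ht.eventually h
    have hp' := (h0 z (ball_subset_closedBall hz)).1 hz0 ▸ hp
    have hΦz := hFΦ z (ball_subset_closedBall hz)
    have h4 := eq_smul_of_wedge_eq_zero hΦz.ne_zero (hΦz.wedge_eq_zero hp')
    set k := herm (Φ z) p / herm (Φ z) (Φ z)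
    have hk : k ≠ 0 := fun hk => hp.ne_zero (by rw [h4, hk, zero_smul])
    refine hs.mul (k := fun _ => k) continuousAt_const hk (.of_forall fun u => ?_)
    rw [h4, ← one_smul ℂ (Φ u), wedge_smul_smul, mul_one, one_smul]
  have h4 : {z | z ∈ ball (0 : ℂ) 1 ∧ wedge p (Φ z) = 0} = layers F P := by
    ext z
    exact and_congr_right fun hz => h0 z (ball_subset_closedBall hz)
  have h5 := hasDegree_ncard_zeros h1 h2 h3
  rw [h4] at h5
  exact ⟨h4 ▸ finite_zeros h1 h2 h3, h5⟩

end IsDistortedDisk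

end Sphere

/-! ### Lifts of closed curves -/

/-- It moves the reparametrization from the curve to the circle, so that all disks bounded by `γ`
have lifts over the same parameter. -/
lemma StrictMono.exists_inverse {φ : ℝ → ℝ} (hφ : Continuous φ) (hm : StrictMono φ)
    (hp : ∀ θ, φ (θ + 2 * π) = φ θ + 2 * π) :
    ∃ ψ : ℝ → ℝ, Continuous ψ ∧ StrictMono ψ ∧ (∀ θ, ψ (θ + 2 * π) = ψ θ + 2 * π) ∧
      ∀ θ, φ (ψ θ) = θ := by
  have hq : Function.Periodic (fun θ => φ θ - θ) (2 * π) := fun θ => by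
    simp only [hp]
    ring
  have hn : ∀ n : ℤ, φ (n * (2 * π)) = φ 0 + n * (2 * π) := fun n => by
    have := hq.int_mul_eq n
    simp only [sub_zero] at this
    linarith
  have hs : Function.Surjective φ := by
    refine hφ.surjective ?_ ?_
    · refine Filter.tendsto_atTop_atTop_of_monotone hm.monotone fun b => ?_
      obtain ⟨n, h⟩ := exists_int_gt ((b - φ 0) / (2 * π))
      refine ⟨n * (2 * π), ?_⟩
      rw [div_lt_iff₀ Real.two_pi_pos] at h
      rw [hn]
      linarith
    · refine Filter.tendsto_atBot_atBot_of_monotone hm.monotone fun b => ?_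
      obtain ⟨n, h⟩ := exists_int_lt ((b - φ 0) / (2 * π))
      refine ⟨n * (2 * π), ?_⟩
      rw [lt_div_iff₀ Real.two_pi_pos] at h
      rw [hn]
      linarith
  set e := StrictMono.orderIsoOfSurjective φ hm hs
  have he : ∀ θ, φ (e.symm θ) = θ := e.apply_symm_apply
  refine ⟨e.symm, e.symm.continuous, e.symm.strictMono, fun θ => hm.injective ?_, he⟩
  rw [he, hp, he]

/-- Factoring out `exp (i ψ θ)`, of degree one, leaves `exp (i s) - 1` with `0 < s < 1 < π`. This
has positive imaginary part, hence degree zero. -/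
lemma HasDegree.exp_sub_exp {ψ : ℝ → ℝ} (hψ : Continuous ψ)
    (hp : ∀ θ, ψ (θ + 2 * π) = ψ θ + 2 * π) {ε : ℝ}
    (h : ∀ θ, ψ (θ + ε) - ψ θ ∈ Ioo 0 1) :
    HasDegree (fun θ => Complex.exp (ψ (θ + ε) * Complex.I) - Complex.exp (ψ θ * Complex.I)) 1 := by
  have h1 := HasDegree.exp_mul_I.comp hψ hp
  have h2 : HasDegree (fun θ => Complex.exp ((ψ (θ + ε) - ψ θ : ℝ) * Complex.I) - 1) 0 := by
    refine HasDegree.of_slitPlane (by fun_prop) (fun θ => ?_) fun θ => Or.inr ?_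
    · rw [hp, add_right_comm, hp]
      congr 4
      ring
    · rw [Complex.sub_im, Complex.exp_ofReal_mul_I_im, Complex.one_im, sub_zero]
      exact (Real.sin_pos_of_pos_of_lt_pi (h θ).1 (by linarith [(h θ).2, Real.pi_gt_three])).ne'
  have h3 := h1.mul h2
  have h4 : ∀ θ, Complex.exp (ψ θ * Complex.I) *
      (Complex.exp ((ψ (θ + ε) - ψ θ : ℝ) * Complex.I) - 1) =
      Complex.exp (ψ (θ + ε) * Complex.I) - Complex.exp (ψ θ * Complex.I) := fun θ => by
    rw [mul_sub, ← Complex.exp_add, mul_one]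
    congr 2
    push_cast
    ring
  simpa only [h4, add_zero] using h3

lemma norm_exp_sub_exp_le (a b : ℝ) :
    ‖Complex.exp (b * Complex.I) - Complex.exp (a * Complex.I)‖ ≤ |b - a| := by
  have h : Complex.exp (b * Complex.I) - Complex.exp (a * Complex.I) =
      Complex.exp (a * Complex.I) * (Complex.exp (Complex.I * (b - a : ℝ)) - 1) := by
    rw [mul_sub, ← Complex.exp_add, mul_one]
    congr 2
    push_cast
    ring
  rw [h, norm_mul, Complex.norm_exp_ofReal_mul_I, one_mul]
  exact Real.norm_exp_I_mul_ofReal_sub_one_le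

lemma eventually_sub_mem_Ioo {ψ : ℝ → ℝ} (hψ : Continuous ψ) (hm : StrictMono ψ)
    (hp : ∀ θ, ψ (θ + 2 * π) = ψ θ + 2 * π) {δ : ℝ} (hδ : 0 < δ) :
    ∀ᶠ ε in 𝓝[>] (0 : ℝ), ∀ θ, ψ (θ + ε) - ψ θ ∈ Ioo 0 δ := by
  have h1 : ∀ᶠ ε in 𝓝 (0 : ℝ), ∀ θ ∈ Icc 0 (2 * π), ψ (θ + ε) - ψ θ < δ := by
    refine isCompact_Icc.eventually_forall_of_forall_eventually fun θ _ => ?_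
    have h2 : Continuous fun q : ℝ × ℝ => ψ (q.2 + q.1) - ψ q.2 := by fun_prop
    refine (h2.tendsto (0, θ)).eventually (gt_mem_nhds ?_)
    simpa using hδ
  filter_upwards [h1.filter_mono nhdsWithin_le_nhds, self_mem_nhdsWithin] with ε h2 hε θ
  refine ⟨sub_pos.2 (hm (lt_add_of_pos_right θ hε)), ?_⟩
  refine forall_of_forall_mem_Icc (p := fun θ => ψ (θ + ε) - ψ θ < δ) (fun θ => ?_) h2 θ
  rw [hp, add_right_comm, hp, add_sub_add_right_eq_sub]

namespace Sphere

/-- `Γ` is a closed lift to `ℂ²` of the closed curve `γ` in the sphere. -/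
structure IsCurveLift (γ : ℝ → Space) (Γ : ℝ → ℂ × ℂ) : Prop where
  continuous : Continuous Γ
  periodic : ∀ θ, Γ (θ + 2 * π) = Γ θ
  isLift : ∀ θ, IsLift (γ θ) (Γ θ)

lemma _root_.Continuous.sphereWedge {X : Type*} [TopologicalSpace X] {f g : X → ℂ × ℂ}
    (hf : Continuous f) (hg : Continuous g) : Continuous fun x => wedge (f x) (g x) := by
  unfold wedge
  fun_prop

/-- The homotopy is `wedge (Φ (t x)) (Φ (t y))` for `r ≤ t ≤ 1`. It has no zero because `t x` and `t
y` are distinct and closer than the scale of injectivity. At the small radius `r` it is dominated by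
`a * r * (y - x)`, of degree one. -/
lemma hasDegree_wedge_rotate {F : ℂ → Space} {Φ : ℂ → ℂ × ℂ} (hF : IsDistortedDisk F)
    (hΦ : ContinuousOn Φ (closedBall 0 1)) (hFΦ : ∀ z ∈ closedBall (0 : ℂ) 1, IsLift (F z) (Φ z))
    {ψ : ℝ → ℝ} (hψ : Continuous ψ) (hm : StrictMono ψ)
    (hp : ∀ θ, ψ (θ + 2 * π) = ψ θ + 2 * π) :
    ∀ᶠ ε in 𝓝[>] (0 : ℝ), HasDegree (fun θ => wedge (Φ (Complex.exp (ψ θ * Complex.I)))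
      (Φ (Complex.exp (ψ (θ + ε) * Complex.I)))) 1 := by
  obtain ⟨δ, hδ, hinj⟩ := hF.exists_uniform_injOn
  obtain ⟨a, ha, c, hc, hac⟩ := hF.exists_wedge_sub_le hΦ hFΦ (mem_ball_self one_pos)
  obtain ⟨r₀, hr₀, hball⟩ := Metric.mem_nhds_iff.1 hac
  replace hball : ∀ q ∈ ball ((0 : ℂ), (0 : ℂ)) r₀,
      ‖wedge (Φ q.1) (Φ q.2) - a * (q.2 - q.1)‖ ≤ c * ‖a‖ * ‖q.2 - q.1‖ := fun q hq => hball hq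
  set r := min (r₀ / 2) 1
  have hr0 : 0 < r := lt_min (half_pos hr₀) one_pos
  have hr1 : r ≤ 1 := min_le_right _ _
  have hrr : r < r₀ := (min_le_left _ _).trans_lt (half_lt_self hr₀)
  filter_upwards [eventually_sub_mem_Ioo hψ hm hp (lt_min hδ one_pos)] with ε hε
  set x : ℝ → ℂ := fun θ => Complex.exp (ψ θ * Complex.I)
  set y : ℝ → ℂ := fun θ => Complex.exp (ψ (θ + ε) * Complex.I)
  have hxc : Continuous x := by fun_prop
  have hyc : Continuous y := by fun_prop
  have hxp : ∀ θ, x (θ + 2 * π) = x θ := fun θ => (HasDegree.exp_mul_I.comp hψ hp).periodic θ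
  have hyp : ∀ θ, y (θ + 2 * π) = y θ := fun θ => by
    have := hxp (θ + ε)
    rwa [add_right_comm] at this
  have hx1 : ∀ θ, ‖x θ‖ = 1 := fun θ => Complex.norm_exp_ofReal_mul_I _
  have hy1 : ∀ θ, ‖y θ‖ = 1 := fun θ => Complex.norm_exp_ofReal_mul_I _
  have hdeg : HasDegree (fun θ => y θ - x θ) 1 :=
    .exp_sub_exp hψ hp fun θ => ⟨(hε θ).1, (hε θ).2.trans_le (min_le_right _ _)⟩
  have hxy : ∀ θ, y θ - x θ ≠ 0 := hdeg.ne_zero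
  have hdist : ∀ θ, dist (x θ) (y θ) < δ := fun θ => by
    rw [dist_comm, dist_eq_norm]
    refine (norm_exp_sub_exp_le _ _).trans_lt ?_
    rw [abs_of_pos (hε θ).1]
    exact (hε θ).2.trans_le (min_le_left _ _)
  have hmem : ∀ t ∈ Icc r 1, ∀ z : ℂ, ‖z‖ = 1 → (t : ℂ) * z ∈ closedBall (0 : ℂ) 1 := by
    intro t ht z hz
    rw [mem_closedBall_zero_iff, norm_mul, hz, mul_one, Complex.norm_real,
      Real.norm_of_nonneg (hr0.le.trans ht.1)]
    exact ht.2
  have hmemx := fun t ht θ => hmem t ht (x θ) (hx1 θ)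
  have hmemy := fun t ht θ => hmem t ht (y θ) (hy1 θ)
  have hH : ContinuousOn (Function.uncurry fun (t : ℝ) (θ : ℝ) =>
      wedge (Φ (t * x θ)) (Φ (t * y θ))) (Icc r 1 ×ˢ univ) := by
    have h1 : ContinuousOn (fun q : ℝ × ℝ => Φ (q.1 * x q.2)) (Icc r 1 ×ˢ univ) :=
      hΦ.comp (by fun_prop) fun q hq => hmemx _ hq.1 _
    have h2 : ContinuousOn (fun q : ℝ × ℝ => Φ (q.1 * y q.2)) (Icc r 1 ×ˢ univ) :=
      hΦ.comp (by fun_prop) fun q hq => hmemy _ hq.1 _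
    exact continuous_wedge.comp_continuousOn (h1.prodMk h2)
  have key := HasDegree.of_homotopy hr1 hH (n := 1) (fun t _ θ => by rw [hxp, hyp])
    (fun t ht θ h0 => ?_) ?_
  · simpa using key
  · have ht0 : (t : ℂ) ≠ 0 := Complex.ofReal_ne_zero.2 (hr0.trans_le ht.1).ne'
    have h1 := ((hFΦ _ (hmemx t ht θ)).wedge_eq_zero_iff (hFΦ _ (hmemy t ht θ))).1 h0
    have h2 := hinj _ (hmemx t ht θ) _ (hmemy t ht θ) ?_ h1
    · exact hxy θ (by rw [mul_left_cancel₀ ht0 h2, sub_self])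
    · rw [dist_eq_norm, ← mul_sub, norm_mul, Complex.norm_real,
        Real.norm_of_nonneg (hr0.le.trans ht.1), ← dist_eq_norm]
      exact (mul_le_of_le_one_left dist_nonneg ht.2).trans_lt (hdist θ)
  · have hr0' : (r : ℂ) ≠ 0 := Complex.ofReal_ne_zero.2 hr0.ne'
    have h1 := (HasDegree.const (mul_ne_zero ha hr0')).mul hdeg
    rw [zero_add] at h1
    have hrm : r ∈ Icc r 1 := left_mem_Icc.2 hr1
    refine h1.of_norm_sub_lt ?_ (fun θ => by rw [hxp, hyp]) fun θ => ?_
    · exact (hΦ.comp_continuous (by fun_prop) (hmemx r hrm)).sphereWedge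
        (hΦ.comp_continuous (by fun_prop) (hmemy r hrm))
    · have h2 : ((r : ℂ) * x θ, (r : ℂ) * y θ) ∈ ball ((0 : ℂ), (0 : ℂ)) r₀ := by
        rw [← ball_prod_same]
        refine mk_mem_prod ?_ ?_
        · rwa [mem_ball_zero_iff, norm_mul, hx1, mul_one, Complex.norm_real,
            Real.norm_of_nonneg hr0.le]
        · rwa [mem_ball_zero_iff, norm_mul, hy1, mul_one, Complex.norm_real,
            Real.norm_of_nonneg hr0.le]
      have h3 := hball _ h2
      dsimp only at h3
      rw [← mul_sub, ← mul_assoc, mul_assoc c, ← norm_mul, ← mul_assoc] at h3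
      have h4 : 0 < ‖a * r * (y θ - x θ)‖ :=
        norm_pos_iff.2 (mul_ne_zero (mul_ne_zero ha hr0') (hxy θ))
      exact h3.trans_lt (mul_lt_of_lt_one_left h4 hc)

/-- The boundary values of a lift of a distorted disk, parametrized by `γ`, compute the number of
layers; and they have degree one in the sense that nearby boundary points turn once around each
other. -/
lemma IsDistortedDisk.exists_curveLift {F : ℂ → Space} {γ : ℝ → Space} (hF : IsDistortedDisk F)
    (hγF : Bounds γ F) : ∃ Γ, IsCurveLift γ Γ ∧
      (∀ P ∉ range γ, ∀ p, IsLift P p → (layers F P).Finite ∧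
        HasDegree (fun θ => wedge p (Γ θ)) (layers F P).ncard) ∧
      ∀ᶠ ε in 𝓝[>] (0 : ℝ), HasDegree (fun θ => wedge (Γ θ) (Γ (θ + ε))) 1 := by
  obtain ⟨Φ, hΦ, hFΦ⟩ := exists_lift hF.continuousOn hF.mapsTo
  have hγF' := hγF
  obtain ⟨φ, hφ, hφm, hφp, h⟩ := hγF'
  obtain ⟨ψ, hψ, hψm, hψp, hφψ⟩ := StrictMono.exists_inverse hφ hφm hφp
  have hmem : ∀ θ, Complex.exp (ψ θ * Complex.I) ∈ closedBall (0 : ℂ) 1 := fun θ =>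
    sphere_subset_closedBall (exp_mul_I_mem_sphere _)
  refine ⟨fun θ => Φ (Complex.exp (ψ θ * Complex.I)), ⟨?_, fun θ => ?_, fun θ => ?_⟩,
    fun P hP p hp => ?_, hasDegree_wedge_rotate hF hΦ hFΦ hψ hψm hψp⟩
  · exact continuousOn_univ.1 (hΦ.comp (by fun_prop) fun θ _ => hmem θ)
  · rw [(HasDegree.exp_mul_I.comp hψ hψp).periodic θ]
  · have := hFΦ _ (hmem θ)
    rwa [h, hφψ] at this
  · obtain ⟨h1, h2⟩ := hF.layers_hasDegree hΦ hFΦ hp fun z => hγF.notMem_image_sphere hP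
    exact ⟨h1, h2.comp hψ hψp⟩

/-! ### Comparison of closed lifts of one curve -/

namespace IsCurveLift

variable {γ : ℝ → Space} {Γ Γ₁ Γ₂ : ℝ → ℂ × ℂ}

lemma exists_smul_eq (h₁ : IsCurveLift γ Γ₁) (h₂ : IsCurveLift γ Γ₂) :
    ∃ (k : ℝ → ℂ) (n : ℤ), HasDegree k n ∧ ∀ θ, Γ₂ θ = k θ • Γ₁ θ := by
  set k : ℝ → ℂ := fun θ => herm (Γ₁ θ) (Γ₂ θ) / herm (Γ₁ θ) (Γ₁ θ) with hk
  have h : ∀ θ, Γ₂ θ = k θ • Γ₁ θ := fun θ => eq_smul_of_wedge_eq_zero (h₁.isLift θ).ne_zero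
    ((h₁.isLift θ).wedge_eq_zero (h₂.isLift θ))
  have hc : Continuous k := continuous_iff_continuousAt.2 fun θ => continuousAt_herm_div
    h₁.continuous.continuousAt h₂.continuous.continuousAt (h₁.isLift θ).ne_zero
  obtain ⟨n, hn⟩ := HasDegree.exists_of_continuous hc
    (fun θ => by simp only [hk, h₁.periodic, h₂.periodic]) fun θ h0 =>
      (h₂.isLift θ).ne_zero (by rw [h, h0, zero_smul])
  exact ⟨k, n, hn, h⟩

/-- If `Γ₂ = k • Γ₁` with `k` of degree `d`, the rotated wedge gains `k θ * k (θ + ε)`, of degree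
`2d`. As both degrees are one, `d = 0`. -/
lemma hasDegree_eq (h₁ : IsCurveLift γ Γ₁) (h₂ : IsCurveLift γ Γ₂)
    (hd₁ : ∀ᶠ ε in 𝓝[>] (0 : ℝ), HasDegree (fun θ => wedge (Γ₁ θ) (Γ₁ (θ + ε))) 1)
    (hd₂ : ∀ᶠ ε in 𝓝[>] (0 : ℝ), HasDegree (fun θ => wedge (Γ₂ θ) (Γ₂ (θ + ε))) 1)
    {p : ℂ × ℂ} {m n : ℤ} (hm : HasDegree (fun θ => wedge p (Γ₁ θ)) m)
    (hn : HasDegree (fun θ => wedge p (Γ₂ θ)) n) : m = n := by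
  obtain ⟨k, d, hk, hkΓ⟩ := h₁.exists_smul_eq h₂
  obtain ⟨ε, h3, h4⟩ := (hd₁.and hd₂).exists
  have h5 : HasDegree (fun θ => k (θ + ε)) d :=
    hk.comp (φ := fun θ => θ + ε) (by fun_prop) fun θ => by ring
  have h6 := (hk.mul h5).mul h3
  simp only [← wedge_smul_smul, ← hkΓ] at h6
  have h7 : d = 0 := by
    have := h6.unique h4
    omega
  have h8 := hk.mul hm
  have h9 : ∀ θ, k θ * wedge p (Γ₁ θ) = wedge p (Γ₂ θ) := fun θ => by
    rw [hkΓ θ]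
    nth_rewrite 2 [← one_smul ℂ p]
    rw [wedge_smul_smul, one_mul]
  simp only [h9, h7, zero_add] at h8
  exact h8.unique hn

lemma exists_hasDegree (hΓ : IsCurveLift γ Γ) {P : Space} (hP : P ∈ domain \ range γ) :
    ∃ n : ℤ, ∀ p, IsLift P p → HasDegree (fun θ => wedge p (Γ θ)) n := by
  obtain ⟨q, hq⟩ := exists_isLift hP.1
  have h0 : ∀ θ, wedge q (Γ θ) ≠ 0 := fun θ h => hP.2
    ⟨θ, ((hq.wedge_eq_zero_iff (hΓ.isLift θ)).1 h).symm⟩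
  obtain ⟨n, hn⟩ := HasDegree.exists_of_continuous (continuous_const.sphereWedge hΓ.continuous)
    (fun θ => by rw [hΓ.periodic]) h0
  refine ⟨n, fun p hp => ?_⟩
  have h1 := eq_smul_of_wedge_eq_zero hq.ne_zero (hq.wedge_eq_zero hp)
  set k := herm q p / herm q q
  have hk : k ≠ 0 := fun hk => hp.ne_zero (by rw [h1, hk, zero_smul])
  have h2 := (HasDegree.const hk).mul hn
  have h3 : ∀ θ, k * wedge q (Γ θ) = wedge p (Γ θ) := fun θ => by
    rw [h1]
    nth_rewrite 2 [← one_smul ℂ (Γ θ)]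
    rw [wedge_smul_smul, mul_one]
  simpa only [h3, zero_add] using h2

/-- The degrees are constant on the components of the complement of the curve. -/
lemma exists_component_degree (hΓ : IsCurveLift γ Γ) : ∃ ν : Set Space → ℤ,
    ∀ Ω ∈ complementComponents domain (range γ), ∀ P ∈ Ω, ∀ p, IsLift P p →
      HasDegree (fun θ => wedge p (Γ θ)) (ν Ω) := by
  choose! d hd using fun P (hP : P ∈ domain \ range γ) => hΓ.exists_hasDegree hP
  obtain ⟨ν, hν⟩ := exists_eq_of_locally_const (X := domain) (K := range γ) d fun P hP => by
    obtain ⟨p, hp⟩ := exists_isLift hP.1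
    have hne := ne_neg_self hP.1
    -- `proj Q p` is a lift of `Q` depending continuously on `Q` near `P`, so the degree is stable
    -- there.
    have h1 := hd P hP _ (hp.proj hP.1 hne)
    have h2 : ∀ᶠ Q in 𝓝 P, HasDegree (fun θ => wedge (proj Q p) (Γ θ)) (d P) := by
      have hc : Continuous fun Q => proj Q p := by
        unfold proj
        fun_prop
      have hc2 : Continuous fun q : Space × ℝ => wedge (proj q.1 p) (Γ q.2) :=
        (hc.comp continuous_fst).sphereWedge (hΓ.continuous.comp continuous_snd)
      refine h1.eventually (.of_forall fun Q => continuous_const.sphereWedge hΓ.continuous)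
        (.of_forall fun Q θ => by rw [hΓ.periodic]) fun θ => ?_
      have := hc2.tendsto (P, θ)
      rwa [nhds_prod_eq] at this
    have h3 : ∀ᶠ Q in 𝓝 P, P ≠ -Q := by
      have : ContinuousAt (fun Q => P - -Q) P := by fun_prop
      filter_upwards [this.eventually_ne (sub_ne_zero.2 hne)] with z hz
      exact sub_ne_zero.1 hz
    filter_upwards [h2.filter_mono nhdsWithin_le_nhds, h3.filter_mono nhdsWithin_le_nhds,
      self_mem_nhdsWithin] with Q h4 h5 hQ
    exact (hd Q hQ _ (hp.proj hQ.1 h5)).unique h4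
  exact ⟨ν, fun Ω hΩ P hP p hp => hν Ω hΩ P hP ▸
    hd P (subset_of_mem_complementComponents hΩ hP) p hp⟩

end IsCurveLift

end Sphere

/-! ### The area of the sphere -/

namespace Sphere

/-- The determinant of three vectors of space. -/
def det₃ (u v w : Space) : ℝ := (Matrix.of fun i j : Fin 3 => (![u, v, w] i) j).det

lemma det₃_eq (u v w : Space) : det₃ u v w = u 0 * v 1 * w 2 - u 0 * v 2 * w 1 - u 1 * v 0 * w 2 +
    u 1 * v 2 * w 0 + u 2 * v 0 * w 1 - u 2 * v 1 * w 0 := by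
  rw [det₃, Matrix.det_fin_three]
  simp

/-- The area measure of the sphere, as a measure on the ambient space. -/
def areaMeasure : Measure Space := (volume : Measure Space).toSphere.map Subtype.val

lemma measurableEmbedding_coe : MeasurableEmbedding (Subtype.val : sphere (0 : Space) 1 → Space) :=
  MeasurableEmbedding.subtype_coe isClosed_sphere.measurableSet

lemma areaMeasure_apply (Ω : Set Space) : areaMeasure Ω = setArea Ω :=
  measurableEmbedding_coe.map_apply _ _

lemma areaMeasure_eq {Ω : Set Space} (hm : MeasurableSet Ω) (hΩ : Ω ⊆ domain) :
    areaMeasure Ω = 3 * volume ((fun q : ℝ × Space => q.1 • q.2) '' (Ioo 0 1 ×ˢ Ω)) := by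
  have h : sphere (0 : Space) 1 ∩ Ω = Ω := inter_eq_right.2 hΩ
  rw [areaMeasure_apply, setArea, Measure.toSphere_apply' _ (measurable_subtype_coe hm),
    finrank_euclideanSpace_fin, image_prod, Subtype.image_preimage_coe, h]
  rfl

/-- Space as the product of a line and a plane. -/
def splitEquiv : Space ≃ᵐ ℝ × ℂ :=
  (MeasurableEquiv.toLp 2 (Fin 3 → ℝ)).symm.trans
    ((MeasurableEquiv.piFinSuccAbove (fun _ => ℝ) 2).trans
      ((MeasurableEquiv.refl ℝ).prodCongr Complex.measurableEquivPi.symm))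

lemma measurePreserving_splitEquiv : MeasurePreserving splitEquiv := by
  have h1 := PiLp.volume_preserving_ofLp (Fin 3)
  have h2 := volume_preserving_piFinSuccAbove (fun _ : Fin 3 => ℝ) 2
  have h3 := (MeasurePreserving.id (volume : Measure ℝ)).prod
    (Complex.volume_preserving_equiv_pi.symm Complex.measurableEquivPi)
  exact h3.comp (h2.comp h1)

lemma splitEquiv_apply (x : Space) : splitEquiv x = (x 2, x 0 + x 1 * Complex.I) := by
  refine Prod.ext rfl ?_
  change Complex.measurableEquivPi.symm (Fin.removeNth 2 x.ofLp) = _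
  rw [Complex.measurableEquivPi_symm_apply]
  rfl

/-- The projection of space to its first two coordinates. -/
def planeProj : Space →L[ℝ] ℂ :=
  LinearMap.toContinuousLinearMap
    { toFun := fun v => v 0 + v 1 * Complex.I
      map_add' := fun u v => by simp; ring
      map_smul' := fun c v => by simp; ring }

lemma planeProj_apply (v : Space) : planeProj v = v 0 + v 1 * Complex.I := rfl

/-- The linear map is the derivative at `x` of the cone map `x ↦ x₂ • F (x₀ + i x₁)`. -/
lemma det_cone (F : ℂ → Space) (F' : ℂ →L[ℝ] Space) (x : Space) :
    (x 2 • F'.comp planeProj + (EuclideanSpace.proj 2 : Space →L[ℝ] ℝ).smulRight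
      (F (planeProj x))).det = x 2 ^ 2 * det₃ (F (planeProj x)) (F' 1) (F' Complex.I) := by
  rw [ContinuousLinearMap.det,
    ← LinearMap.det_toMatrix (EuclideanSpace.basisFun (Fin 3) ℝ).toBasis, Matrix.det_fin_three,
    det₃_eq]
  simp [LinearMap.toMatrix_apply, planeProj_apply]
  ring

lemma lintegral_sq : ∫⁻ t in Ioo (0 : ℝ) 1, ENNReal.ofReal (t ^ 2) = 3⁻¹ := by
  rw [← ofReal_integral_eq_lintegral_ofReal, ← integral_Ioc_eq_integral_Ioo,
    ← intervalIntegral.integral_of_le zero_le_one, integral_pow]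
  · norm_num
    rw [one_div, ENNReal.ofReal_inv_of_pos (by norm_num)]
    simp
  · exact ((continuous_pow 2).integrableOn_Icc (a := 0) (b := 1)).mono_set Ioo_subset_Icc_self
  · exact .of_forall fun t => sq_nonneg t

/-- The area of the image of an injective map to the sphere. -/
theorem areaMeasure_image {F : ℂ → Space} {U A : Set ℂ} (hU : IsOpen U) (hF : ContDiffOn ℝ 1 F U)
    (hAU : A ⊆ U) (hA : MeasurableSet A) (hAF : InjOn F A) (hFd : MapsTo F A domain) :
    areaMeasure (F '' A) =
      ∫⁻ z in A, ENNReal.ofReal |det₃ (F z) (fderiv ℝ F z 1) (fderiv ℝ F z Complex.I)| := by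
  have hd : ∀ z ∈ A, HasFDerivAt F (fderiv ℝ F z) z := fun z hz =>
    ((hF.contDiffAt (hU.mem_nhds (hAU hz))).differentiableAt one_ne_zero).hasFDerivAt
  set J : ℂ → ℝ := fun z => det₃ (F z) (fderiv ℝ F z 1) (fderiv ℝ F z Complex.I) with hJ
  have hJc : ContinuousOn J U := by
    have h1 := hF.continuousOn_fderiv_of_isOpen hU le_rfl
    have h2 := h1.clm_apply (continuousOn_const (c := (1 : ℂ)))
    have h3 := h1.clm_apply (continuousOn_const (c := Complex.I))
    have h4 := hF.continuousOn
    simp only [hJ, det₃_eq]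
    fun_prop
  set T : Space → Space := fun x => x 2 • F (planeProj x) with hT
  set B : Set Space := splitEquiv ⁻¹' (Ioo 0 1 ×ˢ A) with hB
  have hBm : MeasurableSet B := splitEquiv.measurable (measurableSet_Ioo.prod hA)
  have hmemB : ∀ x, x ∈ B ↔ x 2 ∈ Ioo (0 : ℝ) 1 ∧ planeProj x ∈ A := fun x => by
    rw [hB, mem_preimage, splitEquiv_apply, mem_prod, planeProj_apply]
  have himage : (fun q : ℝ × Space => q.1 • q.2) '' (Ioo 0 1 ×ˢ (F '' A)) = T '' B := by
    ext v
    constructor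
    · rintro ⟨⟨t, _⟩, ⟨ht, z, hz, rfl⟩, rfl⟩
      have h1 := splitEquiv.apply_symm_apply (t, z)
      rw [splitEquiv_apply, Prod.mk.injEq, ← planeProj_apply] at h1
      refine ⟨splitEquiv.symm (t, z), (hmemB _).2 ?_, ?_⟩
      · rw [h1.1, h1.2]
        exact ⟨ht, hz⟩
      · simp only [hT]
        rw [h1.1, h1.2]
    · rintro ⟨x, hx, rfl⟩
      rw [hmemB] at hx
      exact ⟨(x 2, F (planeProj x)), ⟨hx.1, mem_image_of_mem F hx.2⟩, rfl⟩
  have hinj : InjOn T B := by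
    intro x hx y hy hxy
    rw [hmemB] at hx hy
    have h1 : x 2 = y 2 := by
      have := congrArg norm hxy
      simp only [hT, norm_smul] at this
      rwa [mem_sphere_zero_iff_norm.1 (hFd hx.2), mem_sphere_zero_iff_norm.1 (hFd hy.2),
        Real.norm_of_nonneg hx.1.1.le, Real.norm_of_nonneg hy.1.1.le, mul_one, mul_one] at this
    have h2 : F (planeProj x) = F (planeProj y) := by
      simp only [hT, h1] at hxy
      exact smul_right_injective _ hy.1.1.ne' hxy
    refine splitEquiv.injective ?_
    rw [splitEquiv_apply, splitEquiv_apply, ← planeProj_apply, ← planeProj_apply, h1,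
      hAF hx.2 hy.2 h2]
  have hTd : ∀ x ∈ B, HasFDerivWithinAt T (x 2 • (fderiv ℝ F (planeProj x)).comp planeProj +
      (EuclideanSpace.proj 2 : Space →L[ℝ] ℝ).smulRight (F (planeProj x))) B x := by
    intro x hx
    rw [hmemB] at hx
    have h1 : HasFDerivAt (fun x : Space => x 2) (EuclideanSpace.proj 2 : Space →L[ℝ] ℝ) x :=
      (EuclideanSpace.proj 2 : Space →L[ℝ] ℝ).hasFDerivAt
    have h2 := (hd _ hx.2).comp x planeProj.hasFDerivAt
    exact (h1.smul h2).hasFDerivWithinAt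
  rw [areaMeasure_eq (hA.image_of_continuousOn_injOn (hF.continuousOn.mono hAU) hAF)
    hFd.image_subset, himage, ← lintegral_abs_det_fderiv_eq_addHaar_image volume hBm hTd hinj]
  have h1 : ∫⁻ x in B, ENNReal.ofReal |(x 2 • (fderiv ℝ F (planeProj x)).comp planeProj +
      (EuclideanSpace.proj 2 : Space →L[ℝ] ℝ).smulRight (F (planeProj x))).det| =
      ∫⁻ x in B, (fun q : ℝ × ℂ => ENNReal.ofReal (q.1 ^ 2) * ENNReal.ofReal |J q.2|)
        (splitEquiv x) := by
    refine setLIntegral_congr_fun hBm fun x _ => ?_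
    simp only [det_cone, splitEquiv_apply, ← planeProj_apply, hJ]
    rw [abs_mul, abs_of_nonneg (sq_nonneg _), ENNReal.ofReal_mul (sq_nonneg _)]
  have h2 := measurePreserving_splitEquiv.setLIntegral_comp_preimage_emb
    splitEquiv.measurableEmbedding
    (fun q : ℝ × ℂ => ENNReal.ofReal (q.1 ^ 2) * ENNReal.ofReal |J q.2|) (Ioo 0 1 ×ˢ A)
  -- The integral splits, and the radial factor `∫ t² = 1/3` cancels the `3` relating spherical area
  -- to the volume of the cone.
  rw [h1, hB, h2, Measure.volume_eq_prod, ← Measure.prod_restrict,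
    lintegral_prod_mul (f := fun t : ℝ => ENNReal.ofReal (t ^ 2))
      (g := fun z => ENNReal.ofReal |J z|) (by fun_prop) ?_, lintegral_sq, ← mul_assoc,
    ENNReal.mul_inv_cancel (by norm_num) (by norm_num), one_mul]
  exact ((hJc.mono hAU).abs.aemeasurable hA).ennreal_ofReal

lemma areaMeasure_range {γ : ℝ → Space} (hγ : IsClosedCurve γ) (hγd : range γ ⊆ domain) :
    areaMeasure (range γ) = 0 := by
  rw [areaMeasure_eq hγ.isCompact_range.isClosed.measurableSet hγd]
  obtain ⟨n, a, b, h1, h2⟩ := hγ.exists_range_eq_iUnion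
  refine mul_eq_zero_of_right _ (measure_mono_null (image_mono (prod_mono_right h1)) ?_)
  rw [prod_iUnion₂, image_iUnion₂]
  refine (measure_biUnion_null_iff (Finset.countable_toSet _)).2 fun i hi => ?_
  have h3 : ContDiffOn ℝ 1 (fun q : ℝ × ℝ => q.1 • γ q.2) (Ioo 0 1 ×ˢ Icc (a i) (b i)) :=
    contDiff_fst.contDiffOn.smul ((h2 i hi).comp contDiff_snd.contDiffOn fun q hq => hq.2)
  refine measure_mono_null ?_ (addHaar_image_eq_zero_of_finrank_lt volume h3
    ((convex_Ioo _ _).prod (convex_Icc _ _)) (by simp))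
  rintro _ ⟨⟨t, _⟩, ⟨ht, θ, hθ, rfl⟩, rfl⟩
  exact ⟨(t, θ), ⟨ht, hθ⟩, rfl⟩

lemma areaMeasure_domain : areaMeasure domain = areaMeasure univ := by
  rw [areaMeasure_apply, areaMeasure_apply, setArea, setArea, preimage_univ]
  congr 1
  exact eq_univ_of_forall fun x => x.2

lemma areaMeasure_univ_ne_zero : areaMeasure univ ≠ 0 := by
  rw [areaMeasure_apply, setArea, preimage_univ, Measure.measure_univ_ne_zero]
  exact Measure.toSphere_ne_zero _

instance : IsFiniteMeasure areaMeasure := by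
  unfold areaMeasure
  infer_instance

lemma inner_eq (u v : Space) : inner ℝ u v = u 0 * v 0 + u 1 * v 1 + u 2 * v 2 := by
  rw [PiLp.inner_apply, Fin.sum_univ_three]
  simp [mul_comm]

lemma IsDistortedDisk.inner_fderiv {F : ℂ → Space} (hF : IsDistortedDisk F) {z : ℂ}
    (hz : z ∈ ball (0 : ℂ) 1) (u : ℂ) : inner ℝ (F z) (fderiv ℝ F z u) = 0 := by
  have h1 := ((hF.contDiffAt hz).differentiableAt one_ne_zero).hasFDerivAt.norm_sq
  have h2 : HasFDerivAt (fun z => ‖F z‖ ^ 2) (0 : ℂ →L[ℝ] ℝ) z := by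
    refine (hasFDerivAt_const (1 : ℝ) z).congr_of_eventuallyEq ?_
    filter_upwards [isOpen_ball.mem_nhds hz] with x hx
    rw [mem_sphere_zero_iff_norm.1 (hF.mapsTo (ball_subset_closedBall hx)), one_pow]
  have h3 := congrArg (fun L : ℂ →L[ℝ] ℝ => L u) (h1.unique h2)
  simpa using h3

lemma IsDistortedDisk.area_eq {F : ℂ → Space} (hF : IsDistortedDisk F) :
    area F = ∫⁻ P, Measure.count (ball (0 : ℂ) 1 ∩ F ⁻¹' {P}) ∂areaMeasure := by
  refine lintegral_eq_lintegral_count isOpen_ball (hF.continuousOn.mono ball_subset_closedBall)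
    (fun z hz => hF.exists_injOn hz) fun A hA hAm hAF => ?_
  rw [areaMeasure_image isOpen_ball hF.contDiffOn hA hAm hAF
    fun z hz => hF.mapsTo (ball_subset_closedBall (hA hz))]
  refine setLIntegral_congr_fun hAm fun z hz => ?_
  have h1 := hF.inner_fderiv (hA hz) 1
  have h2 := hF.inner_fderiv (hA hz) Complex.I
  have h3 := sum_sq_eq_one (hF.mapsTo (ball_subset_closedBall (hA hz)))
  rw [← Real.sqrt_sq_eq_abs, det₃_eq]
  congr 2
  simp only [pullbackMetric, one_mul]
  rw [inner_eq] at h1 h2 ⊢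
  rw [inner_eq, inner_eq, inner_eq]
  set v := F z
  set a := fderiv ℝ F z 1
  set b := fderiv ℝ F z Complex.I
  -- The square of the determinant is the Gram determinant of `v, a, b`. Expanded along its first
  -- row, it reduces to that of `a, b`, as `v` is a unit vector orthogonal to both.
  linear_combination
    ((a 0 ^ 2 + a 1 ^ 2 + a 2 ^ 2) * (b 0 ^ 2 + b 1 ^ 2 + b 2 ^ 2) -
      (a 0 * b 0 + a 1 * b 1 + a 2 * b 2) ^ 2) * h3 -
    ((v 0 * a 0 + v 1 * a 1 + v 2 * a 2) * (b 0 ^ 2 + b 1 ^ 2 + b 2 ^ 2) -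
      (a 0 * b 0 + a 1 * b 1 + a 2 * b 2) * (v 0 * b 0 + v 1 * b 1 + v 2 * b 2)) * h1 +
    ((v 0 * a 0 + v 1 * a 1 + v 2 * a 2) * (a 0 * b 0 + a 1 * b 1 + a 2 * b 2) -
      (a 0 ^ 2 + a 1 ^ 2 + a 2 ^ 2) * (v 0 * b 0 + v 1 * b 1 + v 2 * b 2)) * h2

end Sphere

namespace Sphere

/-! ### Rotations -/

lemma det₃_map (R : Space →ₗ[ℝ] Space) (u v w : Space) :
    det₃ (R u) (R v) (R w) = LinearMap.det R * det₃ u v w := by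
  set b := (EuclideanSpace.basisFun (Fin 3) ℝ).toBasis
  have h : ∀ x : Space, ∀ j, R x j = ∑ k, x k * (LinearMap.toMatrix b b R) j k := by
    intro x j
    have h1 := congrFun (LinearMap.toMatrix_mulVec_repr b b R x) j
    simp only [Matrix.mulVec, dotProduct] at h1
    have h2 : b.repr (R x) j = R x j := by simp [b]
    rw [← h2, ← h1]
    exact Finset.sum_congr rfl fun k _ => by simp [b, mul_comm]
  rw [← LinearMap.det_toMatrix b, det₃_eq, det₃_eq, Matrix.det_fin_three]
  simp only [h, Fin.sum_univ_three]
  ring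

lemma det_reflection_span {m : Space} (hm : m ≠ 0) :
    LinearMap.det (ℝ ∙ m).reflection.toLinearMap = 1 := by
  have : Fact (Module.finrank ℝ Space = 2 + 1) := ⟨by simp⟩
  rw [Submodule.det_reflection, Submodule.finrank_orthogonal_span_singleton (n := 2) hm]
  norm_num

lemma exists_rotation {P : Space} (hP : P ∈ domain) : ∃ R : Space ≃ₗᵢ[ℝ] Space, R P = infinity ∧
    ∀ u v w, det₃ (R u) (R v) (R w) = det₃ u v w := by
  suffices h : ∃ m : Space, m ≠ 0 ∧ (ℝ ∙ m).reflection P = infinity by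
    obtain ⟨m, hm, h⟩ := h
    refine ⟨(ℝ ∙ m).reflection, h, fun u v w => ?_⟩
    have := det₃_map (ℝ ∙ m).reflection.toLinearMap u v w
    rwa [det_reflection_span hm, one_mul] at this
  -- The rotation is the half turn about the bisector of `P` and infinity, or about a perpendicular
  -- axis if they are antipodal.
  by_cases h : P + infinity = 0
  · refine ⟨!₂[1, 0, 0], fun h0 => ?_, ?_⟩
    · have := congrArg (fun v : Space => v 0) h0
      simp at this
    · rw [Submodule.reflection_mem_subspace_orthogonalComplement_eq_neg]
      · exact (eq_neg_of_add_eq_zero_right h).symm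
      · rw [Submodule.mem_orthogonal_singleton_iff_inner_right, eq_neg_of_add_eq_zero_left h,
          inner_eq]
        simp [infinity]
  · refine ⟨P + infinity, h, ?_⟩
    have h1 : ‖P‖ = ‖-infinity‖ := by
      rw [norm_neg, mem_sphere_zero_iff_norm.1 hP, mem_sphere_zero_iff_norm.1 infinity_mem]
    have h2 := Submodule.reflection_sub h1
    rw [sub_neg_eq_add, Submodule.reflection_orthogonal_apply] at h2
    exact neg_injective h2

lemma IsDistortedDisk.rotate {F : ℂ → Space} (hF : IsDistortedDisk F) (R : Space ≃ₗᵢ[ℝ] Space)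
    (hR : ∀ u v w, det₃ (R u) (R v) (R w) = det₃ u v w) : IsDistortedDisk (R ∘ F) where
  continuousOn := R.continuous.comp_continuousOn hF.continuousOn
  mapsTo z hz := by
    rw [domain, mem_sphere_zero_iff_norm, Function.comp_apply, R.norm_map]
    exact mem_sphere_zero_iff_norm.1 (hF.mapsTo hz)
  contDiffOn := R.contDiff.comp_contDiffOn hF.contDiffOn
  det_pos z hz := by
    rw [R.comp_fderiv']
    have h := hF.det_pos z hz
    change 0 < det₃ (R (F z)) (R (fderiv ℝ F z 1)) (R (fderiv ℝ F z Complex.I))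
    rw [hR]
    exact h
  locally_injective z hz := by
    obtain ⟨U, hU, h⟩ := hF.locally_injective z hz
    exact ⟨U, hU, R.injective.comp_injOn h⟩

lemma area_rotate (F : ℂ → Space) (R : Space ≃ₗᵢ[ℝ] Space) : area (R ∘ F) = area F := by
  unfold area diskArea pullbackMetric
  simp only [R.comp_fderiv']
  simp

lemma _root_.DistortedDisk.IsClosedCurve.comp_contDiff {E : Type*} [NormedAddCommGroup E]
    [NormedSpace ℝ E] {γ : ℝ → Space} (hγ : IsClosedCurve γ) {f : Space → E} {s : Set Space}
    (hs : range γ ⊆ s) (hf : ContDiffOn ℝ 1 f s) : IsClosedCurve (fun θ => f (γ θ)) where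
  continuous := hf.continuousOn.comp_continuous hγ.continuous fun θ => hs ⟨θ, rfl⟩
  periodic θ := by rw [hγ.periodic]
  piecewise := by
    obtain ⟨n, t, h1, h2, h3, h4⟩ := hγ.piecewise
    exact ⟨n, t, h1, h2, h3, fun i hi => hf.comp (h4 i hi) fun θ _ => hs ⟨θ, rfl⟩⟩

/-! ### The stereographic projection -/

/-- The inverse of the coordinate `coord`. -/
def invCoord (w : ℂ) : Space :=
  !₂[2 * w.re / (1 + w.re ^ 2 + w.im ^ 2), 2 * w.im / (1 + w.re ^ 2 + w.im ^ 2),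
    (1 - w.re ^ 2 - w.im ^ 2) / (1 + w.re ^ 2 + w.im ^ 2)]

lemma one_add_sq_pos (w : ℂ) : 0 < 1 + w.re ^ 2 + w.im ^ 2 := by positivity

lemma invCoord_mem (w : ℂ) : invCoord w ∈ domain := by
  have := (one_add_sq_pos w).ne'
  rw [mem_domain_iff]
  simp only [invCoord]
  simp
  field_simp
  ring

lemma coord_invCoord (w : ℂ) : coord (invCoord w) = w := by
  have h := (one_add_sq_pos w).ne'
  have h1 : 1 + (1 - w.re ^ 2 - w.im ^ 2) / (1 + w.re ^ 2 + w.im ^ 2) =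
      2 / (1 + w.re ^ 2 + w.im ^ 2) := by
    field_simp
    ring
  have h2 : coord (invCoord w) =
      ((2 * w.re / (1 + w.re ^ 2 + w.im ^ 2) : ℝ) +
        (2 * w.im / (1 + w.re ^ 2 + w.im ^ 2) : ℝ) * Complex.I) /
      ((1 + (1 - w.re ^ 2 - w.im ^ 2) / (1 + w.re ^ 2 + w.im ^ 2) : ℝ) : ℂ) := by
    simp [coord, invCoord]
  rw [h2, h1]
  apply Complex.ext
  · rw [Complex.div_ofReal_re]
    simp only [Complex.add_re, Complex.ofReal_re, Complex.mul_re, Complex.I_re, Complex.I_im,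
      Complex.ofReal_im]
    field_simp
    ring
  · rw [Complex.div_ofReal_im]
    simp only [Complex.add_im, Complex.ofReal_re, Complex.mul_im, Complex.I_re, Complex.I_im,
      Complex.ofReal_im]
    field_simp
    ring

lemma isLift_unique {u v : Space} {p : ℂ × ℂ} (hu : IsLift u p) (hv : IsLift v p) : u = v :=
  hu.eq_of_wedge_eq_zero hv (by rw [wedge]; ring)

lemma invCoord_ne_infinity (w : ℂ) : invCoord w ≠ infinity := by
  intro h
  have h1 := congrArg (fun v : Space => v 2) h
  simp only [invCoord, infinity] at h1
  simp at h1
  have h2 := one_add_sq_pos w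
  rw [div_eq_iff h2.ne'] at h1
  linarith

lemma invCoord_coord {P : Space} (hP : P ∈ domain) (h : P ≠ infinity) : invCoord (coord P) = P := by
  have h1 := isLift_coord (invCoord_mem (coord P)) (invCoord_ne_infinity _)
  rw [coord_invCoord] at h1
  exact isLift_unique h1 (isLift_coord hP h)

lemma contDiff_invCoord : ContDiff ℝ 1 invCoord := by
  have h1 : ContDiff ℝ 1 Complex.re := Complex.reCLM.contDiff
  have h2 : ContDiff ℝ 1 Complex.im := Complex.imCLM.contDiff
  rw [contDiff_euclidean]
  intro i
  fin_cases i
  · exact (ContDiff.div (by fun_prop) (by fun_prop) fun w => (one_add_sq_pos w).ne' :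
      ContDiff ℝ 1 fun w : ℂ => 2 * w.re / (1 + w.re ^ 2 + w.im ^ 2))
  · exact (ContDiff.div (by fun_prop) (by fun_prop) fun w => (one_add_sq_pos w).ne' :
      ContDiff ℝ 1 fun w : ℂ => 2 * w.im / (1 + w.re ^ 2 + w.im ^ 2))
  · exact (ContDiff.div (by fun_prop) (by fun_prop) fun w => (one_add_sq_pos w).ne' :
      ContDiff ℝ 1 fun w : ℂ => (1 - w.re ^ 2 - w.im ^ 2) / (1 + w.re ^ 2 + w.im ^ 2))

lemma contDiffOn_coord : ContDiffOn ℝ 1 coord {v | 1 + v 2 ≠ 0} := by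
  have h : ∀ i, ContDiff ℝ 1 (fun v : Space => (v i : ℂ)) := fun i =>
    (Complex.ofRealCLM.comp (EuclideanSpace.proj i : Space →L[ℝ] ℝ)).contDiff
  have h0 := h 0
  have h1 := h 1
  have h2 := h 2
  have hn : ContDiff ℝ 1 fun v : Space => (v 0 + v 1 * Complex.I : ℂ) :=
    h0.add (h1.mul contDiff_const)
  have hd : ContDiff ℝ 1 fun v : Space => (1 + v 2 : ℂ) := contDiff_const.add h2
  refine hn.contDiffOn.mul (hd.contDiffOn.inv fun v hv => ?_)
  have := Complex.ofReal_ne_zero.2 hv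
  simpa using this

lemma measurable_coord : Measurable coord := by
  unfold coord
  fun_prop

lemma _root_.Continuous.det₃ {X : Type*} [TopologicalSpace X] {f g h : X → Space}
    (hf : Continuous f) (hg : Continuous g) (hh : Continuous h) :
    Continuous fun x => det₃ (f x) (g x) (h x) := by
  simp only [det₃_eq]
  fun_prop

/-- Over a ball of the coordinate plane the spherical area is at most a constant times Lebesgue
measure, with the constant bounding the Jacobian of `invCoord`. This transfers the local
integrability of the winding number to the sphere. -/
lemma exists_lintegral_coord_le (R : ℝ) : ∃ C : ENNReal, C ≠ ⊤ ∧ ∀ f : ℂ → ENNReal, Measurable f →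
    ∫⁻ P in invCoord '' ball 0 R, f (coord P) ∂areaMeasure ≤ C * ∫⁻ w in ball 0 R, f w := by
  have hJ : Continuous fun w => det₃ (invCoord w) (fderiv ℝ invCoord w 1)
      (fderiv ℝ invCoord w Complex.I) := by
    have h1 := contDiff_invCoord.continuous_fderiv one_ne_zero
    have h2 := h1.clm_apply (continuous_const (y := (1 : ℂ)))
    have h3 := h1.clm_apply (continuous_const (y := Complex.I))
    have h4 := contDiff_invCoord.continuous
    exact h4.det₃ h2 h3
  obtain ⟨C, hC⟩ := (isCompact_closedBall (0 : ℂ) R).exists_bound_of_continuousOn hJ.continuousOn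
  refine ⟨ENNReal.ofReal C, ENNReal.ofReal_ne_top, fun f hf => ?_⟩
  have hinj : Function.Injective invCoord := Function.LeftInverse.injective coord_invCoord
  have hle : (areaMeasure.restrict (invCoord '' ball 0 R)).map coord ≤
      ENNReal.ofReal C • volume.restrict (ball 0 R) := by
    refine Measure.le_iff.2 fun s hs => ?_
    have h1 : coord ⁻¹' s ∩ invCoord '' ball 0 R = invCoord '' (s ∩ ball 0 R) := by
      ext P
      constructor
      · rintro ⟨h1, w, hw, rfl⟩
        rw [mem_preimage, coord_invCoord] at h1
        exact ⟨w, ⟨h1, hw⟩, rfl⟩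
      · rintro ⟨w, ⟨h1, hw⟩, rfl⟩
        refine ⟨?_, w, hw, rfl⟩
        rwa [mem_preimage, coord_invCoord]
    have hm := hs.inter (measurableSet_ball (x := (0 : ℂ)) (ε := R))
    rw [Measure.map_apply measurable_coord hs, Measure.restrict_apply (measurable_coord hs), h1,
      areaMeasure_image isOpen_univ contDiff_invCoord.contDiffOn (subset_univ _) hm hinj.injOn
        fun w _ => invCoord_mem w, Measure.smul_apply, Measure.restrict_apply hs, smul_eq_mul,
      ← setLIntegral_const]
    exact setLIntegral_mono' hm fun w hw =>
      ENNReal.ofReal_le_ofReal (hC w (ball_subset_closedBall hw.2))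
  rw [← lintegral_map hf measurable_coord]
  refine (lintegral_mono' hle le_rfl).trans (le_of_eq ?_)
  rw [lintegral_smul_measure, smul_eq_mul]

/-- If `Γ = k • (1, c)` with `c = coord γ`, the two wedges are `k * (c - w)` and `-k`; the unknown
scalar cancels in the quotient. -/
lemma IsCurveLift.hasDegree_coord {γ : ℝ → Space} {Γ : ℝ → ℂ × ℂ} (hΓ : IsCurveLift γ Γ)
    (hγd : range γ ⊆ domain) (hγ : infinity ∉ range γ) {w : ℂ} {m n : ℤ}
    (hm : HasDegree (fun θ => wedge (1, w) (Γ θ)) m)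
    (hn : HasDegree (fun θ => wedge (0, 1) (Γ θ)) n) :
    HasDegree (fun θ => coord (γ θ) - w) (m - n) := by
  have h1 := (hm.div hn).mul (HasDegree.const (c := -1) (by norm_num))
  rw [add_zero] at h1
  convert h1 using 2 with θ
  have h2 := (isLift_coord (hγd ⟨θ, rfl⟩) fun h => hγ ⟨θ, h⟩).wedge_eq_zero (hΓ.isLift θ)
  have h3 := hn.ne_zero θ
  simp only [wedge] at h2 h3 ⊢
  rw [div_mul_eq_mul_div, eq_div_iff h3]
  linear_combination h2

lemma isClosedCurve_coord {γ : ℝ → Space} (hγ : IsClosedCurve γ) (hγd : range γ ⊆ domain)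
    (h : infinity ∉ range γ) : IsClosedCurve (fun θ => coord (γ θ)) :=
  hγ.comp_contDiff (s := {v | 1 + v 2 ≠ 0})
    (fun _ hv => one_add_ne_zero (hγd hv) fun h0 => h (h0 ▸ hv)) contDiffOn_coord

lemma coord_notMem_range {γ : ℝ → Space} (hγd : range γ ⊆ domain) (h : infinity ∉ range γ)
    {P : Space} (hP : P ∈ domain \ range γ) (hP' : P ≠ infinity) :
    coord P ∉ range fun θ => coord (γ θ) := by
  rintro ⟨θ, hθ⟩
  refine hP.2 ⟨θ, ?_⟩
  have h1 := invCoord_coord (hγd ⟨θ, rfl⟩) fun h0 => h ⟨θ, h0⟩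
  dsimp only at hθ
  rw [← h1, hθ, invCoord_coord hP.1 hP']

end Sphere

/-! ### Finite area and the sum over components on the sphere -/

lemma IsClosedCurve.measurable_windingNumber {γ : ℝ → ℂ} (hγ : IsClosedCurve γ) :
    Measurable (windingNumber γ) := by
  have h0 := hγ.continuous.measurable
  have h1 := measurable_deriv γ
  have h : StronglyMeasurable (Function.uncurry fun (w : ℂ) (θ : ℝ) => deriv γ θ / (γ θ - w)) := by
    refine Measurable.stronglyMeasurable ?_
    have : Measurable fun q : ℂ × ℝ => deriv γ q.2 / (γ q.2 - q.1) := by fun_prop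
    exact this
  have h2 : windingNumber γ = fun w => (2 * π * Complex.I)⁻¹ *
      ∫ θ in Ioc 0 (2 * π), deriv γ θ / (γ θ - w) := by
    funext w
    rw [windingNumber, intervalIntegral.integral_of_le Real.two_pi_pos.le]
  rw [h2]
  exact (h.integral_prod_right (ν := volume.restrict (Ioc 0 (2 * π)))).measurable.const_mul _

lemma IsClosedCurve.hasDegree_sub_of_le {γ : ℝ → ℂ} (hγ : IsClosedCurve γ) {R : ℝ}
    (hR : range γ ⊆ ball 0 R) {w : ℂ} (hw : R ≤ ‖w‖) : HasDegree (fun θ => γ θ - w) 0 := by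
  have h : ∀ θ, ‖γ θ‖ < R := fun θ => mem_ball_zero_iff.1 (hR ⟨θ, rfl⟩)
  have hw0 : w ≠ 0 := norm_pos_iff.1 (((norm_nonneg _).trans_lt (h 0)).trans_le hw)
  refine (HasDegree.const (neg_ne_zero.2 hw0)).of_norm_sub_lt
    (hγ.continuous.sub continuous_const) (fun θ => by rw [hγ.periodic]) fun θ => ?_
  rw [sub_neg_eq_add, sub_add_cancel, norm_neg]
  exact (h θ).trans_le hw

namespace Sphere

variable {γ : ℝ → Space} {F : ℂ → Space}

namespace IsDistortedDisk

lemma layers_eq_empty (hF : IsDistortedDisk F) {P : Space} (hP : P ∉ domain) :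
    layers F P = ∅ :=
  eq_empty_of_forall_notMem fun _ hz => hP (hz.2 ▸ hF.mapsTo (ball_subset_closedBall hz.1))

/-- Almost everywhere the number of layers is that at infinity plus the winding number of the
projected curve. The former is a constant on a space of finite area; the latter is integrable and
vanishes for coordinates outside a large ball. -/
lemma area_ne_top_of_infinity_notMem (hF : IsDistortedDisk F) (hγ : IsClosedCurve γ)
    (hγd : range γ ⊆ domain) (h : infinity ∉ range γ) (hγF : Bounds γ F) : area F ≠ ⊤ := by
  obtain ⟨Γ, hΓ, hlay, -⟩ := hF.exists_curveLift hγF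
  have hc := isClosedCurve_coord hγ hγd h
  obtain ⟨R, hR⟩ := hc.isCompact_range.isBounded.subset_ball (0 : ℂ)
  obtain ⟨C, hC, hle⟩ := exists_lintegral_coord_le R
  have hinf := hlay infinity h _ isLift_infinity
  have h1 : ∀ᵐ P ∂areaMeasure, Measure.count (ball (0 : ℂ) 1 ∩ F ⁻¹' {P}) ≤
      (layers F infinity).ncard + (invCoord '' ball 0 R).indicator
        (fun P => ‖windingNumber (fun θ => coord (γ θ)) (coord P)‖ₑ) P := by
    filter_upwards [measure_eq_zero_iff_ae_notMem.1 (areaMeasure_range hγ hγd)] with P hP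
    by_cases hPd : P ∈ domain
    swap
    · rw [count_layers (by simp [hF.layers_eq_empty hPd]), hF.layers_eq_empty hPd]
      simp
    by_cases hPi : P = infinity
    · rw [hPi, count_layers hinf.1]
      exact le_self_add
    obtain ⟨h2, h3⟩ := hlay P hP _ (isLift_coord hPd hPi)
    have h4 := hΓ.hasDegree_coord hγd h h3 hinf.2
    rw [count_layers h2]
    by_cases hPR : P ∈ invCoord '' ball 0 R
    · rw [indicator_of_mem hPR,
        hc.windingNumber_eq (coord_notMem_range hγd h ⟨hPd, hP⟩ hPi) h4, ← ofReal_norm,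
        Complex.norm_intCast, ← ENNReal.ofReal_natCast, ← ENNReal.ofReal_natCast,
        ← ENNReal.ofReal_add (Nat.cast_nonneg _) (abs_nonneg _)]
      refine ENNReal.ofReal_le_ofReal ?_
      push_cast
      linarith [le_abs_self (((layers F P).ncard : ℝ) - (layers F infinity).ncard)]
    · have h5 : R ≤ ‖coord P‖ := not_lt.1 fun h6 =>
        hPR ⟨coord P, mem_ball_zero_iff.2 h6, invCoord_coord hPd hPi⟩
      have h6 := h4.unique (hc.hasDegree_sub_of_le hR h5)
      have h7 : (layers F P).ncard = (layers F infinity).ncard := by omega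
      rw [h7]
      exact le_self_add
  have hm : MeasurableSet (invCoord '' ball 0 R) :=
    measurableSet_ball.image_of_continuousOn_injOn contDiff_invCoord.continuous.continuousOn
      (Function.LeftInverse.injective coord_invCoord).injOn
  rw [hF.area_eq]
  refine ne_top_of_le_ne_top ?_ (lintegral_mono_ae h1)
  rw [lintegral_add_left measurable_const, lintegral_const, lintegral_indicator hm]
  refine ENNReal.add_ne_top.2 ⟨ENNReal.mul_ne_top (ENNReal.natCast_ne_top _)
    (measure_ne_top _ _), ne_top_of_le_ne_top (ENNReal.mul_ne_top hC ?_)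
      (hle _ hc.measurable_windingNumber.enorm)⟩
  exact hc.lintegral_windingNumber_ne_top R

lemma area_ne_top (hF : IsDistortedDisk F) (hγ : IsClosedCurve γ) (hγd : range γ ⊆ domain)
    (hγF : Bounds γ F) : area F ≠ ⊤ := by
  -- The curve has area zero, so it misses a point, which is rotated to infinity.
  obtain ⟨P, hP, hP'⟩ : (domain \ range γ).Nonempty := by
    refine nonempty_of_measure_ne_zero (μ := areaMeasure) ?_
    rw [measure_sdiff_null (areaMeasure_range hγ hγd), areaMeasure_domain]
    exact areaMeasure_univ_ne_zero
  obtain ⟨R, hR, hdet⟩ := exists_rotation hP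
  rw [← area_rotate F R]
  refine (hF.rotate R hdet).area_ne_top_of_infinity_notMem (γ := fun θ => R (γ θ))
    (hγ.comp_contDiff (subset_univ _) R.contDiff.contDiffOn) ?_ ?_ ?_
  · rintro _ ⟨θ, rfl⟩
    rw [domain, mem_sphere_zero_iff_norm, R.norm_map]
    exact mem_sphere_zero_iff_norm.1 (hγd ⟨θ, rfl⟩)
  · rintro ⟨θ, hθ⟩
    exact hP' ⟨θ, R.injective (hθ.trans hR.symm)⟩
  · obtain ⟨φ, h1, h2, h3, h4⟩ := hγF
    exact ⟨φ, h1, h2, h3, fun θ => congrArg R (h4 θ)⟩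

end IsDistortedDisk

/-- Components are taken in the ambient space. They are compared with those of the sphere as a
space, which is locally connected because it is a manifold. -/
lemma isOpen_preimage_component {K Ω : Set Space} (hK : IsClosed K)
    (hΩ : Ω ∈ complementComponents domain K) :
    IsOpen ((Subtype.val : sphere (0 : Space) 1 → Space) ⁻¹' Ω) := by
  have : LocallyConnectedSpace (sphere (0 : Space) 1) :=
    ChartedSpace.locallyConnectedSpace (EuclideanSpace ℝ (Fin 2)) _
  obtain ⟨P, hP, rfl⟩ := hΩ
  have hU : IsOpen ((Subtype.val : sphere (0 : Space) 1 → Space) ⁻¹' K)ᶜ :=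
    (hK.preimage continuous_subtype_val).isOpen_compl
  have him : (Subtype.val : sphere (0 : Space) 1 → Space) ''
      (Subtype.val ⁻¹' K)ᶜ = domain \ K := by
    rw [← preimage_compl, Subtype.image_preimage_coe]
    rfl
  refine isOpen_iff_mem_nhds.2 fun Q hQ => ?_
  have hQ' : Q ∈ ((Subtype.val : sphere (0 : Space) 1 → Space) ⁻¹' K)ᶜ :=
    (connectedComponentIn_subset _ _ hQ).2
  refine Filter.mem_of_superset ((hU.connectedComponentIn (x := Q)).mem_nhds
    (mem_connectedComponentIn hQ')) ?_
  rw [← image_subset_iff, connectedComponentIn_eq hQ]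
  refine (isPreconnected_connectedComponentIn.image _
    continuous_subtype_val.continuousOn).subset_connectedComponentIn
      ⟨Q, mem_connectedComponentIn hQ', rfl⟩ ?_
  rw [← him]
  exact image_mono (connectedComponentIn_subset _ _)

lemma measurableSet_component {K Ω : Set Space} (hK : IsClosed K)
    (hΩ : Ω ∈ complementComponents domain K) : MeasurableSet Ω := by
  have h1 := measurableEmbedding_coe.measurableSet_image'
    (isOpen_preimage_component hK hΩ).measurableSet
  have h2 : Ω ⊆ sphere 0 1 := (subset_of_mem_complementComponents hΩ).trans sdiff_subset
  rwa [Subtype.image_preimage_coe, inter_eq_right.2 h2] at h1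

lemma nonempty_of_mem_complementComponents {K Ω : Set Space}
    (hΩ : Ω ∈ complementComponents domain K) : Ω.Nonempty := by
  obtain ⟨P, hP, rfl⟩ := hΩ
  exact ⟨P, mem_connectedComponentIn hP⟩

lemma countable_components {K : Set Space} (hK : IsClosed K) :
    Countable {Ω : Set Space // Ω ∈ complementComponents domain K} := by
  refine Pairwise.countable_of_isOpen_disjoint
    (s := fun Ω : {Ω : Set Space // Ω ∈ complementComponents domain K} =>
      (Subtype.val : sphere (0 : Space) 1 → Space) ⁻¹' Ω.1)
    (fun Ω₁ Ω₂ h => (pairwise_disjoint_components (fun _ h => h) h).preimage _)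
    (fun Ω => isOpen_preimage_component hK Ω.2) fun Ω => ?_
  obtain ⟨P, hP⟩ := nonempty_of_mem_complementComponents Ω.2
  exact ⟨⟨P, (subset_of_mem_complementComponents Ω.2 hP).1⟩, hP⟩

lemma IsDistortedDisk.hasSum_area (hF : IsDistortedDisk F) (hγ : IsClosedCurve γ)
    (hγd : range γ ⊆ domain) (hγF : Bounds γ F) {ν : Set Space → ℤ}
    (hν : ∀ Ω ∈ complementComponents domain (range γ), ∀ P ∈ Ω,
      (layers F P).Finite ∧ ((layers F P).ncard : ℤ) = ν Ω) :
    HasSum (fun Ω : {Ω : Set Space // Ω ∈ complementComponents domain (range γ)} =>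
      (ν Ω.1 : ℝ) * (setArea Ω.1).toReal) (area F).toReal := by
  have hK := hγ.isCompact_range.isClosed
  have hcount := countable_components hK
  have hfin := hF.area_ne_top hγ hγd hγF
  rw [hF.area_eq] at hfin ⊢
  have hpos : ∀ Ω ∈ complementComponents domain (range γ), 0 ≤ ν Ω := fun Ω hΩ => by
    obtain ⟨P, hP⟩ := nonempty_of_mem_complementComponents hΩ
    rw [← (hν Ω hΩ P hP).2]
    exact Int.natCast_nonneg _
  have key := hasSum_of_lintegral_ne_top
    (n := fun Ω : {Ω : Set Space // Ω ∈ complementComponents domain (range γ)} => (ν Ω.1).toNat)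
    (fun Ω => measurableSet_component hK Ω.2) (pairwise_disjoint_components fun _ h => h)
    (fun Ω P hP => ?_) ?_ hfin
  · convert key using 3 with Ω
    · exact_mod_cast (Int.toNat_of_nonneg (hpos Ω.1 Ω.2)).symm
    · rw [areaMeasure_apply]
  · rw [count_layers (hν Ω.1 Ω.2 P hP).1, ← (hν Ω.1 Ω.2 P hP).2]
    simp
  · filter_upwards [measure_eq_zero_iff_ae_notMem.1 (areaMeasure_range hγ hγd)] with P hP hP'
    have hPd : P ∉ domain := fun hPd => hP' (mem_iUnion.2
      ⟨⟨_, P, ⟨hPd, hP⟩, rfl⟩, mem_connectedComponentIn ⟨hPd, hP⟩⟩)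
    rw [count_layers (by simp [hF.layers_eq_empty hPd]), hF.layers_eq_empty hPd]
    simp

lemma isCurveLift_coord (hγ : IsClosedCurve γ) (hγd : range γ ⊆ domain)
    (h : infinity ∉ range γ) : IsCurveLift γ fun θ => (1, coord (γ θ)) where
  continuous := continuous_const.prodMk (isClosedCurve_coord hγ hγd h).continuous
  periodic θ := by rw [hγ.periodic]
  isLift θ := isLift_coord (hγd ⟨θ, rfl⟩) fun h0 => h ⟨θ, h0⟩

/-- A lift of the curve whose degrees count the layers of every distorted disk bounded by it. -/
lemma exists_curveLift_forall (h : ∃ Γ, IsCurveLift γ Γ) : ∃ Γ, IsCurveLift γ Γ ∧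
    ∀ F, IsDistortedDisk F → Bounds γ F → ∀ P ∈ domain \ range γ, ∀ p, IsLift P p →
      (layers F P).Finite ∧ HasDegree (fun θ => wedge p (Γ θ)) (layers F P).ncard := by
  by_cases hF : ∃ F, IsDistortedDisk F ∧ Bounds γ F
  · obtain ⟨F₀, hF₀, hb₀⟩ := hF
    -- The boundary lift of one disk, with its rotated wedge of degree one, serves for all disks
    -- bounded by `γ`.
    obtain ⟨Γ, hΓ, -, hd⟩ := hF₀.exists_curveLift hb₀
    refine ⟨Γ, hΓ, fun F hF hb P hP p hp => ?_⟩
    obtain ⟨Γ', hΓ', hl', hd'⟩ := hF.exists_curveLift hb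
    obtain ⟨h1, h2⟩ := hl' P hP.2 p hp
    obtain ⟨n, hn⟩ := hΓ.exists_hasDegree hP
    refine ⟨h1, ?_⟩
    rw [← hΓ.hasDegree_eq hΓ' hd hd' (hn p hp) h2]
    exact hn p hp
  · obtain ⟨Γ, hΓ⟩ := h
    exact ⟨Γ, hΓ, fun F h1 h2 => (hF ⟨F, h1, h2⟩).elim⟩

/-- The numbers of layers are determined by the curve. -/
lemma exists_layer_numbers (hγ : IsClosedCurve γ) (hγd : range γ ⊆ domain) :
    ∃ ν : Set Space → ℤ,
      (infinity ∉ range γ → ∀ Ω₀ ∈ complementComponents domain (range γ), infinity ∈ Ω₀ →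
        ∀ Ω ∈ complementComponents domain (range γ), ∀ P ∈ Ω, P ≠ infinity →
          windingNumber (fun θ => coord (γ θ)) (coord P) = ν Ω - ν Ω₀) ∧
      ∀ F, IsDistortedDisk F → Bounds γ F → ∀ Ω ∈ complementComponents domain (range γ),
        ∀ P ∈ Ω, (layers F P).Finite ∧ ((layers F P).ncard : ℤ) = ν Ω := by
  by_cases h : ∃ Γ, IsCurveLift γ Γ
  · obtain ⟨Γ, hΓ, hl⟩ := exists_curveLift_forall h
    obtain ⟨ν, hν⟩ := hΓ.exists_component_degree
    refine ⟨ν, fun hi Ω₀ hΩ₀ hi₀ Ω hΩ P hP hPi => ?_, fun F hF hb Ω hΩ P hP => ?_⟩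
    · have hPm := subset_of_mem_complementComponents hΩ hP
      have h1 := hΓ.hasDegree_coord hγd hi (hν Ω hΩ P hP _ (isLift_coord hPm.1 hPi))
        (hν Ω₀ hΩ₀ _ hi₀ _ isLift_infinity)
      rw [(isClosedCurve_coord hγ hγd hi).windingNumber_eq
        (coord_notMem_range hγd hi hPm hPi) h1]
      push_cast
      rfl
    · have hPm := subset_of_mem_complementComponents hΩ hP
      obtain ⟨p, hp⟩ := exists_isLift hPm.1
      obtain ⟨h1, h2⟩ := hl F hF hb P hPm p hp
      exact ⟨h1, h2.unique (hν Ω hΩ P hP p hp)⟩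
  -- A curve avoiding infinity has the lift `(1, coord γ)`, and a curve bounding a disk has the
  -- boundary lift. Without any closed lift both claims are therefore vacuous.
  · refine ⟨0, fun hi => (h ⟨_, isCurveLift_coord hγ hγd hi⟩).elim, fun F hF hb => ?_⟩
    obtain ⟨Γ, hΓ, -⟩ := hF.exists_curveLift hb
    exact (h ⟨Γ, hΓ⟩).elim

/-- The theorem for the round sphere. -/
theorem area_eq_sum (hγ : IsClosedCurve γ) (hγd : range γ ⊆ domain) :
    (∃ ν : Set Space → ℤ,
      (infinity ∉ range γ → ∀ Ω₀ ∈ complementComponents domain (range γ), infinity ∈ Ω₀ →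
        ∀ Ω ∈ complementComponents domain (range γ), ∀ P ∈ Ω, P ≠ infinity →
          windingNumber (fun θ => coord (γ θ)) (coord P) = ν Ω - ν Ω₀) ∧
      ∀ F : ℂ → Space, IsDistortedDisk F → Bounds γ F →
        (∀ Ω ∈ complementComponents domain (range γ), ∀ P ∈ Ω,
          (layers F P).Finite ∧ ((layers F P).ncard : ℤ) = ν Ω) ∧
        area F ≠ ⊤ ∧
        HasSum (fun Ω : {Ω : Set Space // Ω ∈ complementComponents domain (range γ)} =>
          (ν Ω.1 : ℝ) * (setArea Ω.1).toReal) (area F).toReal) ∧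
    ∀ F₁ F₂ : ℂ → Space, IsDistortedDisk F₁ → IsDistortedDisk F₂ →
      Bounds γ F₁ → Bounds γ F₂ → area F₁ = area F₂ := by
  obtain ⟨ν, hν, hl⟩ := exists_layer_numbers hγ hγd
  have hsum := fun F (hF : IsDistortedDisk F) (hb : Bounds γ F) =>
    hF.hasSum_area hγ hγd hb (hl F hF hb)
  have hfin := fun F (hF : IsDistortedDisk F) (hb : Bounds γ F) => hF.area_ne_top hγ hγd hb
  refine ⟨⟨ν, hν, fun F hF hb => ⟨hl F hF hb, hfin F hF hb, hsum F hF hb⟩⟩,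
    fun F₁ F₂ h₁ h₂ hb₁ hb₂ => ?_⟩
  rw [← ENNReal.toReal_eq_toReal_iff' (hfin F₁ h₁ hb₁) (hfin F₂ h₂ hb₂)]
  exact (hsum F₁ h₁ hb₁).unique (hsum F₂ h₂ hb₂)

end Sphere

end DistortedDisk

end

theorem mainTheorem6 :
    -- the Euclidean plane and the hyperbolic plane
    (∀ (G : DistortedDisk.PlaneGeometry) (γ : ℝ → ℂ),
      DistortedDisk.IsClosedCurve γ → range γ ⊆ G.domain →
      (∃ ν : Set ℂ → ℤ,
        (∀ Ω ∈ DistortedDisk.complementComponents univ (range γ), ∀ P ∈ Ω,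
          DistortedDisk.windingNumber γ P = ν Ω) ∧
        ∀ F : ℂ → ℂ, G.IsDistortedDisk F → DistortedDisk.Bounds γ F →
          (∀ Ω ∈ DistortedDisk.complementComponents univ (range γ), ∀ P ∈ Ω,
            (DistortedDisk.layers F P).Finite ∧
              ((DistortedDisk.layers F P).ncard : ℤ) = ν Ω) ∧
          G.area F ≠ ⊤ ∧
          HasSum (fun Ω : {Ω : Set ℂ //
              Ω ∈ DistortedDisk.complementComponents univ (range γ) ∧ Bornology.IsBounded Ω} =>
            (ν Ω.1 : ℝ) * (G.setArea Ω.1).toReal) (G.area F).toReal) ∧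
      ∀ F₁ F₂ : ℂ → ℂ, G.IsDistortedDisk F₁ → G.IsDistortedDisk F₂ →
        DistortedDisk.Bounds γ F₁ → DistortedDisk.Bounds γ F₂ → G.area F₁ = G.area F₂) ∧
    -- the round sphere
    (∀ γ : ℝ → DistortedDisk.Space,
      DistortedDisk.IsClosedCurve γ → range γ ⊆ DistortedDisk.Sphere.domain →
      (∃ ν : Set DistortedDisk.Space → ℤ,
        (DistortedDisk.Sphere.infinity ∉ range γ →
          ∀ Ω₀ ∈ DistortedDisk.complementComponents DistortedDisk.Sphere.domain (range γ),
          DistortedDisk.Sphere.infinity ∈ Ω₀ →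
          ∀ Ω ∈ DistortedDisk.complementComponents DistortedDisk.Sphere.domain (range γ),
          ∀ P ∈ Ω, P ≠ DistortedDisk.Sphere.infinity →
            DistortedDisk.windingNumber (fun θ => DistortedDisk.Sphere.coord (γ θ))
              (DistortedDisk.Sphere.coord P) = ν Ω - ν Ω₀) ∧
        ∀ F : ℂ → DistortedDisk.Space,
          DistortedDisk.Sphere.IsDistortedDisk F → DistortedDisk.Bounds γ F →
          (∀ Ω ∈ DistortedDisk.complementComponents DistortedDisk.Sphere.domain (range γ),
            ∀ P ∈ Ω, (DistortedDisk.layers F P).Finite ∧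
              ((DistortedDisk.layers F P).ncard : ℤ) = ν Ω) ∧
          DistortedDisk.Sphere.area F ≠ ⊤ ∧
          HasSum (fun Ω : {Ω : Set DistortedDisk.Space //
              Ω ∈ DistortedDisk.complementComponents DistortedDisk.Sphere.domain (range γ)} =>
            (ν Ω.1 : ℝ) * (DistortedDisk.Sphere.setArea Ω.1).toReal)
            (DistortedDisk.Sphere.area F).toReal) ∧
      ∀ F₁ F₂ : ℂ → DistortedDisk.Space,
        DistortedDisk.Sphere.IsDistortedDisk F₁ → DistortedDisk.Sphere.IsDistortedDisk F₂ →
        DistortedDisk.Bounds γ F₁ → DistortedDisk.Bounds γ F₂ →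
        DistortedDisk.Sphere.area F₁ = DistortedDisk.Sphere.area F₂) :=
  ⟨fun G _ hγ _ => G.area_eq_sum hγ, fun _ hγ hγd => DistortedDisk.Sphere.area_eq_sum hγ hγd⟩
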